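/- Notation. For $x=(p,q)\in\mathbb F_2^{n}\times\mathbb F_2^{n}=\mathbb F_2^{2n}$ let $W_x=i^{p\cdot q}\bigotimes_{j=1}^n X^{p_j}Z^{q_j}$ be the Weyl operator, and let $[x,y]=\sum_{i}(x_iy_{n+i}+x_{n+i}y_i)\in\mathbb F_2$ be the symplectic product. A matrix $U\in\mathbb C^{2^n\times 2^n}$ is $k$-Pauli-dimensional if the span $S\subseteq\mathbb F_2^{2n}$ of its Pauli support $\{x:\operatorname{tr}(W_xU)\neq0\}$ has dimension $k$. A subspace $S$ has an $(a,b)$-decomposition if it has a basis $x_1,\dots,x_a,z_1,\dots,z_{a+b}$ with $[x_i,x_j]=[z_i,z_j]=0$ and $[x_i,z_j]=\delta_{ij}$ (so $\dim S=2a+b$). For $a+b\le n$, a matrix is $(a,b)$-block diagonal if it has the form $I^{\otimes(n-a-b)}\otimes\bigoplus_{y\in\{0,1\}^b}A_y$ with $A_y\in\mathbb C^{2^a\times2^a}$; a unitary is $(a,b,\varepsilon)$-approximately block diagonal if it is within operator-norm distance $\varepsilon$ of an $(a,b)$-block-diagonal unitary. **Lemma.** There is an algorithm (a single program for a word RAM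 with words of $O(\log(n+r))$ bits and unit-cost operations) that, given $n$ and vectors $g_1,\dots,g_r\in\mathbb F_2^{2n}$, outputs a Clifford circuit $\widetilde C$ on $n$ qubits (a list of Hadamard, phase and CNOT gates) and integers $a',b'\ge0$, in at most $O(nk^2+1)$ steps for every $k\ge r$ (that is, $O(nk^2)$ when $n,k\ge1$), such that the following holds. Let $U\in\mathbb C^{2^n\times2^n}$ be a $k$-Pauli-dimensional unitary with $k\ge r$, let $S$ be the span of its Pauli support, let $S$ have an $(a,b)$-decomposition, and let $\varepsilon\ge0$. If $T=\langle g_1,\dots,g_r\rangle$ satisfies $T\subseteq S$ and $$\frac1{4^n}\sum_{x\in T}\bigl|\operatorname{tr}(UW_x)\bigr|^2\;\ge\;1-\frac{\varepsilon^2}{2^{a+b+1}},$$ then $a'+b'\le a+b$ and $\widetilde C\,U\,\widetilde C^\dagger$ is $(a',b',\varepsilon)$-approximately block diagonal. -/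

import Mathlib

open scoped Matrix Kronecker

/-! ### Pauli operators and the symplectic space `𝔽₂²ⁿ` -/

namespace PauliBD

/-- Computational basis labels of `n` qubits. Matrices in `ℂ^{2ⁿ × 2ⁿ}` are indexed by them. -/
abbrev Bits (n : ℕ) : Type := Fin n → ZMod 2

/-- Square matrices of size `2ⁿ`. -/
abbrev QMat (n : ℕ) : Type := Matrix (Bits n) (Bits n) ℂ

/-- The space `𝔽₂²ⁿ`, written as pairs `(a, b)` with `a, b ∈ 𝔽₂ⁿ`. -/
abbrev PauliVec (n : ℕ) : Type := Bits n × Bits n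

/-- The one-qubit Pauli matrix `X`. -/
def pauliX : Matrix (ZMod 2) (ZMod 2) ℂ := fun x y => if x = y + 1 then 1 else 0

/-- The one-qubit Pauli matrix `Z`. -/
def pauliZ : Matrix (ZMod 2) (ZMod 2) ℂ :=
  Matrix.diagonal fun x => if x = 0 then 1 else -1

/-- The Weyl operator `W_{(a,b)} = i^{a·b} ⨂ⱼ X^{aⱼ} Z^{bⱼ}`; an entry of a tensor product is the
product of the entries of the factors. -/
noncomputable def weyl {n : ℕ} (v : PauliVec n) : QMat n := fun x y =>
  Complex.I ^ (∑ j, (v.1 j).val * (v.2 j).val) *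
    ∏ j, (pauliX ^ (v.1 j).val * pauliZ ^ (v.2 j).val) (x j) (y j)

/-- The symplectic product on `𝔽₂²ⁿ`. -/
def symp {n : ℕ} (v w : PauliVec n) : ZMod 2 := ∑ j, (v.1 j * w.2 j + v.2 j * w.1 j)

/-- The Pauli support of a matrix. -/
def pauliSupport {n : ℕ} (A : QMat n) : Set (PauliVec n) :=
  {v | (weyl v * A).trace ≠ 0}

/-- The subspace spanned by the Pauli support. -/
def supportSpan {n : ℕ} (A : QMat n) : Submodule (ZMod 2) (PauliVec n) :=
  Submodule.span (ZMod 2) (pauliSupport A)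

/-- `A` is `k`-Pauli-dimensional. -/
def IsPauliDimensional {n : ℕ} (k : ℕ) (A : QMat n) : Prop :=
  Module.finrank (ZMod 2) (supportSpan A) = k

open Classical in
/-- The Pauli weight `4⁻ⁿ ∑_{v ∈ T} |tr(A W_v)|²` that `A` has on `T`. -/
noncomputable def pauliWeight {n : ℕ} (A : QMat n) (T : Submodule (ZMod 2) (PauliVec n)) : ℝ :=
  (1 / 4 ^ n) * ∑ v : PauliVec n with v ∈ T, ‖(A * weyl v).trace‖ ^ 2

/-- `S` has a basis `x₁, …, x_a, z₁, …, z_{a+b}` with `[xᵢ,xⱼ] = [zᵢ,zⱼ] = 0`, `[xᵢ,zⱼ] = δᵢⱼ`: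
a symplectic part of dimension `2a` and an isotropic part of dimension `b`. -/
def HasDecomposition {n : ℕ} (a b : ℕ) (S : Submodule (ZMod 2) (PauliVec n)) : Prop :=
  ∃ (x : Fin a → PauliVec n) (z : Fin (a + b) → PauliVec n),
    LinearIndependent (ZMod 2) (Sum.elim x z) ∧
    Submodule.span (ZMod 2) (Set.range x ∪ Set.range z) = S ∧
    (∀ i j, symp (x i) (x j) = 0) ∧
    (∀ i j, symp (z i) (z j) = 0) ∧
    (∀ i j, symp (x i) (z j) = if (i : ℕ) = (j : ℕ) then 1 else 0)

/-! ### Block-diagonal matrices -/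

/-- Splits an `n`-bit label `x y z` with `|x| = n - a - b`, `|y| = b`, `|z| = a` into
`(x, (z, y))`. -/
def splitBits {n : ℕ} (a b : ℕ) (h : a + b ≤ n) (u : Bits n) :
    Bits (n - a - b) × (Bits a × Bits b) :=
  (fun i => u ⟨i, by omega⟩,
    (fun i => u ⟨n - a + i, by omega⟩, fun i => u ⟨n - a - b + i, by omega⟩))

/-- `(a,b)`-block-diagonal: `A = I^{⊗(n-a-b)} ⊗ ⨁_{y ∈ {0,1}ᵇ} A_y` with `A_y ∈ ℂ^{2ᵃ × 2ᵃ}`. -/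
def IsBlockDiagonal {n : ℕ} (a b : ℕ) (A : QMat n) : Prop :=
  ∃ (h : a + b ≤ n) (B : Bits b → QMat a),
    A = ((1 : QMat (n - a - b)) ⊗ₖ Matrix.blockDiagonal B).submatrix
      (splitBits a b h) (splitBits a b h)

/-- The operator norm (largest singular value). -/
noncomputable def opNorm {n : ℕ} (A : QMat n) : ℝ :=
  ‖Matrix.toEuclideanCLM (n := Bits n) (𝕜 := ℂ) A‖

/-- `(a,b,ε)`-approximately block-diagonal unitary, in operator norm. -/
def IsApproxBlockDiagonal {n : ℕ} (a b : ℕ) (ε : ℝ) (U : QMat n) : Prop :=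
  U ∈ Matrix.unitaryGroup (Bits n) ℂ ∧
    ∃ V ∈ Matrix.unitaryGroup (Bits n) ℂ, IsBlockDiagonal a b V ∧ opNorm (U - V) ≤ ε

/-! ### Clifford circuits -/

/-- The elementary Clifford gates on `n` qubits. -/
inductive Gate (n : ℕ) : Type
  | had (q : Fin n)
  | phase (q : Fin n)
  | cnot (c t : Fin n) (h : c ≠ t)

/-- The one-qubit matrix `G` acting on qubit `q`. -/
def onQubit {n : ℕ} (q : Fin n) (G : Matrix (ZMod 2) (ZMod 2) ℂ) : QMat n := fun x y =>
  if ∀ j, j ≠ q → x j = y j then G (x q) (y q) else 0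

/-- The unitary of a gate: `H = (X + Z)/√2`, `S = diag(1, i)`,
`CNOT |y⟩ = |y with y_t replaced by y_t + y_c⟩`. -/
noncomputable def Gate.toMatrix {n : ℕ} : Gate n → QMat n
  | .had q => onQubit q ((1 / (Real.sqrt 2 : ℂ)) • (pauliX + pauliZ))
  | .phase q => onQubit q (Matrix.diagonal fun x => if x = 0 then 1 else Complex.I)
  | .cnot c t _ => fun x y => if x = Function.update y t (y t + y c) then 1 else 0

/-- The unitary of a Clifford circuit, i.e. of a list of gates; the head is applied first. -/
noncomputable def circuitMatrix {n : ℕ} : List (Gate n) → QMat n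
  | [] => 1
  | g :: L => circuitMatrix L * g.toMatrix

/-! ### Word RAM programs with a step count

Programs have registers and arrays (both indexed by naturals) that hold naturals, initially `0`.
Every elementary operation has unit cost, and a run is only legal if all values that occur in it,
array indices included, are below the word bound `M`. -/

/-- A memory: the contents of the registers and of the arrays. -/
structure Mem where
  reg : ℕ → ℕ
  arr : ℕ → ℕ → ℕ

/-- Expressions. -/
inductive Expr : Type
  | const (c : ℕ)
  | reg (x : ℕ)
  | load (A : ℕ) (i : Expr)
  | add (e f : Expr)
  | sub (e f : Expr)
  | mul (e f : Expr)
  | eq (e f : Expr)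
  | lt (e f : Expr)

/-- The value of an expression (`sub` is truncated, truth values are `0` and `1`). -/
def Expr.eval (m : Mem) : Expr → ℕ
  | .const c => c
  | .reg x => m.reg x
  | .load A i => m.arr A (i.eval m)
  | .add e f => e.eval m + f.eval m
  | .sub e f => e.eval m - f.eval m
  | .mul e f => e.eval m * f.eval m
  | .eq e f => if e.eval m = f.eval m then 1 else 0
  | .lt e f => if e.eval m < f.eval m then 1 else 0

/-- The number of elementary operations in the evaluation of an expression. -/
def Expr.cost : Expr → ℕ
  | .const _ => 1
  | .reg _ => 1
  | .load _ i => i.cost + 1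
  | .add e f => e.cost + f.cost + 1
  | .sub e f => e.cost + f.cost + 1
  | .mul e f => e.cost + f.cost + 1
  | .eq e f => e.cost + f.cost + 1
  | .lt e f => e.cost + f.cost + 1

/-- All values in the evaluation of an expression are below `M`. -/
def Expr.Fits (M : ℕ) (m : Mem) : Expr → Prop
  | .const c => c < M
  | .reg x => m.reg x < M
  | .load A i => i.Fits M m ∧ m.arr A (i.eval m) < M
  | .add e f => e.Fits M m ∧ f.Fits M m ∧ e.eval m + f.eval m < M
  | .sub e f => e.Fits M m ∧ f.Fits M m
  | .mul e f => e.Fits M m ∧ f.Fits M m ∧ e.eval m * f.eval m < M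
  | .eq e f => e.Fits M m ∧ f.Fits M m ∧ 1 < M
  | .lt e f => e.Fits M m ∧ f.Fits M m ∧ 1 < M

/-- Programs. -/
inductive Cmd : Type
  | skip
  | assign (x : ℕ) (e : Expr)
  | store (A : ℕ) (i e : Expr)
  | seq (p q : Cmd)
  | branch (e : Expr) (p q : Cmd)
  | loop (e : Expr) (p : Cmd)

/-- `Exec M p m t m'`: with word bound `M`, the program `p` started on the memory `m` halts after
exactly `t` steps with the memory `m'`. -/
inductive Exec (M : ℕ) : Cmd → Mem → ℕ → Mem → Prop
  | skip (m : Mem) : Exec M .skip m 1 m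
  | assign (m : Mem) (x : ℕ) (e : Expr) (h : e.Fits M m) :
      Exec M (.assign x e) m (e.cost + 1) ⟨Function.update m.reg x (e.eval m), m.arr⟩
  | store (m : Mem) (A : ℕ) (i e : Expr) (hi : i.Fits M m) (he : e.Fits M m) :
      Exec M (.store A i e) m (i.cost + e.cost + 1)
        ⟨m.reg, Function.update m.arr A (Function.update (m.arr A) (i.eval m) (e.eval m))⟩
  | seq (p q : Cmd) (m m' m'' : Mem) (s t : ℕ) (hp : Exec M p m s m') (hq : Exec M q m' t m'') :
      Exec M (.seq p q) m (s + t) m''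
  | branch_true (e : Expr) (p q : Cmd) (m m' : Mem) (t : ℕ) (h : e.Fits M m) (h1 : e.eval m ≠ 0)
      (hp : Exec M p m t m') : Exec M (.branch e p q) m (e.cost + 1 + t) m'
  | branch_false (e : Expr) (p q : Cmd) (m m' : Mem) (t : ℕ) (h : e.Fits M m) (h0 : e.eval m = 0)
      (hq : Exec M q m t m') : Exec M (.branch e p q) m (e.cost + 1 + t) m'
  | loop_true (e : Expr) (p : Cmd) (m m' m'' : Mem) (s t : ℕ) (h : e.Fits M m) (h1 : e.eval m ≠ 0)
      (hp : Exec M p m s m') (hl : Exec M (.loop e p) m' t m'') :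
      Exec M (.loop e p) m (e.cost + 1 + s + t) m''
  | loop_false (e : Expr) (p : Cmd) (m : Mem) (h : e.Fits M m) (h0 : e.eval m = 0) :
      Exec M (.loop e p) m (e.cost + 1) m

/-- Bit `j` of a vector of `𝔽₂²ⁿ` (first the `n` bits of `a`, then those of `b`). -/
def pauliBit {n : ℕ} (v : PauliVec n) (j : ℕ) : ℕ :=
  if h : j < n then (v.1 ⟨j, h⟩).val
  else if h : j - n < n then (v.2 ⟨j - n, h⟩).val
  else 0

/-- The initial memory on the input `g₀, …, g_{r-1} ∈ 𝔽₂²ⁿ`: register `0` holds `n`, register `1`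
holds `r`, array `0` holds the bits of the vectors, row after row. All other cells are `0`. -/
def inputMem {n r : ℕ} (g : Fin r → PauliVec n) : Mem where
  reg x := if x = 0 then n else if x = 1 then r else 0
  arr A p := if A = 0 then (if h : p / (2 * n) < r then pauliBit (g ⟨p / (2 * n), h⟩) (p % (2 * n))
    else 0) else 0

/-- The three words that describe a gate. -/
def Gate.code {n : ℕ} : Gate n → ℕ × ℕ × ℕ
  | .had q => (0, q, 0)
  | .phase q => (1, q, 0)
  | .cnot c t _ => (2, c, t)

/-- The final memory `m` holds the output `(circ, a', b')`: register `2` holds the number of gates,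
registers `3` and `4` hold `a'` and `b'`, and array `1` lists the gates, three words each. -/
def IsOutput {n : ℕ} (m : Mem) (circ : List (Gate n)) (a' b' : ℕ) : Prop :=
  m.reg 2 = circ.length ∧ m.reg 3 = a' ∧ m.reg 4 = b' ∧
    ∀ (i : ℕ) (h : i < circ.length),
      (m.arr 1 (3 * i), m.arr 1 (3 * i + 1), m.arr 1 (3 * i + 2)) = (circ[i]).code

end PauliBD

/-!
Conjugation by a Clifford circuit permutes the Weyl operators up to phases, and the permutation is
a linear symplectic map of `𝔽₂²ⁿ` (`circuitAct`, `circuitMatrix_mul_weyl`). The theorem rests on two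
facts about this action.

*Standardization.* For every subspace `T` there is a circuit whose action maps `T` onto `blockLabels
n a' b'`, the labels of the `(a', b')`-block diagonal Weyl operators: those that are arbitrary on
the last `a'` qubits, products of `Z` on the `b'` qubits before, and trivial elsewhere. Such a
circuit is found by symplectic elimination on the input vectors. The qubits `≥ h` are in use
already. A first pass looks for pairs of vectors that anticommute on the free qubits `< h`: gates on
these qubits turn one of them into `Z_q` with `q = h - 1`, further gates that fix `Z_q` turn the
other into `X_q`, and the pair occupies the qubit `q`, which is of the last kind. Once there are no
such pairs, all vectors commute on the free qubits, and in a second pass each of them either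
vanishes there or is turned into `Z_q` and occupies a qubit of the middle kind. No row operations
are performed: the parts of the vectors on the used qubits lie in the span of the vectors processed
before and are ignored, which is what the invariants `PairInv` and `ZInv` express, and
`ZInv.span_eq` recovers the span at the end. Each vector costs `O(n)` gates of `O(r)` steps each and
`O(nr)` steps for the search for a partner, so the running time is `O(nr²)` (`exists_exec_mainCmd`,
`mainTime_le`). A standardized `T` contains an isotropic subspace of dimension `a' + b'`, whereas
those of `S` have dimension at most `a + b` (`add_le_of_map_eq_blockLabels`).

*Rounding.* After conjugation by this circuit, the weight hypothesis says that the projection `B` of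
the unitary `U` to the block diagonal matrices satisfies `‖B‖_F² ≥ (1 - ε² / 2^(a+b+1)) 2ⁿ`. The
blocks of `B` are averages of submatrices of a unitary, hence contractions, and the singular value
decomposition of each of them gives a block diagonal unitary `V` with `Re tr(B† V) ≥ ‖B‖_F²`
(`exists_unitary_blockMat_near`), so `‖U - V‖_F² ≤ 2ⁿ ε² / 2^(a+b)`. The Pauli support of `U - V`
lies in the image of `S`. That space is itself standardized by some circuit, so up to conjugation
`U - V` is `I^{⊗(n - d)} ⊗ A` with `d ≤ a + b`; the repetition of `A` improves the bound
`‖·‖_op ≤ ‖·‖_F` by the factor `2^(-(n - d) / 2)`, which gives `‖U - V‖_op ≤ ε`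
(`isApproxBlockDiagonal_of_weight`).
-/

namespace PauliBD

/-! ### Weyl operators as tensor products -/

/-- The tensor product `⨂ⱼ Aⱼ` of one-qubit matrices. -/
def tens {n : ℕ} (A : Fin n → Matrix (ZMod 2) (ZMod 2) ℂ) : QMat n :=
  fun x y => ∏ j, A j (x j) (y j)

/-- The exponent of `i` in the nonzero entry of `i^{ab} XᵃZᵇ` in column `y`. -/
def phaseExp (a b y : ZMod 2) : ℕ := a.val * b.val + 2 * (b.val * y.val)

/-- The one-qubit Weyl operator `i^{ab} XᵃZᵇ`, entrywise. -/
noncomputable def weylFactor (a b : ZMod 2) : Matrix (ZMod 2) (ZMod 2) ℂ := fun x y =>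
  if x = y + a then Complex.I ^ phaseExp a b y else 0

lemma forall_zmod_two {P : ZMod 2 → Prop} : (∀ x, P x) ↔ P 0 ∧ P 1 :=
  ⟨fun h => ⟨h 0, h 1⟩, fun h x => by fin_cases x <;> [exact h.1; exact h.2]⟩

lemma sum_zmod_two {M : Type*} [AddCommMonoid M] (f : ZMod 2 → M) : ∑ x, f x = f 0 + f 1 :=
  Fin.sum_univ_two f

lemma zmod_two_val_one : (1 : ZMod 2).val = 1 := rfl

lemma zmod_two_one_add_one : (1 : ZMod 2) + 1 = 0 := rfl

lemma weylFactor_eq (a b x y : ZMod 2) :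
    weylFactor a b x y = Complex.I ^ (a.val * b.val) * (pauliX ^ a.val * pauliZ ^ b.val) x y := by
  revert a b x y
  simp [forall_zmod_two, weylFactor, phaseExp, pauliX, pauliZ, zmod_two_val_one, Matrix.mul_apply,
    sum_zmod_two, zmod_two_one_add_one, Matrix.diagonal_apply, pow_succ, pow_zero]

lemma weyl_eq_tens {n : ℕ} (v : PauliVec n) :
    weyl v = tens fun j => weylFactor (v.1 j) (v.2 j) := by
  ext x y
  simp only [weyl, tens, weylFactor_eq, Finset.prod_mul_distrib, Finset.prod_pow_eq_pow_sum]

lemma tens_mul {n : ℕ} (A B : Fin n → Matrix (ZMod 2) (ZMod 2) ℂ) :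
    tens A * tens B = tens fun j => A j * B j := by
  ext x y
  simp only [tens, Matrix.mul_apply, ← Finset.prod_mul_distrib]
  rw [Finset.prod_univ_sum]
  simp

lemma trace_tens {n : ℕ} (A : Fin n → Matrix (ZMod 2) (ZMod 2) ℂ) :
    (tens A).trace = ∏ j, (A j).trace := by
  simp only [tens, Matrix.trace, Matrix.diag]
  rw [Finset.prod_univ_sum]
  simp

lemma tens_conjTranspose {n : ℕ} (A : Fin n → Matrix (ZMod 2) (ZMod 2) ℂ) :
    (tens A)ᴴ = tens fun j => (A j)ᴴ := by
  ext x y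
  simp [tens, Matrix.conjTranspose_apply]

lemma tens_one {n : ℕ} : (tens fun _ => 1 : QMat n) = 1 := by
  ext x y
  simp only [tens, Matrix.one_apply, Finset.prod_ite_zero, Finset.prod_const_one]
  simp [funext_iff]

lemma weyl_conjTranspose {n : ℕ} (v : PauliVec n) : (weyl v)ᴴ = weyl v := by
  have h : ∀ a b x y : ZMod 2, star (weylFactor a b y x) = weylFactor a b x y := by
    simp [forall_zmod_two, weylFactor, phaseExp, zmod_two_val_one, zmod_two_one_add_one, pow_succ]
  rw [weyl_eq_tens, tens_conjTranspose]
  congr 1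
  ext j x y
  exact h _ _ _ _

lemma trace_weylFactor_mul (a b a' b' : ZMod 2) :
    (weylFactor a b * weylFactor a' b').trace = if a = a' ∧ b = b' then 2 else 0 := by
  revert a b a' b'
  simp [forall_zmod_two, Matrix.trace, weylFactor, phaseExp, zmod_two_val_one, Matrix.mul_apply,
    sum_zmod_two, zmod_two_one_add_one, pow_succ]
  norm_num

/-- The Weyl operators are orthogonal for the trace inner product. -/
lemma trace_weyl_mul_weyl {n : ℕ} (v w : PauliVec n) :
    (weyl v * weyl w).trace = if v = w then 2 ^ n else 0 := by
  rw [weyl_eq_tens, weyl_eq_tens, tens_mul, trace_tens]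
  simp only [trace_weylFactor_mul]
  rw [Finset.prod_ite_zero]
  simp [Prod.ext_iff, funext_iff, forall_and]

lemma linearIndependent_weyl (n : ℕ) : LinearIndependent ℂ (weyl : PauliVec n → QMat n) := by
  rw [Fintype.linearIndependent_iff]
  intro c hc v
  have h := congrArg (fun A => (weyl v * A).trace) hc
  simpa [Finset.mul_sum, Matrix.trace_sum, trace_weyl_mul_weyl] using h

/-- Expansion in the Weyl basis. -/
lemma weyl_expansion {n : ℕ} (A : QMat n) :
    A = ∑ v, ((2 ^ n : ℂ)⁻¹ * (weyl v * A).trace) • weyl v := by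
  have hcard : Fintype.card (PauliVec n) = Module.finrank ℂ (QMat n) := by
    simp [Module.finrank_matrix]
  let b := basisOfLinearIndependentOfCardEqFinrank (linearIndependent_weyl n) hcard
  have hb : ∀ v, b v = weyl v := fun v => by simp [b]
  have hA := (b.sum_repr A).symm
  simp only [hb] at hA
  have hc : ∀ v, (2 ^ n : ℂ)⁻¹ * (weyl v * A).trace = b.repr A v := by
    intro v
    conv_lhs => rw [hA]
    simp only [Finset.mul_sum, Matrix.trace_sum, Matrix.mul_smul, Matrix.trace_smul,
      trace_weyl_mul_weyl, smul_eq_mul, mul_ite, mul_zero, Finset.sum_ite_eq, Finset.mem_univ,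
      if_true]
    field_simp
  simp only [hc]
  exact hA

/-! ### The Frobenius norm -/

/-- The squared Frobenius norm. -/
noncomputable def frobSq {ι : Type*} [Fintype ι] (A : Matrix ι ι ℂ) : ℝ := ∑ x, ∑ y, ‖A x y‖ ^ 2

lemma frobSq_eq_trace {ι : Type*} [Fintype ι] (A : Matrix ι ι ℂ) :
    (frobSq A : ℂ) = (Aᴴ * A).trace := by
  simp only [frobSq, Matrix.trace, Matrix.diag, Matrix.mul_apply, Matrix.conjTranspose_apply]
  rw [Finset.sum_comm]
  push_cast
  refine Finset.sum_congr rfl fun x _ => Finset.sum_congr rfl fun y _ => ?_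
  rw [RCLike.star_def, Complex.conj_mul']

lemma frobSq_eq_re_trace {ι : Type*} [Fintype ι] (A : Matrix ι ι ℂ) :
    frobSq A = (Aᴴ * A).trace.re := by
  rw [← frobSq_eq_trace, Complex.ofReal_re]

lemma frobSq_nonneg {ι : Type*} [Fintype ι] (A : Matrix ι ι ℂ) : 0 ≤ frobSq A := by
  unfold frobSq; positivity

/-- Parseval's identity for the Weyl basis. -/
lemma sum_norm_trace_weyl_sq {n : ℕ} (A : QMat n) :
    ∑ v, ‖(A * weyl v).trace‖ ^ 2 = 2 ^ n * frobSq A := by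
  have h : ((2 ^ n * frobSq A : ℝ) : ℂ) = ((∑ v, ‖(A * weyl v).trace‖ ^ 2 : ℝ) : ℂ) := by
    push_cast
    rw [frobSq_eq_trace]
    conv_lhs => rw [weyl_expansion A]
    simp only [Matrix.conjTranspose_sum, Matrix.conjTranspose_smul, weyl_conjTranspose,
      Finset.sum_mul, Finset.mul_sum, Matrix.trace_sum, Matrix.smul_mul, Matrix.mul_smul,
      Matrix.trace_smul, trace_weyl_mul_weyl, smul_eq_mul]
    refine Finset.sum_congr rfl fun v _ => ?_
    simp only [mul_ite, mul_zero, Finset.sum_ite_eq', Finset.mem_univ, if_true]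
    rw [Matrix.trace_mul_comm (weyl v) A, ← Complex.conj_mul', RCLike.star_def]
    simp only [map_mul, map_inv₀, map_pow, Complex.conj_ofNat]
    field_simp
  exact_mod_cast h.symm

/-! ### The action of Clifford circuits on the symplectic space -/

/-- The linear map of `𝔽₂²ⁿ` that a gate induces on Weyl operators by conjugation, signs
ignored. -/
def Gate.act {n : ℕ} : Gate n → PauliVec n → PauliVec n
  | .had q, v => (fun j => if j = q then v.2 j else v.1 j, fun j => if j = q then v.1 j else v.2 j)
  | .phase q, v => (v.1, fun j => if j = q then v.2 j + v.1 j else v.2 j)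
  | .cnot c t _, v =>
    (fun j => if j = t then v.1 t + v.1 c else v.1 j,
      fun j => if j = c then v.2 c + v.2 t else v.2 j)

lemma zmod_two_add_self (x : ZMod 2) : x + x = 0 := CharTwo.add_self_eq_zero x

lemma Gate.act_act {n : ℕ} (g : Gate n) (v : PauliVec n) : g.act (g.act v) = v := by
  cases g with
  | had q => ext j <;> simp [Gate.act] <;> split_ifs <;> rfl
  | phase q => ext j <;> simp [Gate.act]; split_ifs <;> simp [add_assoc, zmod_two_add_self]
  | cnot c t h =>
    ext j <;> simp [Gate.act, h, h.symm, add_assoc, zmod_two_add_self] <;> split_ifs with hj <;>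
      simp [hj]

lemma Gate.act_add {n : ℕ} (g : Gate n) (v w : PauliVec n) :
    g.act (v + w) = g.act v + g.act w := by
  cases g <;> ext j <;> simp [Gate.act] <;> split_ifs <;> ring

lemma Gate.act_smul {n : ℕ} (g : Gate n) (s : ZMod 2) (v : PauliVec n) :
    g.act (s • v) = s • g.act v := by
  cases g <;> ext j <;> simp [Gate.act] <;> split_ifs <;> ring

lemma symp_gate_act {n : ℕ} (g : Gate n) (v w : PauliVec n) :
    symp (g.act v) (g.act w) = symp v w := by
  cases g with
  | had q =>
    refine Finset.sum_congr rfl fun j _ => ?_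
    simp only [Gate.act]
    split_ifs <;> ring
  | phase q =>
    refine Finset.sum_congr rfl fun j _ => ?_
    simp only [Gate.act]
    split_ifs
    · linear_combination zmod_two_add_self (v.1 j * w.1 j)
    · rfl
  | cnot c t h =>
    have e : ∀ f : Fin n → ZMod 2, ∑ j, f j = f c + (f t + ∑ j ∈ {c, t}ᶜ, f j) := by
      intro f
      rw [← Finset.sum_add_sum_compl {c, t}, Finset.sum_pair h, add_assoc]
    unfold symp
    rw [e, e]
    have hr : ∑ j ∈ {c, t}ᶜ, (((Gate.cnot c t h).act v).1 j * ((Gate.cnot c t h).act w).2 j +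
        ((Gate.cnot c t h).act v).2 j * ((Gate.cnot c t h).act w).1 j) =
        ∑ j ∈ {c, t}ᶜ, (v.1 j * w.2 j + v.2 j * w.1 j) := by
      refine Finset.sum_congr rfl fun j hj => ?_
      simp only [Finset.mem_compl, Finset.mem_insert, Finset.mem_singleton, not_or] at hj
      simp [Gate.act, hj.1, hj.2]
    rw [hr]
    simp only [Gate.act, h, h.symm, if_true, if_false]
    linear_combination zmod_two_add_self (v.1 c * w.2 t) + zmod_two_add_self (v.2 t * w.1 c)

/-- The linear map of `𝔽₂²ⁿ` induced by a circuit. -/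
def circuitAct {n : ℕ} (L : List (Gate n)) : PauliVec n →ₗ[ZMod 2] PauliVec n where
  toFun v := L.foldl (fun w g => g.act w) v
  map_add' v w := by
    induction L generalizing v w with
    | nil => rfl
    | cons g L ih => simp only [List.foldl_cons, Gate.act_add, ih]
  map_smul' s v := by
    induction L generalizing v with
    | nil => rfl
    | cons g L ih => simp only [List.foldl_cons, Gate.act_smul, ih]

lemma circuitAct_nil {n : ℕ} (v : PauliVec n) : circuitAct [] v = v := rfl

lemma circuitAct_cons {n : ℕ} (g : Gate n) (L : List (Gate n)) (v : PauliVec n) :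
    circuitAct (g :: L) v = circuitAct L (g.act v) := rfl

lemma circuitAct_append {n : ℕ} (L L' : List (Gate n)) (v : PauliVec n) :
    circuitAct (L ++ L') v = circuitAct L' (circuitAct L v) := by
  simp [circuitAct, List.foldl_append]

lemma circuitAct_injective {n : ℕ} (L : List (Gate n)) : Function.Injective (circuitAct L) := by
  induction L with
  | nil => exact fun v w h => h
  | cons g L ih =>
    intro v w h
    exact (Function.Involutive.injective g.act_act) (ih h)

lemma symp_circuitAct {n : ℕ} (L : List (Gate n)) (v w : PauliVec n) :
    symp (circuitAct L v) (circuitAct L w) = symp v w := by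
  induction L generalizing v w with
  | nil => rfl
  | cons g L ih => rw [circuitAct_cons, circuitAct_cons, ih, symp_gate_act]

/-! ### Gates as unitaries -/

lemma onQubit_eq_tens {n : ℕ} (q : Fin n) (G : Matrix (ZMod 2) (ZMod 2) ℂ) :
    onQubit q G = tens fun j => if j = q then G else 1 := by
  ext x y
  simp only [onQubit, tens]
  rw [← Finset.mul_prod_erase _ _ (Finset.mem_univ q)]
  have : ∏ j ∈ Finset.univ.erase q, (if j = q then G else 1 : Matrix (ZMod 2) (ZMod 2) ℂ)
      (x j) (y j) = if ∀ j, j ≠ q → x j = y j then 1 else 0 := by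
    rw [Finset.prod_congr rfl (g := fun j => if x j = y j then (1 : ℂ) else 0)]
    · rw [Finset.prod_ite_zero]
      simp
    · intro j hj
      simp [Finset.ne_of_mem_erase hj, Matrix.one_apply]
  rw [this]
  simp

/-- The Hadamard matrix. -/
noncomputable def hadMatrix : Matrix (ZMod 2) (ZMod 2) ℂ :=
  (1 / (Real.sqrt 2 : ℂ)) • (pauliX + pauliZ)

/-- The phase gate. -/
noncomputable def phaseMatrix : Matrix (ZMod 2) (ZMod 2) ℂ :=
  Matrix.diagonal fun x => if x = 0 then 1 else Complex.I

lemma sqrt_two_inv_sq : (1 / (Real.sqrt 2 : ℂ)) * (1 / (Real.sqrt 2 : ℂ)) = 1 / 2 := by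
  rw [div_mul_div_comm, one_mul, ← Complex.ofReal_mul, Real.mul_self_sqrt (by norm_num)]
  norm_num

lemma hadMatrix_unitary : hadMatrixᴴ * hadMatrix = 1 := by
  have h : hadMatrixᴴ = hadMatrix := by
    ext x y
    revert x y
    simp [forall_zmod_two, hadMatrix, Matrix.conjTranspose_apply, pauliX, pauliZ,
      Matrix.diagonal_apply, zmod_two_one_add_one]
  rw [h, hadMatrix, Matrix.smul_mul, Matrix.mul_smul, smul_smul, sqrt_two_inv_sq]
  ext x y
  revert x y
  simp [forall_zmod_two, Matrix.mul_apply, pauliX, pauliZ, sum_zmod_two, zmod_two_one_add_one,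
    Matrix.diagonal_apply]
  norm_num

lemma phaseMatrix_unitary : phaseMatrixᴴ * phaseMatrix = 1 := by
  ext x y
  revert x y
  simp [forall_zmod_two, phaseMatrix, Matrix.mul_apply, Matrix.diagonal_apply]

lemma hadMatrix_mul_weylFactor (a b : ZMod 2) :
    hadMatrix * weylFactor a b = ((-1) ^ (a.val * b.val) : ℂ) • (weylFactor b a * hadMatrix) := by
  rw [hadMatrix, Matrix.smul_mul, Matrix.mul_smul, smul_comm]
  congr 1
  ext x y
  revert a b x y
  simp [forall_zmod_two, Matrix.mul_apply, pauliX, pauliZ, sum_zmod_two, zmod_two_one_add_one,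
    Matrix.diagonal_apply, weylFactor, phaseExp, zmod_two_val_one, pow_succ]

lemma phaseMatrix_mul_weylFactor (a b : ZMod 2) :
    phaseMatrix * weylFactor a b =
      ((-1) ^ (a.val * b.val) : ℂ) • (weylFactor a (b + a) * phaseMatrix) := by
  ext x y
  revert a b x y
  simp [forall_zmod_two, Matrix.mul_apply, phaseMatrix, zmod_two_one_add_one,
    Matrix.diagonal_apply, weylFactor, phaseExp, zmod_two_val_one, pow_succ]

lemma tens_update_mul_weyl {n : ℕ} {q : Fin n} {G : Matrix (ZMod 2) (ZMod 2) ℂ} {v w : PauliVec n}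
    {c : ℂ} (h : ∀ j, j ≠ q → w.1 j = v.1 j ∧ w.2 j = v.2 j)
    (hq : G * weylFactor (v.1 q) (v.2 q) = c • (weylFactor (w.1 q) (w.2 q) * G)) :
    onQubit q G * weyl v = c • (weyl w * onQubit q G) := by
  rw [onQubit_eq_tens, weyl_eq_tens, weyl_eq_tens, tens_mul, tens_mul]
  ext x y
  simp only [tens, Matrix.smul_apply, smul_eq_mul]
  rw [← Finset.mul_prod_erase _ _ (Finset.mem_univ q),
    ← Finset.mul_prod_erase _ _ (Finset.mem_univ q), ← mul_assoc]
  congr 1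
  · simp only [if_true, hq, Matrix.smul_apply, smul_eq_mul]
  · refine Finset.prod_congr rfl fun j hj => ?_
    have hj := Finset.ne_of_mem_erase hj
    simp [hj, h j hj]

lemma weylFactor_cnot (ac bc at' bt xc yc xt yt : ZMod 2) :
    weylFactor ac bc xc yc * weylFactor at' bt (xt + xc) yt =
      (-1) ^ (ac.val * bt.val * (at' + bc + 1).val) *
        (weylFactor ac (bc + bt) xc yc * weylFactor (at' + ac) bt xt (yt + yc)) := by
  by_cases hc : xc = yc + ac
  · have ht : xt + xc = yt + at' ↔ xt = yt + yc + (at' + ac) := by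
      rw [hc]
      clear hc
      revert ac at' yc xt yt
      decide
    by_cases h : xt + xc = yt + at'
    · have h' := ht.1 h
      simp only [weylFactor, if_pos hc, if_pos h, if_pos h']
      have hI : (-1 : ℂ) = Complex.I ^ 2 := by simp
      rw [hI, ← pow_mul, ← pow_add, ← pow_add, ← pow_add, Complex.I_pow_eq_pow_mod]
      conv_rhs => rw [Complex.I_pow_eq_pow_mod]
      congr 1
      clear ht h h' hc
      revert ac bc at' bt yc yt
      decide
    · have h' := fun h' => h (ht.2 h')
      simp only [weylFactor, if_neg h, if_neg h', mul_zero]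
  · simp [weylFactor, hc]

lemma cnot_map_involutive {n : ℕ} {c t : Fin n} (h : c ≠ t) (y : Bits n) :
    Function.update (Function.update y t (y t + y c)) t
      (Function.update y t (y t + y c) t + Function.update y t (y t + y c) c) = y := by
  ext j
  by_cases hj : j = t
  · subst hj; simp [h, add_assoc, zmod_two_add_self]
  · simp [hj]

lemma cnot_toMatrix_apply {n : ℕ} {c t : Fin n} (h : c ≠ t) (x y : Bits n) :
    (Gate.cnot c t h).toMatrix x y = if x = Function.update y t (y t + y c) then 1 else 0 := rfl

/-- Conjugation by a gate permutes the Weyl operators up to phases. -/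
lemma gate_mul_weyl {n : ℕ} (g : Gate n) (v : PauliVec n) :
    ∃ c : ℂ, ‖c‖ = 1 ∧ g.toMatrix * weyl v = c • (weyl (g.act v) * g.toMatrix) := by
  cases g with
  | had q =>
    refine ⟨(-1) ^ ((v.1 q).val * (v.2 q).val), by simp, tens_update_mul_weyl ?_ ?_⟩
    · intro j hj; simp [Gate.act, hj]
    · simp only [Gate.act, if_true]
      exact hadMatrix_mul_weylFactor (v.1 q) (v.2 q)
  | phase q =>
    refine ⟨(-1) ^ ((v.1 q).val * (v.2 q).val), by simp, tens_update_mul_weyl ?_ ?_⟩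
    · intro j hj; simp [Gate.act, hj]
    · simp only [Gate.act, if_true]
      exact phaseMatrix_mul_weylFactor (v.1 q) (v.2 q)
  | cnot c t h =>
    refine ⟨(-1) ^ ((v.1 c).val * (v.2 t).val * (v.1 t + v.2 c + 1).val), by simp, ?_⟩
    ext x y
    simp only [cnot_toMatrix_apply, Matrix.mul_apply, Matrix.smul_apply, smul_eq_mul, ite_mul,
      one_mul, zero_mul, mul_ite, mul_one, mul_zero]
    have hx : ∀ u : Bits n, x = Function.update u t (u t + u c) ↔
        u = Function.update x t (x t + x c) := by
      intro u
      constructor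
      · rintro rfl; exact (cnot_map_involutive h u).symm
      · rintro rfl; exact (cnot_map_involutive h x).symm
    simp only [hx, Finset.sum_ite_eq', Finset.mem_univ, if_true]
    rw [weyl_eq_tens, weyl_eq_tens]
    have e : ∀ f : Fin n → ℂ, ∏ j, f j = f c * f t * ∏ j ∈ {c, t}ᶜ, f j := by
      intro f
      rw [← Finset.prod_mul_prod_compl {c, t}, Finset.prod_pair h]
    simp only [tens]
    rw [e, e (fun j => weylFactor _ _ _ _), ← mul_assoc]
    congr 1
    · simpa [Gate.act, h, h.symm] using
        weylFactor_cnot (v.1 c) (v.2 c) (v.1 t) (v.2 t) (x c) (y c) (x t) (y t)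
    · refine Finset.prod_congr rfl fun j hj => ?_
      simp only [Finset.mem_compl, Finset.mem_insert, Finset.mem_singleton, not_or] at hj
      simp [Gate.act, hj.1, hj.2]

lemma gate_unitary {n : ℕ} (g : Gate n) : g.toMatrixᴴ * g.toMatrix = 1 := by
  have key : ∀ (q : Fin n) (G : Matrix (ZMod 2) (ZMod 2) ℂ), Gᴴ * G = 1 →
      (onQubit q G)ᴴ * onQubit q G = 1 := by
    intro q G hG
    rw [onQubit_eq_tens, tens_conjTranspose, tens_mul, ← tens_one]
    congr 1
    ext1 j
    split_ifs
    · exact hG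
    · simp
  cases g with
  | had q => exact key q _ hadMatrix_unitary
  | phase q => exact key q _ phaseMatrix_unitary
  | cnot c t h =>
    ext x y
    simp only [cnot_toMatrix_apply, Matrix.mul_apply, Matrix.conjTranspose_apply, Matrix.one_apply,
      RCLike.star_def, apply_ite (starRingEnd ℂ), map_one, map_zero, ite_mul, one_mul, zero_mul]
    rw [Finset.sum_ite_eq' Finset.univ (Function.update x t (x t + x c))]
    simp only [Finset.mem_univ, if_true]
    congr 1
    have : Function.Injective fun y : Bits n => Function.update y t (y t + y c) :=
      Function.Involutive.injective (cnot_map_involutive h)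
    exact propext this.eq_iff

lemma circuitMatrix_unitary {n : ℕ} (L : List (Gate n)) :
    circuitMatrix L ∈ Matrix.unitaryGroup (Bits n) ℂ := by
  induction L with
  | nil => exact one_mem _
  | cons g L ih =>
    exact mul_mem ih (Matrix.mem_unitaryGroup_iff'.2 (gate_unitary g))

lemma circuitMatrix_mul_weyl {n : ℕ} (L : List (Gate n)) (v : PauliVec n) :
    ∃ c : ℂ, ‖c‖ = 1 ∧
      circuitMatrix L * weyl v = c • (weyl (circuitAct L v) * circuitMatrix L) := by
  induction L generalizing v with
  | nil => exact ⟨1, by simp, by simp [circuitMatrix, circuitAct_nil]⟩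
  | cons g L ih =>
    obtain ⟨c, hc, h⟩ := gate_mul_weyl g v
    obtain ⟨d, hd, h'⟩ := ih (g.act v)
    refine ⟨c * d, by simp [hc, hd], ?_⟩
    simp only [circuitMatrix, circuitAct_cons]
    rw [Matrix.mul_assoc, h, Matrix.mul_smul, ← Matrix.mul_assoc, h', Matrix.smul_mul, smul_smul,
      Matrix.mul_assoc]

/-! ### Block-diagonal matrices -/

/-- `splitBits` as an equivalence. -/
def splitEquiv {n : ℕ} (a b : ℕ) (h : a + b ≤ n) :
    Bits n ≃ Bits (n - a - b) × (Bits a × Bits b) where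
  toFun := splitBits a b h
  invFun s p :=
    if h₁ : (p : ℕ) < n - a - b then s.1 ⟨p, h₁⟩
    else if h₂ : (p : ℕ) < n - a then s.2.2 ⟨p - (n - a - b), by omega⟩
    else s.2.1 ⟨p - (n - a), by omega⟩
  left_inv u := by
    ext p
    simp only [splitBits]
    split_ifs with h₁ h₂
    · rfl
    · congr 1; ext; simp only; omega
    · congr 1; ext; simp only; omega
  right_inv s := by
    obtain ⟨x, z, y⟩ := s
    refine Prod.ext ?_ (Prod.ext ?_ ?_)
    · ext i; simp [splitBits]
    · ext i
      have h₁ : ¬ n - a + (i : ℕ) < n - a - b := by omega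
      simp [splitBits, h₁]
    · ext i
      have h₂ : n - a - b + (i : ℕ) < n - a := by omega
      simp [splitBits, h₂]

/-- The matrix `I^{⊗(n-a-b)} ⊗ ⨁_y B_y`. -/
def blockMat {n : ℕ} (a b : ℕ) (h : a + b ≤ n) (B : Bits b → QMat a) : QMat n :=
  ((1 : QMat (n - a - b)) ⊗ₖ Matrix.blockDiagonal B).submatrix (splitEquiv a b h) (splitEquiv a b h)

lemma isBlockDiagonal_blockMat {n a b : ℕ} (h : a + b ≤ n) (B : Bits b → QMat a) :
    IsBlockDiagonal a b (blockMat a b h B) := ⟨h, B, rfl⟩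

section

variable {n a b : ℕ} (h : a + b ≤ n)

lemma blockMat_apply (B : Bits b → QMat a) (u w : Bits n) :
    blockMat a b h B u w =
      if (splitBits a b h u).1 = (splitBits a b h w).1 then
        if (splitBits a b h u).2.2 = (splitBits a b h w).2.2 then
          B (splitBits a b h u).2.2 (splitBits a b h u).2.1 (splitBits a b h w).2.1 else 0
      else 0 := by
  change (1 : QMat (n - a - b)) (splitBits a b h u).1 (splitBits a b h w).1 *
    Matrix.blockDiagonal B (splitBits a b h u).2 (splitBits a b h w).2 = _
  rw [Matrix.one_apply, Matrix.blockDiagonal_apply]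
  split_ifs <;> simp

lemma blockMat_one : blockMat a b h (fun _ => 1) = 1 := by
  have : (fun _ => 1 : Bits b → QMat a) = 1 := rfl
  rw [blockMat, this, Matrix.blockDiagonal_one, Matrix.one_kronecker_one,
    Matrix.submatrix_one_equiv]

lemma blockMat_mul (B C : Bits b → QMat a) :
    blockMat a b h B * blockMat a b h C = blockMat a b h fun y => B y * C y := by
  rw [blockMat, blockMat, Matrix.submatrix_mul_equiv, ← Matrix.mul_kronecker_mul, one_mul,
    ← Matrix.blockDiagonal_mul]
  rfl

lemma blockMat_conjTranspose (B : Bits b → QMat a) :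
    (blockMat a b h B)ᴴ = blockMat a b h fun y => (B y)ᴴ := by
  rw [blockMat, Matrix.conjTranspose_submatrix, Matrix.conjTranspose_kronecker,
    Matrix.conjTranspose_one, Matrix.blockDiagonal_conjTranspose]
  rfl

lemma blockMat_sum_smul {ι : Type*} (s : Finset ι) (c : ι → ℂ) (B : ι → Bits b → QMat a) :
    ∑ i ∈ s, c i • blockMat a b h (B i) = blockMat a b h fun y => ∑ i ∈ s, c i • B i y := by
  ext u w
  simp only [Matrix.sum_apply, Matrix.smul_apply, blockMat_apply, smul_eq_mul]
  split_ifs <;> simp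

/-- The blocks of the projection of `A` onto the block-diagonal matrices: the diagonal blocks of
`A`, averaged over the first `n - a - b` qubits. -/
noncomputable def blockAverage (A : QMat n) (y : Bits b) : QMat a :=
  (2 ^ (n - a - b) : ℂ)⁻¹ • ∑ x, A.submatrix (fun z => (splitEquiv a b h).symm (x, z, y))
    (fun z => (splitEquiv a b h).symm (x, z, y))

lemma splitBits_symm (s : Bits (n - a - b) × (Bits a × Bits b)) :
    splitBits a b h ((splitEquiv a b h).symm s) = s := (splitEquiv a b h).apply_symm_apply s

lemma blockMat_apply_symm (B : Bits b → QMat a) (x x' : Bits (n - a - b)) (z z' : Bits a)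
    (y y' : Bits b) :
    blockMat a b h B ((splitEquiv a b h).symm (x, z, y)) ((splitEquiv a b h).symm (x', z', y')) =
      if x = x' then if y = y' then B y z z' else 0 else 0 := by
  simp only [blockMat_apply, splitBits_symm]

lemma blockAverage_blockMat (B : Bits b → QMat a) : blockAverage h (blockMat a b h B) = B := by
  ext y z z'
  simp only [blockAverage, Matrix.smul_apply, Matrix.sum_apply, Matrix.submatrix_apply,
    blockMat_apply_symm, if_true, Finset.sum_const, Finset.card_univ, smul_eq_mul, nsmul_eq_mul]
  simp

lemma trace_mul_blockMat (A : QMat n) (B : Bits b → QMat a) :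
    (A * blockMat a b h B).trace =
      2 ^ (n - a - b) * ∑ y, (blockAverage h A y * B y).trace := by
  have hr : ∀ y, (blockAverage h A y * B y).trace = (2 ^ (n - a - b) : ℂ)⁻¹ *
      ∑ x, ∑ z, ∑ z', A ((splitEquiv a b h).symm (x, z, y)) ((splitEquiv a b h).symm (x, z', y)) *
        B y z' z := by
    intro y
    simp only [blockAverage, Matrix.smul_mul, Matrix.trace_smul, smul_eq_mul, Finset.sum_mul,
      Matrix.trace_sum]
    congr 1
  simp only [hr, ← Finset.mul_sum]
  rw [mul_inv_cancel_left₀ (pow_ne_zero _ two_ne_zero)]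
  have hl : ∀ x z y, (A * blockMat a b h B) ((splitEquiv a b h).symm (x, z, y))
      ((splitEquiv a b h).symm (x, z, y)) =
      ∑ z', A ((splitEquiv a b h).symm (x, z, y)) ((splitEquiv a b h).symm (x, z', y)) *
        B y z' z := by
    intro x z y
    rw [Matrix.mul_apply, ← (splitEquiv a b h).symm.sum_comp]
    simp only [Fintype.sum_prod_type, blockMat_apply_symm]
    simp
  simp only [Matrix.trace, Matrix.diag]
  rw [← (splitEquiv a b h).symm.sum_comp]
  simp only [Fintype.sum_prod_type, hl]
  rw [Finset.sum_comm]
  refine (Finset.sum_congr rfl fun z _ => Finset.sum_comm).trans ?_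
  rw [Finset.sum_comm]
  exact Finset.sum_congr rfl fun y _ => Finset.sum_comm

lemma frobSq_blockMat (B : Bits b → QMat a) :
    frobSq (blockMat a b h B) = 2 ^ (n - a - b) * ∑ y, frobSq (B y) := by
  have e := trace_mul_blockMat h (blockMat a b h B)ᴴ B
  rw [blockMat_conjTranspose, blockAverage_blockMat, ← blockMat_conjTranspose] at e
  rw [← Complex.ofReal_inj]
  push_cast
  simp only [frobSq_eq_trace, e]

lemma blockMat_mem_unitaryGroup {B : Bits b → QMat a}
    (hB : ∀ y, B y ∈ Matrix.unitaryGroup (Bits a) ℂ) :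
    blockMat a b h B ∈ Matrix.unitaryGroup (Bits n) ℂ := by
  rw [Matrix.mem_unitaryGroup_iff', Matrix.star_eq_conjTranspose, blockMat_conjTranspose,
    blockMat_mul, ← blockMat_one h]
  congr 1
  ext1 y
  exact Matrix.mem_unitaryGroup_iff'.1 (hB y)

/-! ### Norm bounds for block-diagonal matrices -/

/-- A block-diagonal matrix repeats its blocks `2^(n-a-b)` times, so its operator norm is small
compared to its Frobenius norm. -/
lemma opNorm_blockMat_sq_le (B : Bits b → QMat a) :
    2 ^ (n - a - b) * opNorm (blockMat a b h B) ^ 2 ≤ frobSq (blockMat a b h B) := by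
  rw [frobSq_blockMat]
  refine mul_le_mul_of_nonneg_left ?_ (by positivity)
  have hF : 0 ≤ ∑ y, frobSq (B y) := Finset.sum_nonneg fun y _ => frobSq_nonneg _
  refine (Real.le_sqrt (norm_nonneg _) hF).1 ?_
  refine ContinuousLinearMap.opNorm_le_bound _ (Real.sqrt_nonneg _) fun φ => ?_
  refine le_of_sq_le_sq ?_ (by positivity)
  rw [mul_pow, Real.sq_sqrt hF, EuclideanSpace.norm_sq_eq, EuclideanSpace.norm_sq_eq]
  have hv : ∀ x z y, (Matrix.toEuclideanCLM (n := Bits n) (𝕜 := ℂ) (blockMat a b h B) φ)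
      ((splitEquiv a b h).symm (x, z, y)) =
      ∑ z', B y z z' * φ ((splitEquiv a b h).symm (x, z', y)) := by
    intro x z y
    rw [Matrix.ofLp_toEuclideanCLM, Matrix.mulVec, dotProduct, ← (splitEquiv a b h).symm.sum_comp]
    simp only [Fintype.sum_prod_type, blockMat_apply_symm]
    simp
  rw [← (splitEquiv a b h).symm.sum_comp, ← (splitEquiv a b h).symm.sum_comp]
  simp only [Fintype.sum_prod_type, hv]
  rw [Finset.mul_sum]
  refine Finset.sum_le_sum fun x _ => ?_
  rw [Finset.sum_comm]
  conv_rhs => rw [Finset.sum_comm]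
  rw [Finset.mul_sum]
  refine Finset.sum_le_sum fun y _ => ?_
  have hy : frobSq (B y) ≤ ∑ y, frobSq (B y) :=
    Finset.single_le_sum (f := fun y => frobSq (B y)) (fun y _ => frobSq_nonneg _)
      (Finset.mem_univ y)
  refine le_trans ?_ (mul_le_mul_of_nonneg_right hy (by positivity))
  rw [frobSq, Finset.sum_mul]
  refine Finset.sum_le_sum fun z _ => ?_
  calc _ ≤ (∑ z', ‖B y z z'‖ * ‖φ ((splitEquiv a b h).symm (x, z', y))‖) ^ 2 := by
        gcongr
        exact (norm_sum_le _ _).trans_eq (by simp only [norm_mul])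
    _ ≤ _ := Finset.sum_mul_sq_le_sq_mul_sq _ _ _

open scoped Matrix.Norms.L2Operator in
/-- The averaged diagonal blocks of a unitary are contractions. -/
lemma norm_blockAverage_le {U : QMat n} (hU : U ∈ Matrix.unitaryGroup (Bits n) ℂ) (y : Bits b) :
    ‖blockAverage h U y‖ ≤ 1 := by
  have key : ∀ f : Bits a → Bits n, Function.Injective f → ‖U.submatrix f f‖ ≤ 1 := by
    intro f hf
    let J : Matrix (Bits n) (Bits a) ℂ := (1 : QMat n).submatrix id f
    have hJ : Jᴴ * J = 1 := by
      ext z z'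
      simp [J, Matrix.mul_apply, Matrix.one_apply, hf.eq_iff]
    have hUJ : U.submatrix f f = Jᴴ * (U * J) := by
      ext z z'
      simp [J, Matrix.mul_apply, Matrix.one_apply]
    have h1 : ‖(1 : QMat a)‖ ≤ 1 := by
      rw [← Matrix.diagonal_one, Matrix.l2_opNorm_diagonal]
      exact (pi_norm_le_iff_of_nonneg zero_le_one).2 fun _ => by simp
    have hJn : ‖J‖ ≤ 1 := by
      have := Matrix.l2_opNorm_conjTranspose_mul_self J
      rw [hJ] at this
      nlinarith [norm_nonneg J]
    have hUJn : ‖U * J‖ ≤ 1 := by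
      have := Matrix.l2_opNorm_conjTranspose_mul_self (U * J)
      rw [Matrix.conjTranspose_mul, Matrix.mul_assoc, ← Matrix.mul_assoc Uᴴ,
        ← Matrix.star_eq_conjTranspose U, Matrix.mem_unitaryGroup_iff'.1 hU, Matrix.one_mul,
        hJ] at this
      nlinarith [norm_nonneg (U * J)]
    rw [hUJ]
    calc _ ≤ ‖Jᴴ‖ * ‖U * J‖ := Matrix.l2_opNorm_mul _ _
      _ ≤ 1 * 1 := by
        rw [Matrix.l2_opNorm_conjTranspose]
        gcongr
      _ = 1 := one_mul 1
  rw [blockAverage, norm_smul]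
  calc _ ≤ ‖(2 ^ (n - a - b) : ℂ)⁻¹‖ * ∑ x : Bits (n - a - b), (1 : ℝ) := by
        refine mul_le_mul_of_nonneg_left (norm_sum_le_of_le _ fun x _ => key _ ?_) (norm_nonneg _)
        intro z z' hz
        simpa using hz
    _ = 1 := by simp

end

open scoped Matrix.Norms.L2Operator in
/-- By the singular value decomposition, the trace norm of a contraction `B`, which is
`Re tr(B† V)` for a suitable unitary `V`, is at least its squared Frobenius norm. -/
lemma exists_unitary_frobSq_le_re_trace {ι : Type*} [Fintype ι] [DecidableEq ι] {B : Matrix ι ι ℂ}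
    (hB : ‖B‖ ≤ 1) : ∃ V ∈ Matrix.unitaryGroup ι ℂ, frobSq B ≤ (Bᴴ * V).trace.re := by
  have hH : (Bᴴ * B).IsHermitian := Matrix.isHermitian_conjTranspose_mul_self B
  set w := hH.eigenvectorBasis
  set l := hH.eigenvalues
  let T := Matrix.toEuclideanCLM (n := ι) (𝕜 := ℂ) B
  have hin : ∀ i j, inner ℂ (T (w i)) (T (w j)) = if i = j then (l j : ℂ) else 0 := by
    intro i j
    have : T.adjoint (T (w j)) = (l j : ℂ) • w j := by
      have e : T.adjoint (T (w j)) =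
          Matrix.toEuclideanCLM (n := ι) (𝕜 := ℂ) (Bᴴ * B) (w j) := by
        rw [map_mul, ← Matrix.star_eq_conjTranspose, map_star]
        rfl
      rw [e]
      ext x
      rw [Matrix.ofLp_toEuclideanCLM, hH.mulVec_eigenvectorBasis]
      simp [l, w]
    rw [← ContinuousLinearMap.adjoint_inner_right, this, inner_smul_right,
      orthonormal_iff_ite.1 w.orthonormal]
    simp
  have h1 : ∀ i, ‖T (w i)‖ ^ 2 = l i := by
    intro i
    have := inner_self_eq_norm_sq_to_K (𝕜 := ℂ) (T (w i))
    rw [hin, if_pos rfl] at this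
    refine Complex.ofReal_injective ?_
    rw [Complex.ofReal_pow]
    exact this.symm
  have hl : ∀ i, 0 ≤ l i := fun i => h1 i ▸ sq_nonneg _
  have hl1 : ∀ i, l i ≤ 1 := by
    intro i
    have h2 : ‖T (w i)‖ ≤ 1 := by
      refine (T.le_opNorm _).trans ?_
      rw [w.orthonormal.1 i, mul_one]
      exact hB
    rw [← h1]
    nlinarith [norm_nonneg (T (w i))]
  let v : ι → EuclideanSpace ℂ ι := fun i => ((Real.sqrt (l i))⁻¹ : ℂ) • T (w i)
  have hv : Orthonormal ℂ (({i | l i ≠ 0} : Set ι).domRestrict v) := by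
    rw [orthonormal_iff_ite]
    rintro ⟨i, hi⟩ ⟨j, hj⟩
    change inner ℂ (v i) (v j) = _
    simp only [v, inner_smul_left, inner_smul_right, hin, Subtype.mk.injEq]
    split_ifs with hij
    · subst hij
      have h0 : (Real.sqrt (l i) : ℂ) ≠ 0 := by
        rw [Complex.ofReal_ne_zero, Real.sqrt_ne_zero (hl i)]
        exact hi
      have hs : (l i : ℂ) = Real.sqrt (l i) * Real.sqrt (l i) := by
        rw [← Complex.ofReal_mul, Real.mul_self_sqrt (hl i)]
      rw [hs]
      simp only [map_inv₀, Complex.conj_ofReal]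
      field_simp
    · simp
  obtain ⟨b, hb⟩ := hv.exists_orthonormalBasis_extension_of_card_eq (by simp)
  have hTb : ∀ i, T (w i) = (Real.sqrt (l i) : ℂ) • b i := by
    intro i
    by_cases hi : l i = 0
    · have := hin i i
      rw [if_pos rfl, hi, Complex.ofReal_zero, inner_self_eq_zero] at this
      rw [this, hi]
      simp
    · have h0 : (Real.sqrt (l i) : ℂ) ≠ 0 := by
        rw [Complex.ofReal_ne_zero, Real.sqrt_ne_zero (hl i)]
        exact hi
      rw [hb i hi]
      simp [v, smul_smul, h0]
  let e := EuclideanSpace.basisFun ι ℂ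
  let Q := e.toBasis.toMatrix b
  let W := e.toBasis.toMatrix w
  have hQ : Q ∈ Matrix.unitaryGroup ι ℂ := e.toMatrix_orthonormalBasis_mem_unitary b
  have hW : W ∈ Matrix.unitaryGroup ι ℂ := e.toMatrix_orthonormalBasis_mem_unitary w
  have hBW : B * W = Q * Matrix.diagonal fun i => (Real.sqrt (l i) : ℂ) := by
    ext x i
    have := congrArg (fun u : EuclideanSpace ℂ ι => u x) (hTb i)
    simp only [T, Matrix.ofLp_toEuclideanCLM, PiLp.smul_apply, smul_eq_mul] at this
    rw [Matrix.mul_diagonal, mul_comm]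
    exact this
  have hB' : B = Q * (Matrix.diagonal fun i => (Real.sqrt (l i) : ℂ)) * Wᴴ := by
    rw [← hBW, Matrix.mul_assoc, ← Matrix.star_eq_conjTranspose,
      Matrix.mem_unitaryGroup_iff.1 hW, Matrix.mul_one]
  refine ⟨Q * Wᴴ, mul_mem hQ (Unitary.star_mem hW), ?_⟩
  have hQ' : Qᴴ * Q = 1 := Matrix.mem_unitaryGroup_iff'.1 hQ
  have hW' : Wᴴ * W = 1 := Matrix.mem_unitaryGroup_iff'.1 hW
  have t1 : (Bᴴ * (Q * Wᴴ)).trace = ∑ i, (Real.sqrt (l i) : ℂ) := by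
    conv_lhs => rw [hB']
    rw [Matrix.conjTranspose_mul, Matrix.conjTranspose_mul, Matrix.conjTranspose_conjTranspose,
      Matrix.diagonal_conjTranspose, Matrix.mul_assoc, Matrix.mul_assoc, ← Matrix.mul_assoc Qᴴ,
      hQ', Matrix.one_mul, ← Matrix.mul_assoc, Matrix.trace_mul_comm, ← Matrix.mul_assoc, hW',
      Matrix.one_mul, Matrix.trace_diagonal]
    simp
  have t2 : frobSq B = ∑ i, l i := by
    rw [frobSq_eq_re_trace, hH.trace_eq_sum_eigenvalues]
    simp [l]
  rw [t1, t2, Complex.re_sum]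
  refine Finset.sum_le_sum fun i _ => ?_
  rw [Complex.ofReal_re]
  exact Real.le_sqrt_of_sq_le (by nlinarith [hl i, hl1 i])

/-! ### Block-diagonal matrices in the Weyl basis -/

/-- The labels of the Weyl operators that are `(a,b)`-block diagonal: arbitrary on the last `a`
qubits, of type `Z` on the `b` qubits before them, trivial on the others. -/
def blockLabels (n a b : ℕ) : Submodule (ZMod 2) (PauliVec n) where
  carrier := {v | (∀ p : Fin n, (p : ℕ) < n - a → v.1 p = 0) ∧
    ∀ p : Fin n, (p : ℕ) < n - a - b → v.2 p = 0}
  add_mem' hv hw := ⟨fun p hp => by simp [hv.1 p hp, hw.1 p hp],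
    fun p hp => by simp [hv.2 p hp, hw.2 p hp]⟩
  zero_mem' := ⟨fun _ _ => rfl, fun _ _ => rfl⟩
  smul_mem' c v hv := ⟨fun p hp => by simp [hv.1 p hp], fun p hp => by simp [hv.2 p hp]⟩

lemma weylFactor_ne_zero {a b x y : ZMod 2} (h : weylFactor a b x y ≠ 0) : x = y + a := by
  by_contra h'
  exact h (if_neg h')

lemma weyl_ne_zero {n : ℕ} {v : PauliVec n} {x y : Bits n} (h : weyl v x y ≠ 0) : x = y + v.1 := by
  rw [weyl_eq_tens, tens, Finset.prod_ne_zero_iff] at h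
  ext j
  exact weylFactor_ne_zero (h j (Finset.mem_univ j))

section

variable {n a b : ℕ} (h : a + b ≤ n)

lemma splitEquiv_symm_congr {x x' : Bits (n - a - b)} {z : Bits a} {y : Bits b} (p : Fin n)
    (hp : ¬ (p : ℕ) < n - a - b) :
    (splitEquiv a b h).symm (x, z, y) p = (splitEquiv a b h).symm (x', z, y) p := by
  simp [splitEquiv, hp]

lemma exists_weyl_eq_blockMat {v : PauliVec n} (hv : v ∈ blockLabels n a b) :
    ∃ B, weyl v = blockMat a b h B := by
  refine ⟨fun y z z' => weyl v ((splitEquiv a b h).symm (0, z, y))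
    ((splitEquiv a b h).symm (0, z', y)), ?_⟩
  ext u w
  obtain ⟨⟨x, z, y⟩, rfl⟩ := (splitEquiv a b h).symm.surjective u
  obtain ⟨⟨x', z', y'⟩, rfl⟩ := (splitEquiv a b h).symm.surjective w
  refine Eq.trans ?_ (blockMat_apply_symm h _ x x' z z' y y').symm
  have hne : ¬ (x = x' ∧ y = y') → weyl v ((splitEquiv a b h).symm (x, z, y))
      ((splitEquiv a b h).symm (x', z', y')) = 0 := by
    intro hxy
    by_contra h0
    have := weyl_ne_zero h0
    refine hxy ⟨?_, ?_⟩
    · ext i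
      have hi := congrFun this ⟨i, by omega⟩
      simp only [Pi.add_apply, hv.1 ⟨(i : ℕ), by omega⟩ (by simp only; omega), add_zero] at hi
      simpa [splitEquiv] using hi
    · ext i
      have hi := congrFun this ⟨n - a - b + i, by omega⟩
      simp only [Pi.add_apply, hv.1 ⟨n - a - b + (i : ℕ), by omega⟩ (by simp only; omega),
        add_zero] at hi
      have h₂ : n - a - b + (i : ℕ) < n - a := by omega
      simpa [splitEquiv, h₂] using hi
  by_cases hx : x = x'
  · by_cases hy : y = y'
    · subst hx hy
      simp only [if_true]
      rw [weyl_eq_tens]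
      refine Finset.prod_congr rfl fun p _ => ?_
      beta_reduce
      by_cases hp : (p : ℕ) < n - a - b
      · rw [hv.1 p (by omega), hv.2 p hp]
        simp [splitEquiv, hp, weylFactor, phaseExp]
      · simp only [splitEquiv_symm_congr h (x' := 0) p hp]
    · rw [hne (fun k => hy k.2), if_pos hx, if_neg hy]
  · rw [hne (fun k => hx k.1), if_neg hx]

lemma trace_weyl_mul_blockMat {v : PauliVec n} (hv : v ∉ blockLabels n a b)
    (B : Bits b → QMat a) : (weyl v * blockMat a b h B).trace = 0 := by
  simp only [Matrix.trace, Matrix.diag, Matrix.mul_apply]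
  by_cases h1 : ∀ p : Fin n, (p : ℕ) < n - a → v.1 p = 0
  · have h2 : ∃ p : Fin n, (p : ℕ) < n - a - b ∧ v.2 p ≠ 0 := by
      by_contra! h2
      exact hv ⟨h1, h2⟩
    obtain ⟨p, hp, hvp⟩ := h2
    have hvp1 : v.2 p = 1 := by
      revert hvp
      generalize v.2 p = s
      revert s
      decide
    -- Flipping bit `p` preserves the entries of the block matrix and negates those of `weyl v`.
    let τ : Bits n ≃ Bits n := Equiv.addRight (Pi.single p 1)
    have hτ : ∀ (u : Bits n) (j : Fin n), j ≠ p → τ u j = u j := fun u j hj => by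
      simp [τ, hj]
    have hτp : ∀ u : Bits n, τ u p = u p + 1 := fun u => by simp [τ]
    have hM : ∀ u w, blockMat a b h B (τ w) (τ u) = blockMat a b h B w u := by
      intro u w
      have e2 : ∀ u, (splitBits a b h (τ u)).2 = (splitBits a b h u).2 := by
        intro u
        refine Prod.ext ?_ ?_ <;> ext i <;> refine hτ _ _ (fun hi => ?_) <;>
          rw [← hi] at hp <;> simp only at hp <;> omega
      have e1 : (splitBits a b h (τ w)).1 = (splitBits a b h (τ u)).1 ↔
          (splitBits a b h w).1 = (splitBits a b h u).1 := by
        simp only [funext_iff, splitBits, τ, Equiv.coe_addRight, Pi.add_apply,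
          add_left_inj]
      rw [blockMat_apply, blockMat_apply, e2, e2]
      simp only [e1]
    have hW : ∀ u w, weyl v (τ u) (τ w) = - weyl v u w := by
      intro u w
      rw [weyl_eq_tens]
      simp only [tens]
      rw [← Finset.mul_prod_erase _ _ (Finset.mem_univ p),
        ← Finset.mul_prod_erase _ _ (Finset.mem_univ p), ← neg_mul]
      congr 1
      · rw [hτp, hτp, hvp1, h1 p (by omega)]
        generalize u p = s
        generalize w p = t
        revert s t
        simp [forall_zmod_two, weylFactor, phaseExp, zmod_two_val_one, zmod_two_one_add_one]
      · refine Finset.prod_congr rfl fun j hj => ?_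
        rw [hτ u j (Finset.ne_of_mem_erase hj), hτ w j (Finset.ne_of_mem_erase hj)]
    have hneg : ∑ u, ∑ w, weyl v u w * blockMat a b h B w u =
        - ∑ u, ∑ w, weyl v u w * blockMat a b h B w u := by
      conv_lhs => rw [← τ.sum_comp]
      rw [← Finset.sum_neg_distrib]
      refine Finset.sum_congr rfl fun u _ => ?_
      rw [← τ.sum_comp, ← Finset.sum_neg_distrib]
      refine Finset.sum_congr rfl fun w _ => ?_
      rw [hM, hW, neg_mul]
    exact self_eq_neg.1 hneg
  · push Not at h1
    obtain ⟨p, hp, hvp⟩ := h1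
    refine Finset.sum_eq_zero fun u _ => Finset.sum_eq_zero fun w _ => ?_
    by_contra h0
    have hW := congrFun (weyl_ne_zero (left_ne_zero_of_mul h0)) p
    have hM := right_ne_zero_of_mul h0
    rw [blockMat_apply] at hM
    split_ifs at hM with e1 e2
    · have : w p = u p := by
        by_cases hp' : (p : ℕ) < n - a - b
        · exact congrFun e1 ⟨p, hp'⟩
        · have := congrFun e2 ⟨p - (n - a - b), by omega⟩
          simp only [splitBits] at this
          convert this using 2 <;> (ext; simp only; omega)
      rw [Pi.add_apply, this, left_eq_add] at hW
      exact hvp hW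
    · exact hM rfl
    · exact hM rfl

lemma exists_eq_blockMat {A : QMat n} (hA : ∀ v ∉ blockLabels n a b, (weyl v * A).trace = 0) :
    ∃ B, A = blockMat a b h B := by
  classical
  have hB : ∀ v, ∃ B, v ∈ blockLabels n a b → weyl v = blockMat a b h B := by
    intro v
    by_cases hv : v ∈ blockLabels n a b
    · obtain ⟨B, hB⟩ := exists_weyl_eq_blockMat h hv
      exact ⟨B, fun _ => hB⟩
    · exact ⟨0, fun hv' => absurd hv' hv⟩
  choose B hB using hB
  refine ⟨_, (weyl_expansion A).trans (Eq.trans ?_ (blockMat_sum_smul h Finset.univ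
    (fun v => (2 ^ n : ℂ)⁻¹ * (weyl v * A).trace) B))⟩
  refine Finset.sum_congr rfl fun v _ => ?_
  by_cases hv : v ∈ blockLabels n a b
  · rw [hB v hv]
  · simp [hA v hv]

/-- The block-diagonal Weyl operators see only the averaged diagonal blocks of a matrix. -/
lemma sum_blockLabels_le (A : QMat n) [DecidablePred (· ∈ blockLabels n a b)] :
    ∑ v with v ∈ blockLabels n a b, ‖(A * weyl v).trace‖ ^ 2 ≤
      2 ^ n * frobSq (blockMat a b h (blockAverage h A)) := by
  rw [← sum_norm_trace_weyl_sq]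
  refine (Finset.sum_le_sum fun v hv => ?_).trans
    (Finset.sum_le_sum_of_subset_of_nonneg (Finset.filter_subset _ _) fun _ _ _ => by positivity)
  obtain ⟨B, hB⟩ := exists_weyl_eq_blockMat h (Finset.mem_filter.1 hv).2
  rw [hB, trace_mul_blockMat, trace_mul_blockMat, blockAverage_blockMat]

end

/-! ### Approximation by a block-diagonal unitary -/

lemma frobSq_unitary_conj {n : ℕ} {C : QMat n} (hC : C ∈ Matrix.unitaryGroup (Bits n) ℂ)
    (A : QMat n) : frobSq (C * A * Cᴴ) = frobSq A := by
  have hC' : Cᴴ * C = 1 := Matrix.mem_unitaryGroup_iff'.1 hC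
  rw [frobSq_eq_re_trace, frobSq_eq_re_trace]
  congr 1
  calc _ = (C * Aᴴ * (Cᴴ * C) * A * Cᴴ).trace := by
        simp only [Matrix.conjTranspose_mul, Matrix.conjTranspose_conjTranspose, Matrix.mul_assoc]
    _ = (Cᴴ * (C * Aᴴ * A)).trace := by rw [hC', Matrix.mul_one, Matrix.trace_mul_comm]
    _ = _ := by rw [Matrix.mul_assoc, ← Matrix.mul_assoc Cᴴ, hC', Matrix.one_mul]

open scoped Matrix.Norms.L2Operator in
lemma opNorm_unitary_conj {n : ℕ} {C : QMat n} (hC : C ∈ Matrix.unitaryGroup (Bits n) ℂ)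
    (A : QMat n) : opNorm (C * A * Cᴴ) = opNorm A := by
  change ‖C * A * star C‖ = ‖A‖
  rw [CStarRing.norm_mul_mem_unitary _ (Unitary.star_mem hC), CStarRing.norm_mem_unitary_mul _ hC]

/-- A unitary has a block-diagonal unitary approximation whose squared Frobenius distance is at most
twice the part of the squared Frobenius norm outside the block-diagonal Weyl operators. -/
lemma exists_unitary_blockMat_near {n a b : ℕ} (h : a + b ≤ n) {U : QMat n}
    (hU : U ∈ Matrix.unitaryGroup (Bits n) ℂ) [DecidablePred (· ∈ blockLabels n a b)] :
    ∃ V : Bits b → QMat a, blockMat a b h V ∈ Matrix.unitaryGroup (Bits n) ℂ ∧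
      frobSq (U - blockMat a b h V) ≤
        2 * (2 ^ n - (2 ^ n)⁻¹ * ∑ v with v ∈ blockLabels n a b, ‖(U * weyl v).trace‖ ^ 2) := by
  choose V hV hVle using fun y => exists_unitary_frobSq_le_re_trace (norm_blockAverage_le h hU y)
  have hVU := blockMat_mem_unitaryGroup h hV
  refine ⟨V, hVU, ?_⟩
  have hone : ∀ W ∈ Matrix.unitaryGroup (Bits n) ℂ, (Wᴴ * W).trace.re = 2 ^ n := by
    intro W hW
    have : Wᴴ * W = 1 := Matrix.mem_unitaryGroup_iff'.1 hW
    have h2 : (2 : ℂ) ^ n = ((2 ^ n : ℝ) : ℂ) := by push_cast; rfl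
    rw [this, Matrix.trace_one]
    simp [h2, -Complex.ofReal_pow]
  set M := blockMat a b h V with hM
  have hexp : frobSq (U - M) = 2 * (2 ^ n - (U * Mᴴ).trace.re) := by
    have hcross : (Mᴴ * U).trace = (U * Mᴴ).trace := Matrix.trace_mul_comm _ _
    have hcross' : (Uᴴ * M).trace = star (U * Mᴴ).trace := by
      rw [← Matrix.trace_conjTranspose, Matrix.conjTranspose_mul,
        Matrix.conjTranspose_conjTranspose, Matrix.trace_mul_comm]
    rw [frobSq_eq_re_trace, Matrix.conjTranspose_sub, Matrix.sub_mul, Matrix.mul_sub,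
      Matrix.mul_sub]
    simp only [Matrix.trace_sub, Complex.sub_re, hone U hU, hone M hVU, hcross, hcross',
      RCLike.star_def, Complex.conj_re]
    ring
  rw [hexp]
  refine mul_le_mul_of_nonneg_left (sub_le_sub_left ?_ _) zero_le_two
  rw [inv_mul_le_iff₀ (by positivity)]
  refine (sum_blockLabels_le h U).trans (mul_le_mul_of_nonneg_left ?_ (by positivity))
  rw [frobSq_blockMat, hM, blockMat_conjTranspose, trace_mul_blockMat]
  have hre : ∀ s : ℂ, ((2 : ℂ) ^ (n - a - b) * s).re = 2 ^ (n - a - b) * s.re := by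
    intro s
    rw [show (2 : ℂ) ^ (n - a - b) = ((2 ^ (n - a - b) : ℝ) : ℂ) by push_cast; rfl,
      Complex.re_ofReal_mul]
  rw [hre, Complex.re_sum]
  refine mul_le_mul_of_nonneg_left (Finset.sum_le_sum fun y _ => (hVle y).trans_eq ?_)
    (by positivity)
  rw [← Matrix.conjTranspose_conjTranspose (blockAverage h U y), ← Matrix.conjTranspose_mul,
    Matrix.trace_conjTranspose, Matrix.trace_mul_comm]
  simp

section

variable {n : ℕ} {L : List (Gate n)}

lemma circuitMatrix_conjTranspose_mul (L : List (Gate n)) :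
    (circuitMatrix L)ᴴ * circuitMatrix L = 1 :=
  Matrix.mem_unitaryGroup_iff'.1 (circuitMatrix_unitary L)

lemma circuitMatrix_mul_conjTranspose (L : List (Gate n)) :
    circuitMatrix L * (circuitMatrix L)ᴴ = 1 :=
  Matrix.mem_unitaryGroup_iff.1 (circuitMatrix_unitary L)

lemma trace_conj_mul_weyl (L : List (Gate n)) (A : QMat n) (v : PauliVec n) :
    ∃ c : ℂ, ‖c‖ = 1 ∧ (A * weyl v).trace =
      c * (circuitMatrix L * A * (circuitMatrix L)ᴴ * weyl (circuitAct L v)).trace := by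
  obtain ⟨c, hc, hcv⟩ := circuitMatrix_mul_weyl L v
  refine ⟨c, hc, ?_⟩
  set C := circuitMatrix L
  have hC : Cᴴ * C = 1 := circuitMatrix_conjTranspose_mul L
  calc (A * weyl v).trace = (C * (A * weyl v) * Cᴴ).trace := by
        rw [Matrix.trace_mul_comm (C * (A * weyl v)), ← Matrix.mul_assoc, hC, Matrix.one_mul]
    _ = (C * A * Cᴴ * (C * weyl v) * Cᴴ).trace := by
        congr 1
        simp only [Matrix.mul_assoc]
        rw [← Matrix.mul_assoc Cᴴ C, hC, Matrix.one_mul]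
    _ = _ := by
        have hW : weyl (circuitAct L v) * C * Cᴴ = weyl (circuitAct L v) := by
          rw [Matrix.mul_assoc, circuitMatrix_mul_conjTranspose, Matrix.mul_one]
        rw [hcv, Matrix.mul_smul, Matrix.smul_mul, Matrix.trace_smul, smul_eq_mul,
          Matrix.mul_assoc (C * A * Cᴴ), hW]

lemma norm_trace_conj_mul_weyl (L : List (Gate n)) (A : QMat n) (v : PauliVec n) :
    ‖(circuitMatrix L * A * (circuitMatrix L)ᴴ * weyl (circuitAct L v)).trace‖ =
      ‖(A * weyl v).trace‖ := by
  obtain ⟨c, hc, h⟩ := trace_conj_mul_weyl L A v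
  rw [h, norm_mul, hc, one_mul]

/-- A matrix with Pauli support in `S` has a small operator norm compared to its Frobenius norm,
as a Clifford circuit that standardizes `S` makes it block diagonal. -/
lemma opNorm_sq_le_of_support {a b : ℕ} (h : a + b ≤ n) {S : Submodule (ZMod 2) (PauliVec n)}
    (hS : S.map (circuitAct L) = blockLabels n a b) {A : QMat n}
    (hA : ∀ v ∉ S, (A * weyl v).trace = 0) :
    2 ^ (n - a - b) * opNorm A ^ 2 ≤ frobSq A := by
  obtain ⟨B, hB⟩ : ∃ B, circuitMatrix L * A * (circuitMatrix L)ᴴ = blockMat a b h B := by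
    refine exists_eq_blockMat h fun w hw => ?_
    obtain ⟨v, rfl⟩ := (LinearMap.injective_iff_surjective.1 (circuitAct_injective L)) w
    rw [Matrix.trace_mul_comm, ← norm_eq_zero, norm_trace_conj_mul_weyl, norm_eq_zero]
    exact hA v fun hv => hw (hS ▸ Submodule.mem_map_of_mem hv)
  rw [← opNorm_unitary_conj (circuitMatrix_unitary L), ← frobSq_unitary_conj
    (circuitMatrix_unitary L) A, hB]
  exact opNorm_blockMat_sq_le h B

lemma pauliWeight_le {a b : ℕ} {T : Submodule (ZMod 2) (PauliVec n)}
    (hT : T.map (circuitAct L) = blockLabels n a b) (U : QMat n)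
    [DecidablePred (· ∈ blockLabels n a b)] :
    4 ^ n * pauliWeight U T ≤ ∑ v with v ∈ blockLabels n a b,
      ‖(circuitMatrix L * U * (circuitMatrix L)ᴴ * weyl v).trace‖ ^ 2 := by
  classical
  rw [pauliWeight, ← mul_assoc, mul_one_div_cancel (by positivity), one_mul]
  simp only [← norm_trace_conj_mul_weyl L U]
  rw [← Finset.sum_image (s := {v | v ∈ T}) (g := circuitAct L)
    (f := fun v => ‖(circuitMatrix L * U * (circuitMatrix L)ᴴ * weyl v).trace‖ ^ 2)
    fun v _ w _ hvw => circuitAct_injective L hvw]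
  refine Finset.sum_le_sum_of_subset_of_nonneg ?_ fun _ _ _ => by positivity
  intro w hw
  simp only [Finset.mem_image, Finset.mem_filter, Finset.mem_univ, true_and] at hw ⊢
  obtain ⟨v, hv, rfl⟩ := hw
  exact hT ▸ Submodule.mem_map_of_mem hv

/-- If the circuit `L` standardizes `T`, and some circuit `L'` standardizes the span of the Pauli
support, then conjugation by `L` makes a unitary that is concentrated on `T` approximately block
diagonal. -/
lemma isApproxBlockDiagonal_of_weight {L' : List (Gate n)} {a b a' b' d : ℕ}
    {S T : Submodule (ZMod 2) (PauliVec n)} {U : QMat n} {ε : ℝ} (h : a + b ≤ n)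
    (hT : T.map (circuitAct L) = blockLabels n a b) (h' : a' + b' ≤ n)
    (hS : S.map (circuitAct L') = blockLabels n a' b') (hd : a' + b' ≤ d)
    (hU : U ∈ Matrix.unitaryGroup (Bits n) ℂ) (hSU : S = supportSpan U) (hTS : T ≤ S)
    (hε : 0 ≤ ε) (hw : pauliWeight U T ≥ 1 - ε ^ 2 / 2 ^ (d + 1)) :
    IsApproxBlockDiagonal a b ε (circuitMatrix L * U * (circuitMatrix L)ᴴ) := by
  classical
  set C := circuitMatrix L with hCdef
  have hC := circuitMatrix_unitary L
  have hU' : C * U * Cᴴ ∈ Matrix.unitaryGroup (Bits n) ℂ :=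
    mul_mem (mul_mem hC hU) (Unitary.star_mem hC)
  obtain ⟨V, hV, hVle⟩ := exists_unitary_blockMat_near h hU'
  refine ⟨hU', blockMat a b h V, hV, isBlockDiagonal_blockMat h V, ?_⟩
  set M := blockMat a b h V with hM
  set X := U - Cᴴ * M * C with hX
  have hCX : C * X * Cᴴ = C * U * Cᴴ - M := by
    have hCC : C * Cᴴ = 1 := circuitMatrix_mul_conjTranspose L
    rw [hX, Matrix.mul_sub, Matrix.sub_mul]
    congr 1
    calc _ = C * Cᴴ * M * (C * Cᴴ) := by simp only [Matrix.mul_assoc]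
      _ = M := by rw [hCC, Matrix.one_mul, Matrix.mul_one]
  rw [← hCX, hCdef, opNorm_unitary_conj hC]
  rw [← hCX, hCdef, frobSq_unitary_conj hC] at hVle
  have hsupp : ∀ v ∉ S, (X * weyl v).trace = 0 := by
    intro v hv
    have h1 : (U * weyl v).trace = 0 := by
      by_contra h0
      refine hv (hSU ▸ Submodule.subset_span ?_)
      rw [pauliSupport, Set.mem_ofPred_eq, Matrix.trace_mul_comm]
      exact h0
    have h2 : (Cᴴ * M * C * weyl v).trace = 0 := by
      rw [← norm_eq_zero, ← norm_trace_conj_mul_weyl L, norm_eq_zero, ← hCdef]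
      have : C * (Cᴴ * M * C) * Cᴴ = M := by
        have hCC : C * Cᴴ = 1 := circuitMatrix_mul_conjTranspose L
        calc _ = C * Cᴴ * M * (C * Cᴴ) := by simp only [Matrix.mul_assoc]
          _ = M := by rw [hCC, Matrix.one_mul, Matrix.mul_one]
      rw [this, Matrix.trace_mul_comm]
      refine trace_weyl_mul_blockMat h (fun hv' => hv (hTS ?_)) V
      rw [← hT] at hv'
      obtain ⟨w, hwT, hwv⟩ := hv'
      exact circuitAct_injective L hwv ▸ hwT
    rw [hX, Matrix.sub_mul, Matrix.trace_sub, h1, h2, sub_zero]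
  have hop := opNorm_sq_le_of_support h' hS hsupp
  have hwt := pauliWeight_le hT U
  -- `frobSq X ≤ 2^n ε² / 2^d` and `opNorm X ^ 2 ≤ 2^d / 2^n * frobSq X`.
  have hfrob : 2 ^ d * frobSq X ≤ 2 ^ n * ε ^ 2 := by
    have h1 : frobSq X ≤ 2 * (2 ^ n - (2 ^ n)⁻¹ * (4 ^ n * pauliWeight U T)) := by
      refine hVle.trans (mul_le_mul_of_nonneg_left (sub_le_sub_left ?_ _) zero_le_two)
      exact mul_le_mul_of_nonneg_left hwt (by positivity)
    have h4 : (2 ^ n : ℝ)⁻¹ * (4 ^ n * pauliWeight U T) = 2 ^ n * pauliWeight U T := by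
      rw [show (4 : ℝ) ^ n = 2 ^ n * 2 ^ n by rw [← mul_pow]; norm_num]
      field_simp
    rw [h4] at h1
    have h5 : 2 ^ n * (1 - pauliWeight U T) ≤ 2 ^ n * (ε ^ 2 / 2 ^ (d + 1)) :=
      mul_le_mul_of_nonneg_left (by linarith) (by positivity)
    calc 2 ^ d * frobSq X ≤ 2 ^ d * (2 * (2 ^ n * (ε ^ 2 / 2 ^ (d + 1)))) :=
          mul_le_mul_of_nonneg_left (by linarith) (by positivity)
      _ = 2 ^ n * ε ^ 2 := by rw [pow_succ (2 : ℝ) d]; field_simp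
  have hpow : (2 : ℝ) ^ n ≤ 2 ^ (n - a' - b') * 2 ^ d := by
    rw [← pow_add]
    exact pow_le_pow_right₀ one_le_two (by omega)
  have hfin : 2 ^ n * opNorm X ^ 2 ≤ 2 ^ n * ε ^ 2 :=
    calc _ ≤ 2 ^ (n - a' - b') * 2 ^ d * opNorm X ^ 2 :=
          mul_le_mul_of_nonneg_right hpow (sq_nonneg _)
      _ = 2 ^ d * (2 ^ (n - a' - b') * opNorm X ^ 2) := by ring
      _ ≤ 2 ^ d * frobSq X := mul_le_mul_of_nonneg_left hop (by positivity)
      _ ≤ _ := hfrob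
  exact le_of_sq_le_sq (le_of_mul_le_mul_left hfin (by positivity)) hε

end

/-! ### Isotropic subspaces -/

/-- The symplectic product as a bilinear form. -/
def sympForm (n : ℕ) : LinearMap.BilinForm (ZMod 2) (PauliVec n) :=
  LinearMap.mk₂ (ZMod 2) symp
    (fun v v' w => by
      simp only [symp, ← Finset.sum_add_distrib]
      exact Finset.sum_congr rfl fun j _ => by
        simp only [Prod.fst_add, Prod.snd_add, Pi.add_apply]; ring)
    (fun c v w => by
      simp only [symp, smul_eq_mul, Finset.mul_sum]
      exact Finset.sum_congr rfl fun j _ => by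
        simp only [Prod.smul_fst, Prod.smul_snd, Pi.smul_apply, smul_eq_mul]; ring)
    (fun v w w' => by
      simp only [symp, ← Finset.sum_add_distrib]
      exact Finset.sum_congr rfl fun j _ => by
        simp only [Prod.fst_add, Prod.snd_add, Pi.add_apply]; ring)
    (fun c v w => by
      simp only [symp, smul_eq_mul, Finset.mul_sum]
      exact Finset.sum_congr rfl fun j _ => by
        simp only [Prod.smul_fst, Prod.smul_snd, Pi.smul_apply, smul_eq_mul]; ring)

lemma sympForm_apply {n : ℕ} (v w : PauliVec n) : sympForm n v w = symp v w := rfl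

lemma symp_comm {n : ℕ} (v w : PauliVec n) : symp v w = symp w v :=
  Finset.sum_congr rfl fun j _ => by ring

lemma card_le_of_isotropic {n a b d : ℕ} {S : Submodule (ZMod 2) (PauliVec n)}
    (hS : HasDecomposition a b S) (y : Fin d → PauliVec n) (hy : LinearIndependent (ZMod 2) y)
    (hyS : ∀ i, y i ∈ S) (hyy : ∀ i j, symp (y i) (y j) = 0) : d ≤ a + b := by
  obtain ⟨x, z, -, hspan, hxx, hzz, hxz⟩ := hS
  -- Coordinates on `S`, and the symplectic form in coordinates.
  let v : Fin a ⊕ Fin (a + b) → PauliVec n := Sum.elim x z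
  let φ := Fintype.linearCombination (ZMod 2) v
  let B : LinearMap.BilinForm (ZMod 2) (Fin a ⊕ Fin (a + b) → ZMod 2) := (sympForm n).comp φ φ
  have hφ : ∀ i, φ (Pi.single i 1) = v i := fun i => by
    simp [φ, Fintype.linearCombination_apply_single]
  have hc : ∀ i, ∃ c, φ c = y i := by
    intro i
    have : y i ∈ LinearMap.range φ := by
      rw [Fintype.range_linearCombination, Set.Sum.elim_range, hspan]
      exact hyS i
    exact this
  choose c hc using hc
  have hcind : LinearIndependent (ZMod 2) c := by
    refine LinearIndependent.of_comp φ ?_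
    convert hy using 1
    exact funext hc
  let W := Submodule.span (ZMod 2) (Set.range c)
  have hWd : Module.finrank (ZMod 2) W = d := by
    rw [finrank_span_eq_card hcind, Fintype.card_fin]
  have hWW : W ≤ B.orthogonal W := by
    refine Submodule.span_le.2 ?_
    rintro _ ⟨j, rfl⟩ w hw
    change B w (c j) = 0
    refine Submodule.span_induction (p := fun w _ => B w (c j) = 0) ?_ ?_ ?_ ?_ hw
    · rintro _ ⟨i, rfl⟩
      change symp (φ (c i)) (φ (c j)) = 0
      rw [hc, hc, hyy]
    · simp
    · intro u u' _ _ hu hu'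
      simp [hu, hu']
    · intro s u _ hu
      simp [hu]
  have hrefl : B.IsRefl := fun u w h => by
    change symp (φ w) (φ u) = 0
    rw [symp_comm]
    exact h
  have hdim := LinearMap.BilinForm.finrank_add_finrank_orthogonal (B := B) hrefl W
  have hle := Submodule.finrank_mono hWW
  have hrad : Module.finrank (ZMod 2) (W ⊓ B.orthogonal ⊤ : Submodule (ZMod 2) _) ≤ b := by
    refine (Submodule.finrank_mono inf_le_right).trans ?_
    let ψ : (Fin a ⊕ Fin (a + b) → ZMod 2) →ₗ[ZMod 2] (Fin b → ZMod 2) :=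
      LinearMap.funLeft (ZMod 2) (ZMod 2) fun j => Sum.inr (Fin.natAdd a j)
    have hinj : Function.Injective (ψ.domRestrict (B.orthogonal ⊤)) := by
      rw [← LinearMap.ker_eq_bot, LinearMap.ker_eq_bot']
      rintro ⟨u, hu⟩ hψ
      have hB : ∀ i, symp (v i) (φ u) = 0 := by
        intro i
        have : B (Pi.single i 1) u = 0 := hu _ trivial
        rwa [← hφ i]
      have hBu : ∀ i, symp (v i) (φ u) = ∑ k, u k * symp (v i) (v k) := by
        intro i
        rw [← sympForm_apply, Fintype.linearCombination_apply, map_sum]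
        refine Finset.sum_congr rfl fun k _ => ?_
        rw [map_smul, smul_eq_mul, sympForm_apply]
      refine Subtype.ext (funext fun k => ?_)
      change u k = 0
      rcases k with k | k
      · have h := hB (Sum.inr (Fin.castAdd b k))
        rw [hBu, Fintype.sum_sum_type] at h
        simp only [v, Sum.elim_inl, Sum.elim_inr, hzz, mul_zero, Finset.sum_const_zero,
          add_zero] at h
        rw [Finset.sum_eq_single k] at h
        · rw [symp_comm, hxz] at h
          simpa using h
        · intro j _ hj
          rw [symp_comm, hxz]
          simp [Fin.val_inj, hj]
        · simp
      · by_cases hk : (k : ℕ) < a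
        · have h := hB (Sum.inl ⟨k, hk⟩)
          rw [hBu, Fintype.sum_sum_type] at h
          simp only [v, Sum.elim_inl, Sum.elim_inr, hxx, mul_zero, Finset.sum_const_zero,
            zero_add] at h
          rw [Finset.sum_eq_single k] at h
          · rwa [hxz, if_pos rfl, mul_one] at h
          · intro j _ hj
            rw [hxz, if_neg (fun e => hj (Fin.ext e.symm)), mul_zero]
          · simp
        · have h := congrFun hψ ⟨k - a, by omega⟩
          have hk' : k = Fin.natAdd a ⟨k - a, by omega⟩ := by ext; simp; omega
          rw [hk']
          exact h
    refine (LinearMap.finrank_le_finrank_of_injective hinj).trans_eq ?_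
    simp
  have hV : Module.finrank (ZMod 2) (Fin a ⊕ Fin (a + b) → ZMod 2) = a + (a + b) := by simp
  omega

/-- The parameters of a standardized subspace are bounded by those of any decomposition of a larger
space, as `a + b` is the dimension of a maximal isotropic subspace. -/
lemma add_le_of_map_eq_blockLabels {n a b a' b' : ℕ} (h : a' + b' ≤ n)
    {S T : Submodule (ZMod 2) (PauliVec n)} (hS : HasDecomposition a b S) (hTS : T ≤ S)
    {L : List (Gate n)} (hT : T.map (circuitAct L) = blockLabels n a' b') : a' + b' ≤ a + b := by
  let f : Fin (a' + b') → Fin n := fun i => ⟨n - (a' + b') + i, by omega⟩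
  have hf : Function.Injective f := fun i j hij => by
    simpa [f, Fin.ext_iff] using hij
  let e : Fin (a' + b') → PauliVec n := fun i => (0, Pi.single (f i) 1)
  have he : ∀ i, e i ∈ T.map (circuitAct L) := by
    intro i
    rw [hT]
    refine ⟨fun p _ => rfl, fun p hp => ?_⟩
    refine Pi.single_eq_of_ne ?_ _
    rintro rfl
    simp only [f] at hp
    omega
  choose y hyT hy using he
  refine card_le_of_isotropic hS y (LinearIndependent.of_comp (circuitAct L) ?_)
    (fun i => hTS (hyT i)) fun i j => ?_
  · have : circuitAct L ∘ y = e := funext hy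
    rw [this, Fintype.linearIndependent_iff]
    intro g hg i
    have := congrArg (fun v : PauliVec n => v.2 (f i)) hg
    simpa [e, Prod.snd_sum, Finset.sum_apply, Pi.single_apply, hf.eq_iff] using this
  · rw [← symp_circuitAct L, hy, hy]
    simp [symp, e]

/-! ### Symplectic elimination on the first qubits -/

section

variable {n r : ℕ}

/-- The vector vanishes on the qubits `p < h`. -/
def ZeroBelow (h : ℕ) (v : PauliVec n) : Prop := ∀ p : Fin n, (p : ℕ) < h → v.1 p = 0 ∧ v.2 p = 0

/-- The vector is `Z_q` on the qubits `p ≤ q`. -/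
def IsZAt (q : Fin n) (v : PauliVec n) : Prop := ZeroBelow q v ∧ v.1 q = 0 ∧ v.2 q = 1

/-- The vector is `X_q` on the qubits `p ≤ q`. -/
def IsXAt (q : Fin n) (v : PauliVec n) : Prop := ZeroBelow q v ∧ v.1 q = 1 ∧ v.2 q = 0

/-- The symplectic product restricted to the qubits `p < h`. -/
def sympBelow (h : ℕ) (v w : PauliVec n) : ZMod 2 :=
  ∑ p : Fin n, if (p : ℕ) < h then v.1 p * w.2 p + v.2 p * w.1 p else 0

/-- The gate touches only qubits `p < h`. -/
def Gate.Below (h : ℕ) : Gate n → Prop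
  | .had q => (q : ℕ) < h
  | .phase q => (q : ℕ) < h
  | .cnot c t _ => (c : ℕ) < h ∧ (t : ℕ) < h

lemma Gate.act_apply_of_le {h : ℕ} {g : Gate n} (hg : g.Below h) (v : PauliVec n) (p : Fin n)
    (hp : h ≤ p) : (g.act v).1 p = v.1 p ∧ (g.act v).2 p = v.2 p := by
  have hne : ∀ q : Fin n, (q : ℕ) < h → p ≠ q := by rintro q hq rfl; omega
  cases g with
  | had q => simp [Gate.act, hne q hg]
  | phase q => simp [Gate.act, hne q hg]
  | cnot c t _ => simp [Gate.act, hne c hg.1, hne t hg.2]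

lemma ZeroBelow.gate_act {h : ℕ} {g : Gate n} (hg : g.Below h) {v : PauliVec n}
    (hv : ZeroBelow h v) : g.act v = v := by
  cases g with
  | had q =>
    obtain ⟨h1, h2⟩ := hv q hg
    ext j <;> simp only [Gate.act] <;> split_ifs with hj <;> simp [hj, h1, h2]
  | phase q =>
    obtain ⟨h1, h2⟩ := hv q hg
    ext j <;> simp only [Gate.act]
    split_ifs with hj <;> simp [hj, h1]
  | cnot c t _ =>
    obtain ⟨h1, h2⟩ := hv c hg.1
    obtain ⟨h3, h4⟩ := hv t hg.2
    ext j <;> simp only [Gate.act] <;> split_ifs with hj <;> simp [hj, h1, h4]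

variable {h : ℕ} {L : List (Gate n)}

lemma circuitAct_apply_of_le (hL : ∀ g ∈ L, g.Below h) (v : PauliVec n) (p : Fin n) (hp : h ≤ p) :
    (circuitAct L v).1 p = v.1 p ∧ (circuitAct L v).2 p = v.2 p := by
  induction L generalizing v with
  | nil => exact ⟨rfl, rfl⟩
  | cons g L ih =>
    rw [circuitAct_cons]
    obtain ⟨h1, h2⟩ := ih (fun g' hg' => hL g' (List.mem_cons_of_mem _ hg')) (g.act v)
    obtain ⟨h3, h4⟩ := Gate.act_apply_of_le (hL g List.mem_cons_self) v p hp
    exact ⟨h1.trans h3, h2.trans h4⟩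

lemma ZeroBelow.circuitAct (hL : ∀ g ∈ L, g.Below h) {v : PauliVec n} (hv : ZeroBelow h v) :
    circuitAct L v = v := by
  induction L with
  | nil => rfl
  | cons g L ih =>
    rw [circuitAct_cons, hv.gate_act (hL g List.mem_cons_self)]
    exact ih fun g' hg' => hL g' (List.mem_cons_of_mem _ hg')

lemma symp_eq_sympBelow_add (h : ℕ) (v w : PauliVec n) :
    symp v w = sympBelow h v w +
      ∑ p : Fin n, if (p : ℕ) < h then 0 else v.1 p * w.2 p + v.2 p * w.1 p := by
  rw [symp, sympBelow, ← Finset.sum_add_distrib]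
  refine Finset.sum_congr rfl fun p _ => ?_
  split_ifs <;> simp

lemma sympBelow_circuitAct (hL : ∀ g ∈ L, g.Below h) (v w : PauliVec n) :
    sympBelow h (circuitAct L v) (circuitAct L w) = sympBelow h v w := by
  have e := symp_circuitAct L v w
  rw [symp_eq_sympBelow_add h, symp_eq_sympBelow_add h v w] at e
  have : (∑ p : Fin n, if (p : ℕ) < h then 0 else (circuitAct L v).1 p * (circuitAct L w).2 p +
      (circuitAct L v).2 p * (circuitAct L w).1 p) =
      ∑ p : Fin n, if (p : ℕ) < h then 0 else v.1 p * w.2 p + v.2 p * w.1 p := by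
    refine Finset.sum_congr rfl fun p _ => ?_
    split_ifs with hp
    · rfl
    · obtain ⟨h1, h2⟩ := circuitAct_apply_of_le hL v p (by omega)
      obtain ⟨h3, h4⟩ := circuitAct_apply_of_le hL w p (by omega)
      rw [h1, h2, h3, h4]
  rw [this] at e
  exact add_right_cancel e

lemma sympBelow_succ (q : Fin n) (v w : PauliVec n) :
    sympBelow (q + 1) v w = sympBelow q v w + (v.1 q * w.2 q + v.2 q * w.1 q) := by
  have : v.1 q * w.2 q + v.2 q * w.1 q =
      ∑ p : Fin n, if p = q then v.1 p * w.2 p + v.2 p * w.1 p else 0 := by simp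
  rw [this, sympBelow, sympBelow, ← Finset.sum_add_distrib]
  refine Finset.sum_congr rfl fun p _ => ?_
  rcases lt_trichotomy p q with hp | rfl | hp
  · have : (p : ℕ) < q := hp
    simp [hp.ne, this, Nat.lt_succ_of_lt this]
  · simp
  · have : (q : ℕ) < p := hp
    simp [hp.ne', show ¬ (p : ℕ) < q + 1 by omega, show ¬ (p : ℕ) < q by omega]

lemma sympBelow_zero (v w : PauliVec n) : sympBelow 0 v w = 0 := by simp [sympBelow]

lemma sympBelow_of_zeroBelow_left {v : PauliVec n} (hv : ZeroBelow h v) (w : PauliVec n) :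
    sympBelow h v w = 0 := by
  refine Finset.sum_eq_zero fun p _ => ?_
  split_ifs with hp
  · simp [(hv p hp).1, (hv p hp).2]
  · rfl

lemma sympBelow_of_zeroBelow_right (v : PauliVec n) {w : PauliVec n} (hw : ZeroBelow h w) :
    sympBelow h v w = 0 := by
  refine Finset.sum_eq_zero fun p _ => ?_
  split_ifs with hp
  · simp [(hw p hp).1, (hw p hp).2]
  · rfl

lemma sympBelow_isZAt {q : Fin n} (v : PauliVec n) {w : PauliVec n} (hw : IsZAt q w) :
    sympBelow (q + 1) v w = v.1 q := by
  rw [sympBelow_succ, sympBelow_of_zeroBelow_right v hw.1, hw.2.1, hw.2.2]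
  ring

lemma sympBelow_isXAt {q : Fin n} (v : PauliVec n) {w : PauliVec n} (hw : IsXAt q w) :
    sympBelow (q + 1) v w = v.2 q := by
  rw [sympBelow_succ, sympBelow_of_zeroBelow_right v hw.1, hw.2.1, hw.2.2]
  ring

lemma zmod_two_ne_zero_iff {x : ZMod 2} : x ≠ 0 ↔ x = 1 := by
  revert x; decide

/-! ### Invariants of the elimination -/

/-- The state of the elimination while it looks for anticommuting pairs: the qubits `p ≥ h` are
entirely in the span, and the rows before row `i` are orthogonal to all others on the qubits
`p < h`. -/
structure PairInv (i h : ℕ) (w : Fin r → PauliVec n) : Prop where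
  le : h ≤ n
  mem : ∀ v, ZeroBelow h v → v ∈ Submodule.span (ZMod 2) (Set.range w)
  orth : ∀ l m : Fin r, (l : ℕ) < i → sympBelow h (w l) (w m) = 0

/-- The state of the elimination once no anticommuting pairs are left: the qubits `p ≥ h₁` are
entirely in the span, the qubits `h ≤ p < h₁` carry Pauli matrices `Z` that are in the span, the
rows are orthogonal to each other on the qubits `p < h`, and the rows before row `i` vanish
there. -/
structure ZInv (h₁ i h : ℕ) (w : Fin r → PauliVec n) : Prop where
  le : h ≤ h₁
  le' : h₁ ≤ n
  mem : ∀ v, ZeroBelow h v → (∀ p : Fin n, (p : ℕ) < h₁ → v.1 p = 0) →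
    v ∈ Submodule.span (ZMod 2) (Set.range w)
  noX : ∀ (l : Fin r) (p : Fin n), h ≤ p → (p : ℕ) < h₁ → (w l).1 p = 0
  orth : ∀ l m : Fin r, sympBelow h (w l) (w m) = 0
  zero : ∀ l : Fin r, (l : ℕ) < i → ZeroBelow h (w l)

lemma mem_span_circuitAct (hL : ∀ g ∈ L, g.Below h) {w : Fin r → PauliVec n} {v : PauliVec n}
    (hv : ZeroBelow h v) (hmem : v ∈ Submodule.span (ZMod 2) (Set.range w)) :
    v ∈ Submodule.span (ZMod 2) (Set.range fun l => circuitAct L (w l)) := by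
  have := Submodule.mem_map_of_mem (f := circuitAct L) hmem
  rwa [hv.circuitAct hL, Submodule.map_span, ← Set.range_comp] at this

lemma pairInv_init (w : Fin r → PauliVec n) : PairInv 0 n w where
  le := le_rfl
  mem v hv := by
    have : v = 0 := by
      ext p
      · exact (hv p p.2).1
      · exact (hv p p.2).2
    rw [this]
    exact zero_mem _
  orth l m hl := absurd hl (Nat.not_lt_zero _)

lemma PairInv.skip {w : Fin r → PauliVec n} {i : Fin r} (H : PairInv i h w)
    (hi : ∀ m, sympBelow h (w i) (w m) = 0) : PairInv (i + 1) h w where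
  le := H.le
  mem := H.mem
  orth l m hl := by
    rcases Nat.lt_succ_iff_lt_or_eq.1 hl with hl | hl
    · exact H.orth l m hl
    · rw [Fin.ext hl]
      exact hi m

lemma PairInv.pair {w : Fin r → PauliVec n} {i j : Fin r} {q : Fin n} (H : PairInv i (q + 1) w)
    (hL : ∀ g ∈ L, g.Below (q + 1)) (hi : IsZAt q (circuitAct L (w i)))
    (hj : IsXAt q (circuitAct L (w j))) :
    PairInv (i + 1) q fun l => circuitAct L (w l) where
  le := q.2.le
  mem v hv := by
    set w' := fun l => circuitAct L (w l) with hw'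
    have hu : ZeroBelow (q + 1) (v - v.1 q • w' j - v.2 q • w' i) := by
      intro p hp
      rcases Nat.lt_succ_iff_lt_or_eq.1 hp with hp | hp
      · simp [hw', hv p hp, hi.1 p hp, hj.1 p hp]
      · rw [Fin.ext hp]
        simp [hw', hi.2.1, hi.2.2, hj.2.1, hj.2.2]
    have hmem := mem_span_circuitAct hL hu (H.mem _ hu)
    have e : v = (v - v.1 q • w' j - v.2 q • w' i) + v.1 q • w' j + v.2 q • w' i := by abel
    rw [e]
    exact add_mem (add_mem hmem (Submodule.smul_mem _ _ (Submodule.subset_span ⟨j, rfl⟩)))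
      (Submodule.smul_mem _ _ (Submodule.subset_span ⟨i, rfl⟩))
  orth l m hl := by
    rcases Nat.lt_succ_iff_lt_or_eq.1 hl with hl | hl
    · have e : ∀ m, sympBelow (q + 1) (circuitAct L (w l)) (circuitAct L (w m)) = 0 := fun m => by
        rw [sympBelow_circuitAct hL, H.orth l m hl]
      have e1 := (sympBelow_isZAt _ hi).symm.trans (e i)
      have e2 := (sympBelow_isXAt _ hj).symm.trans (e j)
      have e3 := e m
      rw [sympBelow_succ, e1, e2] at e3
      simpa using e3
    · rw [Fin.ext hl]
      exact sympBelow_of_zeroBelow_left hi.1 _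

lemma PairInv.zInv {w : Fin r → PauliVec n} (H : PairInv r h w) : ZInv h 0 h w where
  le := le_rfl
  le' := H.le
  mem v hv _ := H.mem v hv
  noX l p hp hp' := by omega
  orth l m := H.orth l m l.2
  zero l hl := absurd hl (Nat.not_lt_zero _)

lemma ZInv.skip {h₁ : ℕ} {w : Fin r → PauliVec n} {i : Fin r} (H : ZInv h₁ i h w)
    (hi : ZeroBelow h (w i)) : ZInv h₁ (i + 1) h w where
  le := H.le
  le' := H.le'
  mem := H.mem
  noX := H.noX
  orth := H.orth
  zero l hl := by
    rcases Nat.lt_succ_iff_lt_or_eq.1 hl with hl | hl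
    · exact H.zero l hl
    · rw [Fin.ext hl]
      exact hi

lemma ZInv.eliminate {h₁ : ℕ} {w : Fin r → PauliVec n} {i : Fin r} {q : Fin n}
    (H : ZInv h₁ i (q + 1) w) (hL : ∀ g ∈ L, g.Below (q + 1))
    (hi : IsZAt q (circuitAct L (w i))) : ZInv h₁ (i + 1) q fun l => circuitAct L (w l) := by
  have hx : ∀ l, (circuitAct L (w l)).1 q = 0 := by
    intro l
    rw [← sympBelow_isZAt _ hi, sympBelow_circuitAct hL, H.orth]
  have hnoX : ∀ (l : Fin r) (p : Fin n), q ≤ p → (p : ℕ) < h₁ → (circuitAct L (w l)).1 p = 0 := by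
    intro l p hp hp'
    rcases hp.eq_or_lt with hp | hp
    · rw [← hp]
      exact hx l
    · rw [(circuitAct_apply_of_le hL (w l) p hp).1]
      exact H.noX l p hp hp'
  refine ⟨by have := H.le; omega, H.le', ?_, hnoX, ?_, ?_⟩
  · intro v hv hvx
    set w' := fun l => circuitAct L (w l) with hw'
    have hu : ZeroBelow (q + 1) (v - v.2 q • w' i) := by
      intro p hp
      rcases Nat.lt_succ_iff_lt_or_eq.1 hp with hp | hp
      · simp [hw', hv p hp, hi.1 p hp]
      · rw [Fin.ext hp]
        simp [hw', hi.2.1, hi.2.2, hvx q (by have := H.le; omega)]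
    have hux : ∀ p : Fin n, (p : ℕ) < h₁ → (v - v.2 q • w' i).1 p = 0 := by
      intro p hp
      by_cases hpq : (p : ℕ) < q + 1
      · exact (hu p hpq).1
      · simp [hvx p hp, hw', hnoX i p (Fin.le_def.2 (by omega)) hp]
    have hmem := mem_span_circuitAct hL hu (H.mem _ hu hux)
    have e : v = (v - v.2 q • w' i) + v.2 q • w' i := by abel
    rw [e]
    exact add_mem hmem (Submodule.smul_mem _ _ (Submodule.subset_span ⟨i, rfl⟩))
  · intro l m
    have e := sympBelow_circuitAct hL (w l) (w m)
    rw [H.orth, sympBelow_succ, hx, hx] at e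
    simpa using e
  · intro l hl
    rcases Nat.lt_succ_iff_lt_or_eq.1 hl with hl | hl
    · have := H.zero l hl
      rw [this.circuitAct hL]
      exact fun p hp => this p (Nat.lt_succ_of_lt hp)
    · rw [Fin.ext hl]
      exact hi.1

lemma ZInv.span_eq {h₁ : ℕ} {w : Fin r → PauliVec n} (H : ZInv h₁ r h w) :
    Submodule.span (ZMod 2) (Set.range w) = blockLabels n (n - h₁) (h₁ - h) := by
  have h1 := H.le
  have h2 := H.le'
  refine le_antisymm (Submodule.span_le.2 ?_) fun v hv => ?_
  · rintro _ ⟨l, rfl⟩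
    refine ⟨fun p hp => ?_, fun p hp => ?_⟩
    · by_cases hph : (p : ℕ) < h
      · exact (H.zero l l.2 p hph).1
      · exact H.noX l p (by omega) (by omega)
    · exact (H.zero l l.2 p (by omega)).2
  · exact H.mem v (fun p hp => ⟨hv.1 p (by omega), hv.2 p (by omega)⟩) fun p hp =>
      hv.1 p (by omega)

end

section

/-! ### Reasoning about word RAM programs -/

/-- The program halts from `m` within `T` steps, in a memory that satisfies `Q`. -/
def Spec (M : ℕ) (p : Cmd) (m : Mem) (T : ℕ) (Q : Mem → Prop) : Prop :=
  ∃ t m', Exec M p m t m' ∧ t ≤ T ∧ Q m'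

/-- The memory after an assignment to register `x`. -/
def Mem.setReg (m : Mem) (x v : ℕ) : Mem := ⟨Function.update m.reg x v, m.arr⟩

/-- The memory after a store to cell `i` of array `A`. -/
def Mem.setArr (m : Mem) (A i v : ℕ) : Mem :=
  ⟨m.reg, Function.update m.arr A (Function.update (m.arr A) i v)⟩

@[simp] lemma Mem.setReg_reg (m : Mem) (x v y : ℕ) :
    (m.setReg x v).reg y = if y = x then v else m.reg y := by
  simp [Mem.setReg, Function.update_apply]

@[simp] lemma Mem.setReg_arr (m : Mem) (x v : ℕ) : (m.setReg x v).arr = m.arr := rfl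

@[simp] lemma Mem.setArr_reg (m : Mem) (A i v : ℕ) : (m.setArr A i v).reg = m.reg := rfl

lemma Mem.setArr_arr (m : Mem) (A i v B j : ℕ) :
    (m.setArr A i v).arr B j = if B = A ∧ j = i then v else m.arr B j := by
  by_cases hB : B = A
  · subst hB
    simp [Mem.setArr, Function.update_apply]
  · simp [Mem.setArr, hB]

variable {M : ℕ}

lemma Spec.mono {p : Cmd} {m : Mem} {T T' : ℕ} {Q Q' : Mem → Prop} (h : Spec M p m T Q)
    (hT : T ≤ T') (hQ : ∀ m', Q m' → Q' m') : Spec M p m T' Q' := by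
  obtain ⟨t, m', he, ht, hm⟩ := h
  exact ⟨t, m', he, ht.trans hT, hQ _ hm⟩

lemma Spec.skip {m : Mem} {Q : Mem → Prop} (h : Q m) : Spec M .skip m 1 Q :=
  ⟨1, m, .skip m, le_rfl, h⟩

lemma Spec.assign {m : Mem} {x v T : ℕ} {e : Expr} {Q : Mem → Prop} (hf : e.Fits M m)
    (hv : e.eval m = v) (hT : e.cost + 1 ≤ T) (h : Q (m.setReg x v)) :
    Spec M (.assign x e) m T Q :=
  ⟨_, _, .assign m x e hf, hT, hv ▸ h⟩

lemma Spec.store {m : Mem} {A j v T : ℕ} {i e : Expr} {Q : Mem → Prop} (hi : i.Fits M m)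
    (hj : i.eval m = j) (he : e.Fits M m) (hv : e.eval m = v) (hT : i.cost + e.cost + 1 ≤ T)
    (h : Q (m.setArr A j v)) : Spec M (.store A i e) m T Q :=
  ⟨_, _, .store m A i e hi he, hT, hv ▸ hj ▸ h⟩

lemma Spec.seq {p q : Cmd} {m : Mem} {T' : ℕ} {Q : Mem → Prop} (S T : ℕ) (hT : S + T ≤ T')
    (h : Spec M p m S fun m' => Spec M q m' T Q) : Spec M (.seq p q) m T' Q := by
  obtain ⟨s, m', he, hs, t, m'', he', ht, hm⟩ := h
  exact ⟨s + t, m'', .seq _ _ _ _ _ _ _ he he', by omega, hm⟩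

lemma Spec.branch {e : Expr} {p q : Cmd} {m : Mem} {T' : ℕ} {Q : Mem → Prop} (T : ℕ)
    (hT : e.cost + 1 + T ≤ T') (hf : e.Fits M m) (h1 : e.eval m ≠ 0 → Spec M p m T Q)
    (h0 : e.eval m = 0 → Spec M q m T Q) : Spec M (.branch e p q) m T' Q := by
  by_cases h : e.eval m = 0
  · obtain ⟨t, m', he, ht, hm⟩ := h0 h
    exact ⟨_, m', .branch_false _ _ _ _ _ _ hf h he, by omega, hm⟩
  · obtain ⟨t, m', he, ht, hm⟩ := h1 h
    exact ⟨_, m', .branch_true _ _ _ _ _ _ hf h he, by omega, hm⟩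

/-- `for x in [0, y)`, where `x` and `y` are registers. -/
def Cmd.forLoop (x y : ℕ) (body : Cmd) : Cmd :=
  .seq (.assign x (.const 0))
    (.loop (.lt (.reg x) (.reg y)) (.seq body (.assign x (.add (.reg x) (.const 1)))))

/-- The loop rule: `I k` holds when the counter is `k`. -/
lemma Spec.forLoop {x y N T : ℕ} {body : Cmd} {m : Mem} {Q : Mem → Prop} (I : ℕ → Mem → Prop)
    (hxy : x ≠ y) (hN : m.reg y = N) (hM : N + 1 < M) (h0 : I 0 (m.setReg x 0))
    (step : ∀ k m', k < N → m'.reg x = k → m'.reg y = N → I k m' →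
      Spec M body m' T fun m'' =>
        m''.reg x = k ∧ m''.reg y = N ∧ I (k + 1) (m''.setReg x (k + 1)))
    (hQ : ∀ m', m'.reg x = N → m'.reg y = N → I N m' → Q m') :
    Spec M (.forLoop x y body) m (N * (T + 8) + 6) Q := by
  have key : ∀ d k m', k + d = N → m'.reg x = k → m'.reg y = N → I k m' →
      Spec M (.loop (.lt (.reg x) (.reg y)) (.seq body (.assign x (.add (.reg x) (.const 1)))))
        m' (d * (T + 8) + 4) Q := by
    intro d
    induction d with
    | zero =>
      intro k m' hk hx hy hI
      refine ⟨_, m', .loop_false _ _ _ ?_ ?_, le_of_eq ?_, hQ m' (by omega) hy ?_⟩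
      · simp only [Expr.Fits]; omega
      · change (if m'.reg x < m'.reg y then 1 else 0) = 0
        exact if_neg (by omega)
      · simp [Expr.cost]
      · rw [← hk]; exact hI
    | succ d ih =>
      intro k m' hk hx hy hI
      obtain ⟨s, m₁, he, hs, hx₁, hy₁, hI₁⟩ := step k m' (by omega) hx hy hI
      have he' : Exec M (.assign x (.add (.reg x) (.const 1))) m₁ 4 (m₁.setReg x (k + 1)) := by
        have := Exec.assign (M := M) m₁ x (.add (.reg x) (.const 1))
          (by simp only [Expr.Fits, Expr.eval]; omega)
        simpa [Expr.cost, Expr.eval, hx₁, Mem.setReg] using this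
      obtain ⟨t, m₂, he₂, ht, hm⟩ := ih (k + 1) (m₁.setReg x (k + 1)) (by omega) (by simp)
        (by simp [hxy.symm, hy₁]) hI₁
      refine ⟨_, m₂, .loop_true _ _ _ _ _ _ _ ?_ ?_ (.seq _ _ _ _ _ _ _ he he') he₂, ?_, hm⟩
      · simp only [Expr.Fits]; omega
      · change (if m'.reg x < m'.reg y then 1 else 0) ≠ 0
        rw [if_pos (by omega)]
        exact one_ne_zero
      · simp only [Expr.cost]
        rw [add_mul]
        omega
  have := key N 0 (m.setReg x 0) (by omega) (by simp) (by simp [hxy.symm, hN]) h0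
  exact Spec.seq 2 _ (by omega) (Spec.assign (by simp only [Expr.Fits]; omega) rfl le_rfl this)

end

/-! ### Gates as programs -/

section

variable {n r M : ℕ}

/-- The cell of array `0` that holds the `X` bit of a row at a qubit; `l` and `p` are the registers
that hold the row and the qubit. -/
def xIdx (l p : ℕ) : Expr := .add (.mul (.reg l) (.add (.reg 0) (.reg 0))) (.reg p)

/-- The cell of array `0` that holds the `Z` bit of a row at a qubit. -/
def zIdx (l p : ℕ) : Expr :=
  .add (.mul (.reg l) (.add (.reg 0) (.reg 0))) (.add (.reg p) (.reg 0))

/-- The `X` bit of a row at a qubit. -/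
def xBit (l p : ℕ) : Expr := .load 0 (xIdx l p)

/-- The `Z` bit of a row at a qubit. -/
def zBit (l p : ℕ) : Expr := .load 0 (zIdx l p)

/-- The sum of two bits modulo `2`. -/
def Expr.xor (e f : Expr) : Expr := .sub (.const 1) (.eq e f)

/-- The memory holds the rows `w` and the circuit `L`. -/
structure Holds (w : Fin r → PauliVec n) (L : List (Gate n)) (m : Mem) : Prop where
  reg_zero : m.reg 0 = n
  reg_one : m.reg 1 = r
  reg_two : m.reg 2 = L.length
  xbit : ∀ (l : Fin r) (p : Fin n), m.arr 0 (l * (n + n) + p) = ((w l).1 p).val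
  zbit : ∀ (l : Fin r) (p : Fin n), m.arr 0 (l * (n + n) + (p + n)) = ((w l).2 p).val
  code : ∀ i (h : i < L.length),
    (m.arr 1 (3 * i), m.arr 1 (3 * i + 1), m.arr 1 (3 * i + 2)) = (L[i]).code

/-- The word bound suffices for the indices of rows and qubits, with some room. -/
structure Fitting (M n r : ℕ) : Prop where
  two : 2 < M
  qubits : n + n + 2 < M
  rows : r + 2 < M
  cells : r * (n + n) < M

variable {w : Fin r → PauliVec n} {L : List (Gate n)} {m m' : Mem}

lemma Holds.congr (H : Holds w L m) (ha : m'.arr = m.arr) (h0 : m'.reg 0 = m.reg 0)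
    (h1 : m'.reg 1 = m.reg 1) (h2 : m'.reg 2 = m.reg 2) : Holds w L m' := by
  obtain ⟨a, b, c, d, e, f⟩ := H
  exact ⟨h0.trans a, h1.trans b, h2.trans c, ha ▸ d, ha ▸ e, ha ▸ f⟩

lemma Holds.setReg (H : Holds w L m) {x v : ℕ} (hx : 2 < x) : Holds w L (m.setReg x v) :=
  H.congr rfl (by simp [show 0 ≠ x by omega]) (by simp [show 1 ≠ x by omega])
    (by simp [show 2 ≠ x by omega])

lemma index_lt (l : Fin r) {j : ℕ} (hj : j < n + n) : (l : ℕ) * (n + n) + j < r * (n + n) := by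
  have : (l + 1) * (n + n) ≤ r * (n + n) := Nat.mul_le_mul_right _ l.2
  rw [add_mul, one_mul] at this
  omega

lemma index_inj {l l' j j' : ℕ} (hj : j < n + n) (hj' : j' < n + n)
    (h : l * (n + n) + j = l' * (n + n) + j') : l = l' ∧ j = j' := by
  have hl : l = l' := by
    have h1 : (l * (n + n) + j) / (n + n) = l := by
      rw [mul_comm, Nat.mul_add_div (by omega), Nat.div_eq_of_lt hj, add_zero]
    have h2 : (l' * (n + n) + j') / (n + n) = l' := by
      rw [mul_comm, Nat.mul_add_div (by omega), Nat.div_eq_of_lt hj', add_zero]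
    rw [← h1, h, h2]
  subst hl
  omega

lemma zmod_two_val_lt (x : ZMod 2) : x.val < 2 := ZMod.val_lt x

section

variable (H : Holds w L m) {ρ π : ℕ} {l : Fin r} {p : Fin n}
  (hl : m.reg ρ = l) (hp : m.reg π = p) (hM : Fitting M n r)

include H hl hp

lemma Holds.eval_xIdx : (xIdx ρ π).eval m = l * (n + n) + p := by
  simp [xIdx, Expr.eval, H.reg_zero, hl, hp]

lemma Holds.eval_zIdx : (zIdx ρ π).eval m = l * (n + n) + (p + n) := by
  simp [zIdx, Expr.eval, H.reg_zero, hl, hp]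

lemma Holds.eval_xBit : (xBit ρ π).eval m = ((w l).1 p).val := by
  rw [xBit, Expr.eval, H.eval_xIdx hl hp, H.xbit]

lemma Holds.eval_zBit : (zBit ρ π).eval m = ((w l).2 p).val := by
  rw [zBit, Expr.eval, H.eval_zIdx hl hp, H.zbit]

include hM

lemma Holds.fits_xIdx : (xIdx ρ π).Fits M m := by
  have h1 := index_lt (n := n) l (j := p) (by omega)
  have h2 := hM.cells
  have h3 := hM.qubits
  have h4 := hM.rows
  have h5 := H.reg_zero
  simp only [xIdx, Expr.Fits, Expr.eval, h5, hl, hp]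
  omega

lemma Holds.fits_zIdx : (zIdx ρ π).Fits M m := by
  have h1 := index_lt (n := n) l (j := p + n) (by omega)
  have h2 := hM.cells
  have h3 := hM.qubits
  have h4 := hM.rows
  have h5 := H.reg_zero
  simp only [zIdx, Expr.Fits, Expr.eval, h5, hl, hp]
  omega

lemma Holds.fits_xBit : (xBit ρ π).Fits M m := by
  refine ⟨H.fits_xIdx hl hp hM, ?_⟩
  rw [H.eval_xIdx hl hp, H.xbit]
  exact (zmod_two_val_lt _).trans hM.two

lemma Holds.fits_zBit : (zBit ρ π).Fits M m := by
  refine ⟨H.fits_zIdx hl hp hM, ?_⟩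
  rw [H.eval_zIdx hl hp, H.zbit]
  exact (zmod_two_val_lt _).trans hM.two

end

lemma eval_xor {e f : Expr} {s t : ZMod 2} (he : e.eval m = s.val) (hf : f.eval m = t.val) :
    (e.xor f).eval m = (s + t).val := by
  simp only [Expr.xor, Expr.eval, he, hf]
  clear he hf
  revert s t
  decide

lemma fits_xor {e f : Expr} (hM : 2 < M) (he : e.Fits M m) (hf : f.Fits M m) :
    (e.xor f).Fits M m := by
  simp only [Expr.xor, Expr.Fits]
  exact ⟨by omega, he, hf, by omega⟩

lemma Holds.setX (H : Holds w L m) (l : Fin r) (p : Fin n) (s : ZMod 2) :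
    Holds (Function.update w l (Function.update (w l).1 p s, (w l).2)) L
      (m.setArr 0 (l * (n + n) + p) s.val) where
  reg_zero := H.reg_zero
  reg_one := H.reg_one
  reg_two := H.reg_two
  xbit l' p' := by
    rw [Mem.setArr_arr]
    by_cases hl : l' = l
    · subst hl
      by_cases hp : p' = p
      · subst hp; simp
      · have : (p' : ℕ) ≠ p := fun e => hp (Fin.ext e)
        simp [hp, this, H.xbit]
    · have : ¬ (l' * (n + n) + p' = l * (n + n) + (p : ℕ)) := fun e =>
        hl (Fin.ext (index_inj (by omega) (by omega) e).1)
      simp [hl, this, H.xbit]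
  zbit l' p' := by
    have : ¬ (l' * (n + n) + (p' + n) = l * (n + n) + (p : ℕ)) := fun e => by
      have := (index_inj (by omega) (by omega) e).2
      omega
    rw [Mem.setArr_arr, if_neg (fun e => this e.2), H.zbit]
    by_cases hl : l' = l
    · subst hl; simp
    · simp [hl]
  code i hi := by simp only [Mem.setArr_arr, one_ne_zero, false_and, if_false, H.code i hi]

lemma Holds.setZ (H : Holds w L m) (l : Fin r) (p : Fin n) (s : ZMod 2) :
    Holds (Function.update w l ((w l).1, Function.update (w l).2 p s)) L
      (m.setArr 0 (l * (n + n) + (p + n)) s.val) where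
  reg_zero := H.reg_zero
  reg_one := H.reg_one
  reg_two := H.reg_two
  zbit l' p' := by
    rw [Mem.setArr_arr]
    by_cases hl : l' = l
    · subst hl
      by_cases hp : p' = p
      · subst hp; simp
      · have : (p' : ℕ) ≠ p := fun e => hp (Fin.ext e)
        simp [hp, this, H.zbit]
    · have : ¬ (l' * (n + n) + (p' + n) = l * (n + n) + (p + n : ℕ)) := fun e =>
        hl (Fin.ext (index_inj (by omega) (by omega) e).1)
      simp [hl, this, H.zbit]
  xbit l' p' := by
    have : ¬ (l' * (n + n) + p' = l * (n + n) + (p + n : ℕ)) := fun e => by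
      have := (index_inj (by omega) (by omega) e).2
      omega
    rw [Mem.setArr_arr, if_neg (fun e => this e.2), H.xbit]
    by_cases hl : l' = l
    · subst hl; simp
    · simp [hl]
  code i hi := by simp only [Mem.setArr_arr, one_ne_zero, false_and, if_false, H.code i hi]

/-- Appends a gate, given by the three words of its code, to the output. -/
def emit (c : ℕ) (e f : Expr) : Cmd :=
  .seq (.store 1 (.mul (.const 3) (.reg 2)) (.const c))
    (.seq (.store 1 (.add (.mul (.const 3) (.reg 2)) (.const 1)) e)
      (.seq (.store 1 (.add (.mul (.const 3) (.reg 2)) (.const 2)) f)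
        (.assign 2 (.add (.reg 2) (.const 1)))))

/-- The register is used for neither the input nor the output nor the execution of gates. -/
def IsFree (x : ℕ) : Prop := x ≠ 0 ∧ x ≠ 1 ∧ x ≠ 2 ∧ x ≠ 13 ∧ x ≠ 14

/-- Applies a gate to all rows; `body` applies it to the row in register `13`. -/
def applyGate (c : ℕ) (e f : Expr) (body : Cmd) : Cmd :=
  .seq (emit c e f) (.forLoop 13 1 body)

lemma spec_emit (H : Holds w L m) (hM : Fitting M n r) (hL : 3 * L.length + 3 < M) {g : Gate n}
    {c : ℕ} {e f : Expr} (he : ∀ m', m'.reg = m.reg → e.eval m' = g.code.2.1 ∧ e.Fits M m')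
    (hf : ∀ m', m'.reg = m.reg → f.eval m' = g.code.2.2 ∧ f.Fits M m') (hc : c = g.code.1)
    (hc2 : c ≤ 2) (hec : e.cost = 1) (hfc : f.cost = 1) :
    Spec M (emit c e f) m 30 fun m' =>
      Holds w (L ++ [g]) m' ∧ ∀ x, x ≠ 2 → m'.reg x = m.reg x := by
  have h2 := hM.two
  have hr2 := H.reg_two
  have h1 : ∀ m₁ : Mem, m₁.reg = m.reg → (Expr.mul (.const 3) (.reg 2)).Fits M m₁ := by
    intro m₁ h₁
    simp only [Expr.Fits, Expr.eval, h₁]; omega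
  have h3 : ∀ (m₁ : Mem) (j : ℕ), m₁.reg = m.reg → j ≤ 2 →
      (Expr.add (.mul (.const 3) (.reg 2)) (.const j)).Fits M m₁ := by
    intro m₁ j h₁ hj
    simp only [Expr.Fits, Expr.eval, h₁]; omega
  have h4 : ∀ (m₁ : Mem) (j : ℕ), m₁.reg = m.reg →
      (Expr.add (.mul (.const 3) (.reg 2)) (.const j)).eval m₁ = 3 * L.length + j := by
    intro m₁ j h₁
    simp only [Expr.eval, h₁, hr2]
  refine Spec.seq 5 25 le_rfl (Spec.store (j := 3 * L.length) (v := c) (h1 _ rfl)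
    (by simp only [Expr.eval, hr2]) (by simp only [Expr.Fits]; omega) rfl le_rfl ?_)
  refine Spec.seq 7 18 le_rfl (Spec.store (h3 _ _ rfl (by decide)) (h4 _ _ rfl)
    (he (m.setArr _ _ _) rfl).2 (he (m.setArr _ _ _) rfl).1 (by rw [hec]; exact le_rfl) ?_)
  refine Spec.seq 7 11 le_rfl (Spec.store (h3 _ _ rfl (by decide)) (h4 _ _ rfl)
    (hf ((m.setArr _ _ _).setArr _ _ _) rfl).2 (hf ((m.setArr _ _ _).setArr _ _ _) rfl).1
    (by rw [hfc]; exact le_rfl) ?_)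
  refine Spec.assign (v := L.length + 1) ?_ ?_ (show 4 ≤ 11 by decide) ?_
  · simp only [Expr.Fits, Expr.eval, Mem.setArr_reg]; omega
  · simp only [Expr.eval, Mem.setArr_reg, hr2]
  · refine ⟨⟨?_, ?_, ?_, ?_, ?_, ?_⟩, ?_⟩
    · simpa using H.reg_zero
    · simpa using H.reg_one
    · simp
    · intro l p; simpa [Mem.setArr_arr] using H.xbit l p
    · intro l p; simpa [Mem.setArr_arr] using H.zbit l p
    · intro i hi
      rw [List.length_append, List.length_singleton] at hi
      simp only [Mem.setReg_arr, Mem.setArr_arr, true_and]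
      rcases Nat.lt_succ_iff_lt_or_eq.1 hi with hi' | rfl
      · rw [List.getElem_append_left hi', ← H.code i hi']
        simp (disch := omega) only [if_neg]
      · simp (disch := omega) only [if_neg]
        simp [hc]
    · intro x hx; simp [hx]

lemma spec_applyGate (H : Holds w L m) (hM : Fitting M n r) (hL : 3 * L.length + 3 < M)
    {g : Gate n} {c : ℕ} {e f : Expr} {body : Cmd} {T : ℕ}
    (he : ∀ m', m'.reg = m.reg → e.eval m' = g.code.2.1 ∧ e.Fits M m')
    (hf : ∀ m', m'.reg = m.reg → f.eval m' = g.code.2.2 ∧ f.Fits M m') (hc : c = g.code.1)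
    (hc2 : c ≤ 2) (hec : e.cost = 1) (hfc : f.cost = 1)
    (hbody : ∀ (w' : Fin r → PauliVec n) (l : Fin r) (m' : Mem), Holds w' (L ++ [g]) m' →
      m'.reg 13 = l → (∀ x, IsFree x → m'.reg x = m.reg x) →
      Spec M body m' T fun m'' => Holds (Function.update w' l (g.act (w' l))) (L ++ [g]) m'' ∧
        ∀ x, x ≠ 14 → m''.reg x = m'.reg x) :
    Spec M (applyGate c e f body) m (r * (T + 8) + 36) fun m' =>
      Holds (fun l => g.act (w l)) (L ++ [g]) m' ∧ ∀ x, IsFree x → m'.reg x = m.reg x := by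
  have h := spec_emit H hM hL he hf hc hc2 hec hfc
  refine Spec.seq 30 (r * (T + 8) + 6) (by omega) (h.mono le_rfl ?_)
  rintro m₁ ⟨H₁, hreg⟩
  refine Spec.forLoop (fun k m' =>
    Holds (fun l => if (l : ℕ) < k then g.act (w l) else w l) (L ++ [g]) m' ∧
      ∀ x, IsFree x → m'.reg x = m.reg x) (by decide) H₁.reg_one (by have := hM.rows; omega)
    ?_ ?_ ?_
  · refine ⟨?_, fun x hx => ?_⟩
    · simpa using H₁.setReg (by decide)
    · rw [Mem.setReg_reg, if_neg hx.2.2.2.1, hreg x hx.2.2.1]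
  · rintro k m' hk h13 h1 ⟨H', hreg'⟩
    refine (hbody _ ⟨k, hk⟩ m' H' h13 hreg').mono le_rfl ?_
    rintro m'' ⟨H'', hreg''⟩
    refine ⟨by rw [hreg'' _ (by decide), h13], by rw [hreg'' _ (by decide), h1], ?_, fun x hx => ?_⟩
    · refine Holds.setReg ?_ (by decide)
      convert H'' using 1
      ext1 l
      by_cases hl : l = ⟨k, hk⟩
      · subst hl; simp
      · have : (l : ℕ) ≠ k := fun e => hl (Fin.ext e)
        rw [Function.update_of_ne hl]
        by_cases hlk : (l : ℕ) < k
        · simp [hlk, Nat.lt_succ_of_lt hlk]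
        · simp [hlk, show ¬ (l : ℕ) < k + 1 by omega]
    · rw [Mem.setReg_reg, if_neg hx.2.2.2.1, hreg'' x hx.2.2.2.2, hreg' x hx]
  · rintro m' - - ⟨H', hreg'⟩
    refine ⟨?_, hreg'⟩
    simpa using H'

/-- Applies a Hadamard gate to the qubit in register `π`. -/
def hadCmd (π : ℕ) : Cmd :=
  applyGate 0 (.reg π) (.const 0)
    (.seq (.assign 14 (xBit 13 π))
      (.seq (.store 0 (xIdx 13 π) (zBit 13 π)) (.store 0 (zIdx 13 π) (.reg 14))))

/-- Applies a phase gate to the qubit in register `π`. -/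
def phaseCmd (π : ℕ) : Cmd :=
  applyGate 1 (.reg π) (.const 0) (.store 0 (zIdx 13 π) ((zBit 13 π).xor (xBit 13 π)))

/-- Applies a CNOT gate to the qubits in the registers `κ` (control) and `τ` (target). -/
def cnotCmd (κ τ : ℕ) : Cmd :=
  applyGate 2 (.reg κ) (.reg τ)
    (.seq (.store 0 (xIdx 13 τ) ((xBit 13 τ).xor (xBit 13 κ)))
      (.store 0 (zIdx 13 κ) ((zBit 13 κ).xor (zBit 13 τ))))

lemma spec_hadCmd (H : Holds w L m) (hM : Fitting M n r) (hL : 3 * L.length + 3 < M)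
    {π : ℕ} (hπ : IsFree π) {q : Fin n} (hq : m.reg π = q) :
    Spec M (hadCmd π) m (r * 68 + 36) fun m' =>
      Holds (fun l => (Gate.had q).act (w l)) (L ++ [.had q]) m' ∧
        ∀ x, IsFree x → m'.reg x = m.reg x := by
  have hqM := hM.qubits
  refine spec_applyGate (T := 60) H hM hL ?_ ?_ rfl (by decide) rfl rfl ?_
  · intro m' hm'
    simp only [Expr.eval, Expr.Fits, hm', hq, Gate.code, true_and]
    omega
  · intro m' hm'
    simp only [Expr.eval, Expr.Fits, Gate.code, true_and]
    omega
  intro w' l m₁ H₁ h13 hreg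
  have hq₁ : m₁.reg π = q := by rw [hreg π hπ, hq]
  have hπ14 : π ≠ 14 := hπ.2.2.2.2
  have h14 : Holds w' (L ++ [.had q]) (m₁.setReg 14 ((w' l).1 q).val) := H₁.setReg (by decide)
  have h14l : (m₁.setReg 14 ((w' l).1 q).val).reg 13 = l := by simp [h13]
  have h14q : (m₁.setReg 14 ((w' l).1 q).val).reg π = q := by simp [hπ14, hq₁]
  refine Spec.seq 9 43 (by decide) (Spec.assign (H₁.fits_xBit h13 hq₁ hM) (H₁.eval_xBit h13 hq₁)
    (Nat.le_of_ble_eq_true rfl) ?_)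
  refine Spec.seq 22 21 le_rfl (Spec.store (h14.fits_xIdx h14l h14q hM) (h14.eval_xIdx h14l h14q)
    (h14.fits_zBit h14l h14q hM) (h14.eval_zBit h14l h14q) (Nat.le_of_ble_eq_true rfl) ?_)
  have h2 := h14.setX l q ((w' l).2 q)
  refine Spec.store (v := ((w' l).1 q).val) (h2.fits_zIdx h14l h14q hM) (h2.eval_zIdx h14l h14q)
    ?_ ?_ (Nat.le_of_ble_eq_true rfl) ⟨?_, fun x hx => by simp [hx]⟩
  · simp only [Expr.Fits, Mem.setArr_reg, Mem.setReg_reg, if_true]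
    exact (zmod_two_val_lt _).trans hM.two
  · simp [Expr.eval]
  · convert h2.setZ l q ((w' l).1 q) using 1
    rw [Function.update_idem]
    congr 1
    ext j <;> by_cases hj : j = q <;> simp [Gate.act, hj]

lemma spec_phaseCmd (H : Holds w L m) (hM : Fitting M n r) (hL : 3 * L.length + 3 < M)
    {π : ℕ} (hπ : IsFree π) {q : Fin n} (hq : m.reg π = q) :
    Spec M (phaseCmd π) m (r * 68 + 36) fun m' =>
      Holds (fun l => (Gate.phase q).act (w l)) (L ++ [.phase q]) m' ∧
        ∀ x, IsFree x → m'.reg x = m.reg x := by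
  have hqM := hM.qubits
  refine spec_applyGate (T := 60) H hM hL ?_ ?_ rfl (by decide) rfl rfl ?_
  · intro m' hm'
    simp only [Expr.eval, Expr.Fits, hm', hq, Gate.code, true_and]
    omega
  · intro m' hm'
    simp only [Expr.eval, Expr.Fits, Gate.code, true_and]
    omega
  intro w' l m₁ H₁ h13 hreg
  have hq₁ : m₁.reg π = q := by rw [hreg π hπ, hq]
  refine Spec.store (H₁.fits_zIdx h13 hq₁ hM) (H₁.eval_zIdx h13 hq₁)
    (fits_xor hM.two (H₁.fits_zBit h13 hq₁ hM) (H₁.fits_xBit h13 hq₁ hM))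
    (eval_xor (H₁.eval_zBit h13 hq₁) (H₁.eval_xBit h13 hq₁)) (Nat.le_of_ble_eq_true rfl)
    ⟨?_, fun x hx => rfl⟩
  convert H₁.setZ l q ((w' l).2 q + (w' l).1 q) using 1
  congr 1
  ext j <;> by_cases hj : j = q <;> simp [Gate.act, hj]

lemma spec_cnotCmd (H : Holds w L m) (hM : Fitting M n r) (hL : 3 * L.length + 3 < M)
    {κ τ : ℕ} (hκ : IsFree κ) (hτ : IsFree τ) {c t : Fin n} (hc : m.reg κ = c)
    (ht : m.reg τ = t) (hct : c ≠ t) :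
    Spec M (cnotCmd κ τ) m (r * 68 + 36) fun m' =>
      Holds (fun l => (Gate.cnot c t hct).act (w l)) (L ++ [.cnot c t hct]) m' ∧
        ∀ x, IsFree x → m'.reg x = m.reg x := by
  have hqM := hM.qubits
  refine spec_applyGate (T := 60) H hM hL ?_ ?_ rfl (by decide) rfl rfl ?_
  · intro m' hm'
    simp only [Expr.eval, Expr.Fits, hm', hc, Gate.code, true_and]
    omega
  · intro m' hm'
    simp only [Expr.eval, Expr.Fits, hm', ht, Gate.code, true_and]
    omega
  intro w' l m₁ H₁ h13 hreg
  have hc₁ : m₁.reg κ = c := by rw [hreg κ hκ, hc]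
  have ht₁ : m₁.reg τ = t := by rw [hreg τ hτ, ht]
  refine Spec.seq 27 33 le_rfl (Spec.store (H₁.fits_xIdx h13 ht₁ hM) (H₁.eval_xIdx h13 ht₁)
    (fits_xor hM.two (H₁.fits_xBit h13 ht₁ hM) (H₁.fits_xBit h13 hc₁ hM))
    (eval_xor (H₁.eval_xBit h13 ht₁) (H₁.eval_xBit h13 hc₁)) (Nat.le_of_ble_eq_true rfl) ?_)
  have h2 := H₁.setX l t ((w' l).1 t + (w' l).1 c)
  refine Spec.store (h2.fits_zIdx h13 hc₁ hM) (h2.eval_zIdx h13 hc₁)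
    (fits_xor hM.two (h2.fits_zBit h13 hc₁ hM) (h2.fits_zBit h13 ht₁ hM))
    (eval_xor (h2.eval_zBit h13 hc₁) (h2.eval_zBit h13 ht₁)) (Nat.le_of_ble_eq_true rfl)
    ⟨?_, fun x hx => rfl⟩
  convert h2.setZ l c ((w' l).2 c + (w' l).2 t) using 1
  · rw [Function.update_idem]
    congr 1
    ext j
    · by_cases hj : j = t <;> simp [Gate.act, hj]
    · by_cases hj : j = c <;> simp [Gate.act, hj]
  · simp

end

/-! ### The elimination as a program -/

section

variable {n r M : ℕ} {g : Fin r → PauliVec n} {L : List (Gate n)} {m : Mem}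

/-- The memory holds the circuit `L` and the images of the input vectors under it. -/
def Run (g : Fin r → PauliVec n) (L : List (Gate n)) (m : Mem) : Prop :=
  Holds (fun l => circuitAct L (g l)) L m

/-- A bound for the number of steps that the application of a gate takes. -/
def gateTime (r : ℕ) : ℕ := r * 68 + 36

lemma Run.hadCmd (H : Run g L m) (hM : Fitting M n r) (hL : 3 * L.length + 3 < M)
    {π : ℕ} (hπ : IsFree π) {q : Fin n} (hq : m.reg π = q) :
    Spec M (hadCmd π) m (gateTime r) fun m' =>
      Run g (L ++ [.had q]) m' ∧ ∀ x, IsFree x → m'.reg x = m.reg x := by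
  refine (spec_hadCmd H hM hL hπ hq).mono le_rfl fun m' h => ⟨?_, h.2⟩
  simpa only [Run, circuitAct_append, circuitAct_cons, circuitAct_nil] using h.1

lemma Run.phaseCmd (H : Run g L m) (hM : Fitting M n r) (hL : 3 * L.length + 3 < M)
    {π : ℕ} (hπ : IsFree π) {q : Fin n} (hq : m.reg π = q) :
    Spec M (phaseCmd π) m (gateTime r) fun m' =>
      Run g (L ++ [.phase q]) m' ∧ ∀ x, IsFree x → m'.reg x = m.reg x := by
  refine (spec_phaseCmd H hM hL hπ hq).mono le_rfl fun m' h => ⟨?_, h.2⟩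
  simpa only [Run, circuitAct_append, circuitAct_cons, circuitAct_nil] using h.1

lemma Run.cnotCmd (H : Run g L m) (hM : Fitting M n r) (hL : 3 * L.length + 3 < M)
    {κ τ : ℕ} (hκ : IsFree κ) (hτ : IsFree τ) {c t : Fin n} (hc : m.reg κ = c)
    (ht : m.reg τ = t) (hct : c ≠ t) :
    Spec M (cnotCmd κ τ) m (gateTime r) fun m' =>
      Run g (L ++ [.cnot c t hct]) m' ∧ ∀ x, IsFree x → m'.reg x = m.reg x := by
  refine (spec_cnotCmd H hM hL hκ hτ hc ht hct).mono le_rfl fun m' h => ⟨?_, h.2⟩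
  simpa only [Run, circuitAct_append, circuitAct_cons, circuitAct_nil] using h.1

lemma Run.setReg (H : Run g L m) {x v : ℕ} (hx : 2 < x) : Run g L (m.setReg x v) :=
  Holds.setReg H hx

lemma val_ne_zero_iff {x : ZMod 2} : x.val ≠ 0 ↔ x = 1 := by
  revert x; decide

lemma val_eq_zero_iff {x : ZMod 2} : x.val = 0 ↔ x = 0 := by
  revert x; decide

/-! #### Sweeping a row -/

/-- The circuit `L'` has cleared the vector `v`, whose `X` bit at qubit `q` is set, on the qubits
`p < k`. It has at most `c` gates, acts on the qubits `p ≤ q` only, and fixes `Z_q`. -/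
structure SweepInv (q : Fin n) (k c : ℕ) (L' : List (Gate n)) (v : PauliVec n) : Prop where
  length : L'.length ≤ c
  below : ∀ g ∈ L', g.Below (q + 1)
  fix : ∀ w, ZeroBelow q w → w.1 q = 0 → circuitAct L' w = w
  zero : ZeroBelow k (circuitAct L' v)
  one : (circuitAct L' v).1 q = 1

lemma SweepInv.weaken {q : Fin n} {k c c' : ℕ} {L' : List (Gate n)} {v : PauliVec n}
    (H : SweepInv q k c L' v) (hc : c ≤ c') : SweepInv q k c' L' v :=
  ⟨H.length.trans hc, H.below, H.fix, H.zero, H.one⟩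

lemma SweepInv.snoc {q : Fin n} {k k' c : ℕ} {L' : List (Gate n)} {v : PauliVec n}
    (H : SweepInv q k c L' v) {e : Gate n} (he : e.Below (q + 1))
    (hfix : ∀ w, ZeroBelow q w → w.1 q = 0 → e.act w = w)
    (hz : ZeroBelow k' (e.act (circuitAct L' v))) (hx : (e.act (circuitAct L' v)).1 q = 1) :
    SweepInv q k' (c + 1) (L' ++ [e]) v where
  length := by simpa using H.length
  below g hg := by
    rcases List.mem_append.1 hg with hg | hg
    · exact H.below g hg
    · rw [List.mem_singleton.1 hg]; exact he
  fix w h0 h1 := by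
    rw [circuitAct_append, H.fix w h0 h1]
    exact hfix w h0 h1
  zero := by rw [circuitAct_append]; exact hz
  one := by rw [circuitAct_append]; exact hx

lemma phase_act_eq {p : Fin n} {w : PauliVec n} (h : w.1 p = 0) : (Gate.phase p).act w = w := by
  ext j <;> simp only [Gate.act]
  split_ifs with hj <;> simp [hj, h]

lemma had_act_eq {p : Fin n} {w : PauliVec n} (h : w.1 p = 0) (h' : w.2 p = 0) :
    (Gate.had p).act w = w := by
  ext j <;> simp only [Gate.act] <;> split_ifs with hj <;> simp [hj, h, h']

lemma cnot_act_eq {c t : Fin n} (hct : c ≠ t) {w : PauliVec n} (h : w.1 c = 0) (h' : w.2 t = 0) :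
    (Gate.cnot c t hct).act w = w := by
  ext j <;> simp only [Gate.act] <;> split_ifs with hj <;> simp [hj, h, h']

/-- Clears the `Z` bit of row `7` at qubit `11`. -/
def clearZCmd : Cmd :=
  .branch (zBit 7 11) (.branch (xBit 7 11) (phaseCmd 11) (hadCmd 11)) .skip

/-- Maps row `7`, whose `X` bit at the qubit `q` in register `5` must be set, to `X_q` on the qubits
`p ≤ q`, by gates that fix `Z_q`. -/
def sweepCmd : Cmd :=
  .seq (.forLoop 11 5 (.seq clearZCmd (.branch (xBit 7 11) (cnotCmd 5 11) .skip)))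
    (.branch (zBit 7 5) (phaseCmd 5) .skip)

lemma one_le_gateTime (r : ℕ) : 1 ≤ gateTime r := by unfold gateTime; omega

lemma spec_clearZCmd (hM : Fitting M n r) {l : Fin r} {p q : Fin n} (hpq : (p : ℕ) < q)
    {c : ℕ} {L' : List (Gate n)} (hL : 3 * (L ++ L').length + 3 < M) (H : Run g (L ++ L') m)
    (hl : m.reg 7 = l) (hp : m.reg 11 = p) (hI : SweepInv q p c L' (circuitAct L (g l))) :
    Spec M clearZCmd m (gateTime r + 20) fun m' => ∃ L'', Run g (L ++ L'') m' ∧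
      SweepInv q p (c + 1) L'' (circuitAct L (g l)) ∧
      (circuitAct L'' (circuitAct L (g l))).2 p = 0 ∧ ∀ x, IsFree x → m'.reg x = m.reg x := by
  have hqp : q ≠ p := fun e => by simp [e] at hpq
  have hf : IsFree 11 := by unfold IsFree; decide
  refine Spec.branch (gateTime r + 9) (by simp [Expr.cost, zBit, zIdx]; omega)
    (Holds.fits_zBit H hl hp hM) (fun hz => ?_) fun hz => ?_
  · rw [Holds.eval_zBit H hl hp, val_ne_zero_iff, circuitAct_append] at hz
    refine Spec.branch (gateTime r) (by simp [Expr.cost, xBit, xIdx]; omega)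
      (Holds.fits_xBit H hl hp hM) (fun hx => ?_) fun hx => ?_
    · rw [Holds.eval_xBit H hl hp, val_ne_zero_iff, circuitAct_append] at hx
      refine (H.phaseCmd hM hL hf hp).mono le_rfl ?_
      rintro m' ⟨H', hreg⟩
      refine ⟨L' ++ [.phase p], by rwa [← List.append_assoc], hI.snoc (e := .phase p)
        (Nat.lt_succ_of_lt hpq) (fun w h0 _ => phase_act_eq (h0 p hpq).1) (fun j hj => ?_) ?_, ?_,
        hreg⟩
      · have hjp : j ≠ p := fun e => by simp [e] at hj
        simpa [Gate.act, hjp] using hI.zero j hj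
      · simpa [Gate.act] using hI.one
      · rw [circuitAct_append]
        change ((Gate.phase p).act _).2 p = 0
        simp [Gate.act, hx, hz, zmod_two_add_self]
    · rw [Holds.eval_xBit H hl hp, val_eq_zero_iff, circuitAct_append] at hx
      refine (H.hadCmd hM hL hf hp).mono le_rfl ?_
      rintro m' ⟨H', hreg⟩
      refine ⟨L' ++ [.had p], by rwa [← List.append_assoc], hI.snoc (e := .had p)
        (Nat.lt_succ_of_lt hpq) (fun w h0 _ => had_act_eq (h0 p hpq).1 (h0 p hpq).2)
        (fun j hj => ?_) ?_, ?_, hreg⟩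
      · have hjp : j ≠ p := fun e => by simp [e] at hj
        simpa [Gate.act, hjp] using hI.zero j hj
      · simpa [Gate.act, hqp] using hI.one
      · rw [circuitAct_append]
        change ((Gate.had p).act _).2 p = 0
        simp [Gate.act, hx]
  · rw [Holds.eval_zBit H hl hp, val_eq_zero_iff, circuitAct_append] at hz
    exact (Spec.skip ⟨L', H, hI.weaken (Nat.le_succ c), hz, fun _ _ => rfl⟩).mono (by omega)
      fun _ h => h

/-- A bound for the number of steps of `sweepCmd`. -/
def sweepTime (n r : ℕ) : ℕ := n * (2 * gateTime r + 37) + gateTime r + 17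

lemma spec_sweepCmd (hM : Fitting M n r) {l : Fin r} {q : Fin n}
    (hL : 3 * (L.length + 2 * q + 1) + 3 < M) (H : Run g L m) (hl : m.reg 7 = l)
    (hq : m.reg 5 = q) (hx : (circuitAct L (g l)).1 q = 1) :
    Spec M sweepCmd m (sweepTime n r) fun m' => ∃ L', Run g (L ++ L') m' ∧
      L'.length ≤ 2 * q + 1 ∧ (∀ g ∈ L', g.Below (q + 1)) ∧
      (∀ w, ZeroBelow q w → w.1 q = 0 → circuitAct L' w = w) ∧
      IsXAt q (circuitAct L' (circuitAct L (g l))) ∧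
      ∀ x, IsFree x → x ≠ 11 → m'.reg x = m.reg x := by
  have hqM := hM.qubits
  have hT : q * (2 * gateTime r + 29 + 8) + 6 + (gateTime r + 11) ≤ sweepTime n r := by
    have := Nat.mul_le_mul_right (2 * gateTime r + 37) q.2.le
    rw [sweepTime, show 2 * gateTime r + 29 + 8 = 2 * gateTime r + 37 by omega]
    omega
  have hf5 : IsFree 5 := by unfold IsFree; decide
  have hf7 : IsFree 7 := by unfold IsFree; decide
  have hf11 : IsFree 11 := by unfold IsFree; decide
  refine Spec.seq _ _ hT (Spec.forLoop (fun k m' => ∃ L', Run g (L ++ L') m' ∧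
    SweepInv q k (2 * k) L' (circuitAct L (g l)) ∧ ∀ x, IsFree x → x ≠ 11 → m'.reg x = m.reg x)
    (by decide) hq (by omega) ?_ ?_ ?_)
  · refine ⟨[], ?_, ⟨le_rfl, by simp, fun _ _ _ => rfl, fun p hp => by omega, hx⟩,
      fun x _ hx => by simp [hx]⟩
    rw [List.append_nil]
    exact H.setReg (by decide)
  · rintro k m₁ hk h11 h5 ⟨L₁, H₁, hI₁, hreg₁⟩
    have hl₁ : m₁.reg 7 = l := by rw [hreg₁ 7 hf7 (by decide), hl]
    have hlen := hI₁.length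
    let p : Fin n := ⟨k, by omega⟩
    have hpq : (p : ℕ) < q := hk
    have hqp : q ≠ p := fun e => by simp [e] at hpq
    refine Spec.seq (gateTime r + 20) (gateTime r + 9) (by omega)
      ((spec_clearZCmd hM (p := p) hpq (by rw [List.length_append]; omega) H₁ hl₁ h11 hI₁).mono
        le_rfl ?_)
    rintro m₂ ⟨L₂, H₂, hI₂, hz, hreg₂⟩
    have hl₂ : m₂.reg 7 = l := by rw [hreg₂ 7 hf7, hl₁]
    have hp₂ : m₂.reg 11 = p := by rw [hreg₂ 11 hf11, h11]
    have hq₂ : m₂.reg 5 = q := by rw [hreg₂ 5 hf5, h5]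
    have hlen₂ := hI₂.length
    refine Spec.branch (gateTime r) (by simp [Expr.cost, xBit, xIdx]; omega)
      (Holds.fits_xBit H₂ hl₂ hp₂ hM) (fun hb => ?_) fun hb => ?_
    · rw [Holds.eval_xBit H₂ hl₂ hp₂, val_ne_zero_iff, circuitAct_append] at hb
      refine (H₂.cnotCmd hM (by rw [List.length_append]; omega) hf5 hf11 hq₂ hp₂ hqp).mono le_rfl ?_
      rintro m₃ ⟨H₃, hreg₃⟩
      refine ⟨by rw [hreg₃ 11 hf11, hp₂], by rw [hreg₃ 5 hf5, hq₂],
        L₂ ++ [.cnot q p hqp], ?_, hI₂.snoc (e := .cnot q p hqp)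
        ⟨Nat.lt_succ_self _, Nat.lt_succ_of_lt hpq⟩ (fun w h0 h1 => cnot_act_eq hqp h1 (h0 p hpq).2)
        (fun j hj => ?_) ?_, fun x hx hx' => ?_⟩
      · rw [← List.append_assoc]
        exact H₃.setReg (by decide)
      · have hjq : j ≠ q := fun e => by rw [e] at hj; omega
        rcases Nat.lt_succ_iff_lt_or_eq.1 hj with hj' | hj'
        · have hjp : j ≠ p := fun e => by rw [e] at hj'; exact lt_irrefl _ hj'
          simpa [Gate.act, hjp, hjq] using hI₂.zero j hj'
        · have hjp : j = p := Fin.ext hj'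
          simp [Gate.act, hjp, hqp.symm, hb, hz, hI₂.one, zmod_two_add_self]
      · simpa [Gate.act, hqp] using hI₂.one
      · rw [Mem.setReg_reg, if_neg hx', hreg₃ x hx, hreg₂ x hx, hreg₁ x hx hx']
    · rw [Holds.eval_xBit H₂ hl₂ hp₂, val_eq_zero_iff, circuitAct_append] at hb
      refine (Spec.skip ⟨hp₂, hq₂, L₂, H₂.setReg (by decide),
        ⟨hlen₂.trans (by omega), hI₂.below, hI₂.fix, fun j hj => ?_, hI₂.one⟩,
        fun x hx hx' => ?_⟩).mono (one_le_gateTime r) fun _ h => h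
      · rcases Nat.lt_succ_iff_lt_or_eq.1 hj with hj' | hj'
        · exact hI₂.zero j hj'
        · have hjp : j = p := Fin.ext hj'
          rw [hjp]
          exact ⟨hb, hz⟩
      · rw [Mem.setReg_reg, if_neg hx', hreg₂ x hx, hreg₁ x hx hx']
  · rintro m₁ - h5 ⟨L₁, H₁, hI₁, hreg₁⟩
    have hl₁ : m₁.reg 7 = l := by rw [hreg₁ 7 hf7 (by decide), hl]
    have hlen := hI₁.length
    refine Spec.branch (gateTime r) (by simp [Expr.cost, zBit, zIdx]; omega)
      (Holds.fits_zBit H₁ hl₁ h5 hM) (fun hb => ?_) fun hb => ?_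
    · rw [Holds.eval_zBit H₁ hl₁ h5, val_ne_zero_iff, circuitAct_append] at hb
      refine (H₁.phaseCmd hM (by rw [List.length_append]; omega) hf5 h5).mono le_rfl ?_
      rintro m₂ ⟨H₂, hreg₂⟩
      have hI₂ : SweepInv q q (2 * q + 1) (L₁ ++ [.phase q]) (circuitAct L (g l)) := by
        refine hI₁.snoc (e := .phase q) (Nat.lt_succ_self _) (fun w h0 h1 => phase_act_eq h1)
          (fun j hj => ?_) ?_
        · have hjq : j ≠ q := fun e => by rw [e] at hj; omega
          simpa [Gate.act, hjq] using hI₁.zero j hj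
        · simpa [Gate.act] using hI₁.one
      refine ⟨L₁ ++ [.phase q], by rwa [← List.append_assoc], hI₂.length, hI₂.below, hI₂.fix,
        ⟨hI₂.zero, hI₂.one, ?_⟩, fun x hx hx' => by rw [hreg₂ x hx, hreg₁ x hx hx']⟩
      rw [circuitAct_append]
      change ((Gate.phase q).act _).2 q = 0
      simp [Gate.act, hb, hI₁.one, zmod_two_add_self]
    · rw [Holds.eval_zBit H₁ hl₁ h5, val_eq_zero_iff, circuitAct_append] at hb
      exact (Spec.skip ⟨L₁, H₁, hlen.trans (Nat.le_succ _), hI₁.below, hI₁.fix,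
        ⟨hI₁.zero, hI₁.one, hb⟩, hreg₁⟩).mono (one_le_gateTime r) fun _ h => h

end

section

variable {n r M : ℕ} {g : Fin r → PauliVec n} {L : List (Gate n)} {m : Mem}

/-! #### Eliminating a row -/

/-- Looks for a qubit `p < h`, where `h` is in register `5`, on which row `7` does not vanish;
register `12` receives `p + 1`, or `0` if there is none. -/
def findQubitCmd : Cmd :=
  .seq (.assign 12 (.const 0))
    (.forLoop 11 5 (.branch (.add (xBit 7 11) (zBit 7 11))
      (.assign 12 (.add (.reg 11) (.const 1))) .skip))

lemma spec_findQubitCmd (hM : Fitting M n r) {l : Fin r} {h : ℕ} (hh : h ≤ n) (H : Run g L m)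
    (hl : m.reg 7 = l) (h5 : m.reg 5 = h) :
    Spec M findQubitCmd m (n * 32 + 8) fun m' => Run g L m' ∧
      (m'.reg 12 = 0 ∧ ZeroBelow h (circuitAct L (g l)) ∨
        ∃ p : Fin n, (p : ℕ) < h ∧ m'.reg 12 = p + 1 ∧
          ((circuitAct L (g l)).1 p ≠ 0 ∨ (circuitAct L (g l)).2 p ≠ 0)) ∧
      ∀ x, x ≠ 11 → x ≠ 12 → m'.reg x = m.reg x := by
  have hqM := hM.qubits
  have h2 := hM.two
  refine Spec.seq 2 (n * 32 + 6) (by omega) (Spec.assign (v := 0) (by simp only [Expr.Fits]; omega)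
    rfl le_rfl ?_)
  refine (Spec.forLoop (T := 24) (N := h) (fun k m' => Run g L m' ∧
    (m'.reg 12 = 0 ∧ ZeroBelow k (circuitAct L (g l)) ∨
      ∃ p : Fin n, (p : ℕ) < h ∧ m'.reg 12 = p + 1 ∧
        ((circuitAct L (g l)).1 p ≠ 0 ∨ (circuitAct L (g l)).2 p ≠ 0)) ∧
    ∀ x, x ≠ 11 → x ≠ 12 → m'.reg x = m.reg x) (by decide) (by simp [h5]) (by omega) ?_ ?_ ?_).mono
    (by omega) fun _ h => h
  · refine ⟨(H.setReg (by decide)).setReg (by decide), Or.inl ⟨by simp, fun p hp => by omega⟩,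
      fun x hx hx' => by simp [hx, hx']⟩
  · rintro k m₁ hk h11 h5' ⟨H₁, hor, hreg⟩
    have hl₁ : m₁.reg 7 = l := by rw [hreg 7 (by decide) (by decide), hl]
    let p : Fin n := ⟨k, by omega⟩
    have h11' : m₁.reg 11 = p := h11
    have hev : (Expr.add (xBit 7 11) (zBit 7 11)).eval m₁ =
        ((circuitAct L (g l)).1 p).val + ((circuitAct L (g l)).2 p).val := by
      rw [Expr.eval, Holds.eval_xBit H₁ hl₁ h11', Holds.eval_zBit H₁ hl₁ h11']
    refine Spec.branch 4 (by simp [Expr.cost, xBit, zBit, xIdx, zIdx]) ?_ (fun hb => ?_)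
      fun hb => ?_
    · refine ⟨Holds.fits_xBit H₁ hl₁ h11' hM, Holds.fits_zBit H₁ hl₁ h11' hM, ?_⟩
      rw [Holds.eval_xBit H₁ hl₁ h11', Holds.eval_zBit H₁ hl₁ h11']
      have := zmod_two_val_lt ((circuitAct L (g l)).1 p)
      have := zmod_two_val_lt ((circuitAct L (g l)).2 p)
      have := p.2
      omega
    · rw [hev] at hb
      refine Spec.assign (v := k + 1) (by simp only [Expr.Fits, Expr.eval]; omega)
        (by simp only [Expr.eval, h11]) le_rfl ⟨by simp [h11], by simp [h5'],
          (H₁.setReg (by decide)).setReg (by decide), Or.inr ⟨p, hk, by simp [p], ?_⟩,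
          fun x hx hx' => by simp [hx, hx', hreg x hx hx']⟩
      by_contra! hc
      rw [hc.1, hc.2] at hb
      exact hb rfl
    · rw [hev] at hb
      refine (Spec.skip ⟨h11, h5', H₁.setReg (by decide), ?_,
        fun x hx hx' => by simp [hx, hreg x hx hx']⟩).mono (by omega) fun _ h => h
      rcases hor with ⟨h12, hz⟩ | ⟨p', hp', h12, hne⟩
      · refine Or.inl ⟨by simpa using h12, fun j hj => ?_⟩
        rcases Nat.lt_succ_iff_lt_or_eq.1 hj with hj' | hj'
        · exact hz j hj'
        · have hjp : j = p := Fin.ext hj'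
          rw [hjp, ← val_eq_zero_iff, ← val_eq_zero_iff]
          omega
      · exact Or.inr ⟨p', hp', by simpa using h12, hne⟩
  · rintro m₁ - - ⟨H₁, hor, hreg⟩
    exact ⟨H₁, hor, hreg⟩

/-- If row `7` does not vanish on the qubits `p < h`, where `h` is in register `5`, decreases `h`
to `q := h - 1` and maps the row to `Z_q` on the qubits `p ≤ q`. -/
def elimCmd : Cmd :=
  .seq findQubitCmd (.branch (.reg 12)
    (.seq (.assign 5 (.sub (.reg 5) (.const 1)))
      (.seq (.assign 12 (.sub (.reg 12) (.const 1)))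
        (.seq (.branch (xBit 7 12) .skip (hadCmd 12))
          (.seq (.branch (xBit 7 5) .skip (cnotCmd 12 5)) (.seq sweepCmd (hadCmd 5))))))
    .skip)

/-- A bound for the number of steps of `elimCmd`. -/
def elimTime (n r : ℕ) : ℕ := n * 32 + 36 + 3 * gateTime r + sweepTime n r

lemma IsXAt.had_act {q : Fin n} {v : PauliVec n} (hv : IsXAt q v) :
    IsZAt q ((Gate.had q).act v) := by
  refine ⟨fun j hj => ?_, by simp [Gate.act, hv.2.2], by simp [Gate.act, hv.2.1]⟩
  have hjq : j ≠ q := fun e => by rw [e] at hj; omega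
  simpa [Gate.act, hjq] using hv.1 j hj

lemma spec_elimCmd (hM : Fitting M n r) {l : Fin r} {h : ℕ} (hh : h ≤ n)
    (hL : 3 * (L.length + 2 * h + 2) + 3 < M) (H : Run g L m) (hl : m.reg 7 = l)
    (h5 : m.reg 5 = h) :
    Spec M elimCmd m (elimTime n r) fun m' =>
      (Run g L m' ∧ m'.reg 5 = h ∧ ZeroBelow h (circuitAct L (g l)) ∨
        ∃ (q : Fin n) (L' : List (Gate n)), h = q + 1 ∧ Run g (L ++ L') m' ∧ m'.reg 5 = q ∧
          L'.length ≤ 2 * h + 2 ∧ (∀ g ∈ L', g.Below (q + 1)) ∧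
          IsZAt q (circuitAct L' (circuitAct L (g l)))) ∧
      ∀ x, IsFree x → x ≠ 5 → x ≠ 11 → x ≠ 12 → m'.reg x = m.reg x := by
  have hqM := hM.qubits
  have h2 := hM.two
  have hf5 : IsFree 5 := by unfold IsFree; decide
  have hf7 : IsFree 7 := by unfold IsFree; decide
  have hf12 : IsFree 12 := by unfold IsFree; decide
  refine Spec.seq (n * 32 + 8) (28 + 3 * gateTime r + sweepTime n r) (by unfold elimTime; omega)
    ((spec_findQubitCmd hM hh H hl h5).mono le_rfl ?_)
  rintro m₁ ⟨H₁, hor, hreg₁⟩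
  have h5₁ : m₁.reg 5 = h := by rw [hreg₁ 5 (by decide) (by decide), h5]
  have hl₁ : m₁.reg 7 = l := by rw [hreg₁ 7 (by decide) (by decide), hl]
  refine Spec.branch (26 + 3 * gateTime r + sweepTime n r) (by simp only [Expr.cost]; omega) ?_
    (fun h12 => ?_) fun h12 => ?_
  · rcases hor with ⟨h12, -⟩ | ⟨p, hp, h12, -⟩ <;> simp only [Expr.Fits] <;> omega
  swap
  · refine (Spec.skip ⟨Or.inl ⟨H₁, h5₁, ?_⟩, fun x _ _ h11 h12 => hreg₁ x h11 h12⟩).mono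
      (by omega) fun _ h => h
    rcases hor with ⟨-, hz⟩ | ⟨p, -, hp, -⟩
    · exact hz
    · simp only [Expr.eval] at h12; omega
  obtain ⟨p, hph, h12, hne⟩ : ∃ p : Fin n, (p : ℕ) < h ∧ m₁.reg 12 = p + 1 ∧
      ((circuitAct L (g l)).1 p ≠ 0 ∨ (circuitAct L (g l)).2 p ≠ 0) :=
    hor.resolve_left fun e => h12 e.1
  obtain ⟨k, rfl⟩ : ∃ k, h = k + 1 := ⟨h - 1, by omega⟩
  let q : Fin n := ⟨k, by omega⟩
  refine Spec.seq 4 (22 + 3 * gateTime r + sweepTime n r) (by omega)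
    (Spec.assign (v := q) (by simp only [Expr.Fits]; omega) (by simp [Expr.eval, h5₁, q]) le_rfl ?_)
  refine Spec.seq 4 (18 + 3 * gateTime r + sweepTime n r) (by omega)
    (Spec.assign (v := p) (by simp [Expr.Fits, h12]; omega) (by simp [Expr.eval, h12]) le_rfl ?_)
  have H₂ : Run g L ((m₁.setReg 5 q).setReg 12 p) :=
    (H₁.setReg (by decide)).setReg (by decide)
  have h5₂ : ((m₁.setReg 5 q).setReg 12 p).reg 5 = q := by simp
  have hl₂ : ((m₁.setReg 5 q).setReg 12 p).reg 7 = l := by simp [hl₁]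
  have h12₂ : ((m₁.setReg 5 q).setReg 12 p).reg 12 = p := by simp
  have hreg₂ : ∀ x, x ≠ 5 → x ≠ 11 → x ≠ 12 → ((m₁.setReg 5 q).setReg 12 p).reg x = m.reg x :=
    fun x h5 h11 h12 => by simp [h5, h12, hreg₁ x h11 h12]
  generalize (m₁.setReg 5 q).setReg 12 p = m₂ at *
  set v := circuitAct L (g l) with hv
  -- After the first gate, the `X` bit at qubit `p` is set.
  refine Spec.seq (gateTime r + 9) (9 + 2 * gateTime r + sweepTime n r) (by omega)
    (Spec.mono (T := gateTime r + 9) (Q := fun m' => ∃ L', Run g (L ++ L') m' ∧ L'.length ≤ 1 ∧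
      (∀ g ∈ L', g.Below (q + 1)) ∧ (circuitAct L' v).1 p = 1 ∧
      ∀ x, IsFree x → m'.reg x = m₂.reg x) ?_ le_rfl ?_)
  · refine Spec.branch (gateTime r) (by simp [Expr.cost, xBit, xIdx]; omega)
      (Holds.fits_xBit H₂ hl₂ h12₂ hM) (fun hb => ?_) fun hb => ?_
    · rw [Holds.eval_xBit H₂ hl₂ h12₂, val_ne_zero_iff] at hb
      exact (Spec.skip ⟨[], by rwa [List.append_nil], Nat.zero_le _, by simp, hb,
        fun _ _ => rfl⟩).mono (one_le_gateTime r) fun _ h => h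
    · rw [Holds.eval_xBit H₂ hl₂ h12₂, val_eq_zero_iff] at hb
      refine (H₂.hadCmd hM (by omega) hf12 h12₂).mono le_rfl ?_
      rintro m₃ ⟨H₃, hreg₃⟩
      refine ⟨[.had p], H₃, le_rfl, ?_, ?_, hreg₃⟩
      · intro e he; rw [List.mem_singleton.1 he]; exact hph
      · change ((Gate.had p).act v).1 p = 1
        rw [← zmod_two_ne_zero_iff]
        simpa [Gate.act] using hne.resolve_left (not_not.2 hb)
  rintro m₃ ⟨L₃, H₃, hlen₃, hbel₃, hx₃, hreg₃⟩
  have h5₃ : m₃.reg 5 = q := by rw [hreg₃ 5 hf5, h5₂]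
  have hl₃ : m₃.reg 7 = l := by rw [hreg₃ 7 hf7, hl₂]
  have h12₃ : m₃.reg 12 = p := by rw [hreg₃ 12 hf12, h12₂]
  -- After the second gate, the `X` bit at qubit `q` is set.
  refine Spec.seq (gateTime r + 9) (gateTime r + sweepTime n r) (by omega)
    (Spec.mono (T := gateTime r + 9) (Q := fun m' => ∃ L', Run g (L ++ L') m' ∧ L'.length ≤ 2 ∧
      (∀ g ∈ L', g.Below (q + 1)) ∧ (circuitAct L' v).1 q = 1 ∧
      ∀ x, IsFree x → m'.reg x = m₂.reg x) ?_ le_rfl ?_)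
  · refine Spec.branch (gateTime r) (by simp [Expr.cost, xBit, xIdx]; omega)
      (Holds.fits_xBit H₃ hl₃ h5₃ hM) (fun hb => ?_) fun hb => ?_
    · rw [Holds.eval_xBit H₃ hl₃ h5₃, val_ne_zero_iff, circuitAct_append] at hb
      exact (Spec.skip ⟨L₃, H₃, hlen₃.trans (by decide), hbel₃, hb, hreg₃⟩).mono
        (one_le_gateTime r) fun _ h => h
    · rw [Holds.eval_xBit H₃ hl₃ h5₃, val_eq_zero_iff, circuitAct_append] at hb
      have hpq : p ≠ q := by
        intro e
        rw [e] at hx₃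
        exact zero_ne_one (hb.symm.trans hx₃)
      refine (H₃.cnotCmd hM (by rw [List.length_append]; omega) hf12 hf5 h12₃ h5₃ hpq).mono
        le_rfl ?_
      rintro m₄ ⟨H₄, hreg₄⟩
      refine ⟨L₃ ++ [.cnot p q hpq], by rwa [← List.append_assoc], by simpa using hlen₃, ?_, ?_,
        fun x hx => by rw [hreg₄ x hx, hreg₃ x hx]⟩
      · intro e he
        rcases List.mem_append.1 he with he | he
        · exact hbel₃ e he
        · rw [List.mem_singleton.1 he]; exact ⟨hph, Nat.lt_succ_self _⟩
      · rw [circuitAct_append]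
        change ((Gate.cnot p q hpq).act (circuitAct L₃ v)).1 q = 1
        have hb' : (circuitAct L₃ v).1 q = 0 := hb
        simp [Gate.act, hb', hx₃]
  rintro m₄ ⟨L₄, H₄, hlen₄, hbel₄, hx₄, hreg₄⟩
  have h5₄ : m₄.reg 5 = q := by rw [hreg₄ 5 hf5, h5₂]
  have hl₄ : m₄.reg 7 = l := by rw [hreg₄ 7 hf7, hl₂]
  have hqk : (q : ℕ) = k := rfl
  refine Spec.seq (sweepTime n r) (gateTime r) (by omega)
    ((spec_sweepCmd hM (by rw [List.length_append]; omega) H₄ hl₄ h5₄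
      (by rwa [circuitAct_append])).mono le_rfl ?_)
  rintro m₅ ⟨L₅, H₅, hlen₅, hbel₅, -, hX₅, hreg₅⟩
  have h5₅ : m₅.reg 5 = q := by rw [hreg₅ 5 hf5 (by decide), h5₄]
  refine (H₅.hadCmd hM (by simp only [List.length_append]; omega) hf5 h5₅).mono le_rfl ?_
  rintro m₆ ⟨H₆, hreg₆⟩
  refine ⟨Or.inr ⟨q, L₄ ++ L₅ ++ [.had q], rfl, ?_, by rw [hreg₆ 5 hf5, h5₅], ?_, ?_, ?_⟩,
    fun x hx h5 h11 h12 => ?_⟩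
  · simpa only [List.append_assoc] using H₆
  · simp only [List.length_append, List.length_singleton]; omega
  · intro e he
    rcases List.mem_append.1 he with he | he
    · rcases List.mem_append.1 he with he | he
      · exact hbel₄ e he
      · exact hbel₅ e he
    · rw [List.mem_singleton.1 he]; exact Nat.lt_succ_self _
  · rw [circuitAct_append]
    rw [circuitAct_append] at hX₅
    rw [circuitAct_append]
    exact IsXAt.had_act hX₅
  · rw [hreg₆ x hx, hreg₅ x hx h11, hreg₄ x hx, hreg₂ x h5 h11 h12]

/-! #### Looking for anticommuting rows -/

/-- The summand of the symplectic product of the rows `6` and `9` at qubit `11`. -/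
def sympTerm : Expr :=
  ((Expr.mul (xBit 6 11) (zBit 9 11)).xor (Expr.mul (zBit 6 11) (xBit 9 11)))

/-- Computes the symplectic product of the rows `6` and `9` on the qubits `p < h`, where `h` is in
register `5`, in register `10`. -/
def sympCmd : Cmd :=
  .seq (.assign 10 (.const 0)) (.forLoop 11 5 (.assign 10 ((Expr.reg 10).xor sympTerm)))

/-- Looks for a row `j` that anticommutes with row `6` on the qubits `p < h`, where `h` is in
register `5`; register `8` receives `j + 1`, or `0` if there is none. -/
def findRowCmd : Cmd :=
  .seq (.assign 8 (.const 0))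
    (.forLoop 9 1 (.seq sympCmd (.branch (.reg 10) (.assign 8 (.add (.reg 9) (.const 1))) .skip)))

lemma eval_mul_val {e f : Expr} {s t : ZMod 2} (he : e.eval m = s.val) (hf : f.eval m = t.val) :
    (e.mul f).eval m = (s * t).val := by
  simp only [Expr.eval, he, hf]
  clear he hf
  revert s t
  decide

lemma fits_mul_val {e f : Expr} {s t : ZMod 2} (hM : 2 < M) (he : e.eval m = s.val)
    (hf : f.eval m = t.val) (he' : e.Fits M m) (hf' : f.Fits M m) : (e.mul f).Fits M m := by
  refine ⟨he', hf', ?_⟩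
  have := eval_mul_val he hf
  simp only [Expr.eval] at this
  rw [this]
  exact (zmod_two_val_lt _).trans hM

lemma spec_sympCmd (hM : Fitting M n r) {i l : Fin r} {h : ℕ} (hh : h ≤ n) (H : Run g L m)
    (hi : m.reg 6 = i) (hl : m.reg 9 = l) (h5 : m.reg 5 = h) :
    Spec M sympCmd m (n * 54 + 8) fun m' => Run g L m' ∧
      m'.reg 10 = (sympBelow h (circuitAct L (g i)) (circuitAct L (g l))).val ∧
      ∀ x, x ≠ 10 → x ≠ 11 → m'.reg x = m.reg x := by
  have hqM := hM.qubits
  have h2 := hM.two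
  refine Spec.seq 2 (n * 54 + 6) (by omega) (Spec.assign (v := 0) (by simp only [Expr.Fits]; omega)
    rfl le_rfl ?_)
  refine (Spec.forLoop (T := 46) (N := h) (fun k m' => Run g L m' ∧
    m'.reg 10 = (sympBelow k (circuitAct L (g i)) (circuitAct L (g l))).val ∧
    ∀ x, x ≠ 10 → x ≠ 11 → m'.reg x = m.reg x) (by decide) (by simp [h5]) (by omega) ?_ ?_ ?_).mono
    (by omega) fun _ h => h
  · refine ⟨(H.setReg (by decide)).setReg (by decide), ?_, fun x hx hx' => by simp [hx, hx']⟩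
    rw [sympBelow_zero]
    simp
  · rintro k m₁ hk h11 h5' ⟨H₁, h10, hreg⟩
    have hi₁ : m₁.reg 6 = i := by rw [hreg 6 (by decide) (by decide), hi]
    have hl₁ : m₁.reg 9 = l := by rw [hreg 9 (by decide) (by decide), hl]
    let p : Fin n := ⟨k, by omega⟩
    have hp : m₁.reg 11 = p := h11
    have e1 := Holds.eval_xBit H₁ hi₁ hp
    have e2 := Holds.eval_zBit H₁ hl₁ hp
    have e3 := Holds.eval_zBit H₁ hi₁ hp
    have e4 := Holds.eval_xBit H₁ hl₁ hp
    refine Spec.assign (fits_xor h2 ?_ (fits_xor h2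
      (fits_mul_val h2 e1 e2 (Holds.fits_xBit H₁ hi₁ hp hM) (Holds.fits_zBit H₁ hl₁ hp hM))
      (fits_mul_val h2 e3 e4 (Holds.fits_zBit H₁ hi₁ hp hM) (Holds.fits_xBit H₁ hl₁ hp hM))))
      (eval_xor h10 (eval_xor (eval_mul_val e1 e2) (eval_mul_val e3 e4)))
      (Nat.le_of_ble_eq_true rfl) ⟨by simp [h11], by simp [h5'],
        (H₁.setReg (by decide)).setReg (by decide), ?_,
        fun x hx hx' => by simp [hx, hx', hreg x hx hx']⟩
    · simp only [Expr.Fits, h10]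
      exact (zmod_two_val_lt _).trans h2
    · rw [show k + 1 = p + 1 from rfl, sympBelow_succ]
      simp [p]
  · rintro m₁ - - ⟨H₁, hor, hreg⟩
    exact ⟨H₁, hor, hreg⟩

lemma spec_findRowCmd (hM : Fitting M n r) {i : Fin r} {h : ℕ} (hh : h ≤ n) (H : Run g L m)
    (hi : m.reg 6 = i) (h5 : m.reg 5 = h) :
    Spec M findRowCmd m (r * (n * 54 + 22) + 8) fun m' => Run g L m' ∧
      (m'.reg 8 = 0 ∧ (∀ l, sympBelow h (circuitAct L (g i)) (circuitAct L (g l)) = 0) ∨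
        ∃ j : Fin r, m'.reg 8 = j + 1 ∧
          sympBelow h (circuitAct L (g i)) (circuitAct L (g j)) = 1) ∧
      ∀ x, x ≠ 8 → x ≠ 9 → x ≠ 10 → x ≠ 11 → m'.reg x = m.reg x := by
  have hrM := hM.rows
  have h2 := hM.two
  refine Spec.seq 2 (r * (n * 54 + 14 + 8) + 6) (by rw [add_assoc (n * 54)]; omega)
    (Spec.assign (v := 0) (by simp only [Expr.Fits]; omega) rfl le_rfl ?_)
  refine Spec.forLoop (fun k m' => Run g L m' ∧
    (m'.reg 8 = 0 ∧ (∀ l : Fin r, (l : ℕ) < k →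
        sympBelow h (circuitAct L (g i)) (circuitAct L (g l)) = 0) ∨
      ∃ j : Fin r, m'.reg 8 = j + 1 ∧
        sympBelow h (circuitAct L (g i)) (circuitAct L (g j)) = 1) ∧
    ∀ x, x ≠ 8 → x ≠ 9 → x ≠ 10 → x ≠ 11 → m'.reg x = m.reg x) (by decide)
    (by simpa using H.reg_one) (by omega) ?_ ?_ ?_
  · refine ⟨(H.setReg (by decide)).setReg (by decide), Or.inl ⟨by simp, fun l hl => by omega⟩,
      fun x hx hx' _ _ => by simp [hx, hx']⟩
  · rintro k m₁ hk h9 h1 ⟨H₁, hor, hreg⟩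
    have hi₁ : m₁.reg 6 = i := by rw [hreg 6 (by decide) (by decide) (by decide) (by decide), hi]
    have h5₁ : m₁.reg 5 = h := by rw [hreg 5 (by decide) (by decide) (by decide) (by decide), h5]
    let l : Fin r := ⟨k, hk⟩
    have hl : m₁.reg 9 = l := h9
    refine Spec.seq (n * 54 + 8) 6 (by omega) ((spec_sympCmd hM hh H₁ hi₁ hl h5₁).mono le_rfl ?_)
    rintro m₂ ⟨H₂, h10, hreg₂⟩
    have h9₂ : m₂.reg 9 = k := by rw [hreg₂ 9 (by decide) (by decide), h9]
    have h1₂ : m₂.reg 1 = r := by rw [hreg₂ 1 (by decide) (by decide), h1]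
    have h8₂ : m₂.reg 8 = m₁.reg 8 := hreg₂ 8 (by decide) (by decide)
    refine Spec.branch 4 le_rfl ?_ (fun hb => ?_) fun hb => ?_
    · simp only [Expr.Fits, h10]
      exact (zmod_two_val_lt _).trans h2
    · simp only [Expr.eval] at hb
      rw [h10, val_ne_zero_iff] at hb
      exact Spec.assign (v := k + 1) (by simp only [Expr.Fits, Expr.eval]; omega)
        (by simp only [Expr.eval, h9₂]) le_rfl ⟨by simp [h9₂], by simp [h1₂],
          (H₂.setReg (by decide)).setReg (by decide), Or.inr ⟨l, by simp [l], hb⟩,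
          fun x h8 h9 h10 h11 => by simp [h8, h9, hreg₂ x h10 h11, hreg x h8 h9 h10 h11]⟩
    · simp only [Expr.eval] at hb
      rw [h10, val_eq_zero_iff] at hb
      refine (Spec.skip ⟨h9₂, h1₂, H₂.setReg (by decide), ?_, fun x h8 h9 h10 h11 => by
        simp [h9, hreg₂ x h10 h11, hreg x h8 h9 h10 h11]⟩).mono (by omega) fun _ h => h
      rcases hor with ⟨h8, hz⟩ | ⟨j, h8, hj⟩
      · refine Or.inl ⟨by simp [h8₂, h8], fun l' hl' => ?_⟩
        rcases Nat.lt_succ_iff_lt_or_eq.1 hl' with hl' | hl'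
        · exact hz l' hl'
        · rw [show l' = l from Fin.ext hl']
          exact hb
      · exact Or.inr ⟨j, by simp [h8₂, h8], hj⟩
  · rintro m₁ - - ⟨H₁, hor, hreg⟩
    exact ⟨H₁, hor.imp_left fun e => ⟨e.1, fun l => e.2 l l.2⟩, hreg⟩

/-! #### The main program -/

/-- Looks for a row that anticommutes with row `6` and maps the pair to `Z_q` and `X_q`. -/
def pairCmd : Cmd :=
  .seq findRowCmd (.branch (.reg 8)
    (.seq (.assign 7 (.reg 6)) (.seq elimCmd
      (.seq (.assign 7 (.sub (.reg 8) (.const 1))) sweepCmd))) .skip)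

/-- A bound for the number of steps of `pairCmd`. -/
def pairTime (n r : ℕ) : ℕ := r * (n * 54 + 22) + 16 + elimTime n r + sweepTime n r

lemma spec_pairCmd (hM : Fitting M n r) {i : Fin r} {h : ℕ}
    (hL : 3 * (L.length + 4 * n + 5) + 3 < M) (H : Run g L m) (hi : m.reg 6 = i)
    (h5 : m.reg 5 = h) (hI : PairInv i h fun l => circuitAct L (g l)) :
    Spec M pairCmd m (pairTime n r) fun m' => ∃ L' h', Run g L' m' ∧ m'.reg 5 = h' ∧
      L'.length ≤ L.length + (4 * n + 5) ∧ PairInv (i + 1) h' (fun l => circuitAct L' (g l)) ∧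
      m'.reg 6 = m.reg 6 := by
  have hh := hI.le
  have hrM := hM.rows
  have h2 := hM.two
  have hi2 := i.2
  have hf5 : IsFree 5 := by unfold IsFree; decide
  have hf6 : IsFree 6 := by unfold IsFree; decide
  have hf8 : IsFree 8 := by unfold IsFree; decide
  refine Spec.seq _ (8 + elimTime n r + sweepTime n r) (by unfold pairTime; omega)
    ((spec_findRowCmd hM hh H hi h5).mono le_rfl ?_)
  rintro m₁ ⟨H₁, hor, hreg₁⟩
  have h6₁ : m₁.reg 6 = i := by rw [hreg₁ 6 (by decide) (by decide) (by decide) (by decide), hi]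
  have h5₁ : m₁.reg 5 = h := by rw [hreg₁ 5 (by decide) (by decide) (by decide) (by decide), h5]
  refine Spec.branch (6 + elimTime n r + sweepTime n r) (by simp only [Expr.cost]; omega) ?_
    (fun h8 => ?_) fun h8 => ?_
  · rcases hor with ⟨h8, -⟩ | ⟨j, h8, -⟩ <;> simp only [Expr.Fits] <;> omega
  swap
  · refine (Spec.skip ⟨L, h, H₁, h5₁, by omega, hI.skip ?_, by rw [h6₁, hi]⟩).mono
      (by omega) fun _ h => h
    rcases hor with ⟨-, hz⟩ | ⟨j, hj, -⟩
    · exact hz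
    · simp only [Expr.eval] at h8; omega
  obtain ⟨j, h8, hij⟩ : ∃ j : Fin r, m₁.reg 8 = j + 1 ∧
      sympBelow h (circuitAct L (g i)) (circuitAct L (g j)) = 1 :=
    hor.resolve_left fun e => h8 e.1
  have hj2 := j.2
  refine Spec.seq 2 (4 + elimTime n r + sweepTime n r) (by omega)
    (Spec.assign (v := i) (by simp only [Expr.Fits]; omega) (by simp only [Expr.eval, h6₁])
      le_rfl ?_)
  refine Spec.seq _ (4 + sweepTime n r) (by omega) ((spec_elimCmd hM (l := i) hh (by omega)
    (H₁.setReg (by decide)) (by simp) (by simp [h5₁])).mono le_rfl ?_)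
  rintro m₂ ⟨hor₂, hreg₂⟩
  obtain ⟨q, L₂, rfl, H₂, h5₂, hlen₂, hbel₂, hZ₂⟩ := hor₂.resolve_left fun e => by
    rw [sympBelow_of_zeroBelow_left e.2.2] at hij
    exact zero_ne_one hij
  have h8₂ : m₂.reg 8 = j + 1 := by
    rw [hreg₂ 8 hf8 (by decide) (by decide) (by decide)]
    simp [h8]
  have h6₂ : m₂.reg 6 = i := by
    rw [hreg₂ 6 hf6 (by decide) (by decide) (by decide)]
    simp [h6₁]
  refine Spec.seq 4 (sweepTime n r) (by omega) (Spec.assign (v := j)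
    (by simp only [Expr.Fits]; omega) (by simp [Expr.eval, h8₂]) le_rfl ?_)
  have hx : (circuitAct (L ++ L₂) (g j)).1 q = 1 := by
    rw [circuitAct_append, ← sympBelow_isZAt _ hZ₂, sympBelow_circuitAct hbel₂, ← hij]
    exact Finset.sum_congr rfl fun p _ => by split_ifs <;> ring
  have hq2 := q.2
  refine (spec_sweepCmd hM (l := j) (q := q) (by rw [List.length_append]; omega)
    (H₂.setReg (by decide)) (by simp) (by simp [h5₂]) hx).mono le_rfl ?_
  rintro m₃ ⟨L₃, H₃, hlen₃, hbel₃, hfix₃, hX₃, hreg₃⟩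
  refine ⟨L ++ L₂ ++ L₃, q, H₃, ?_, ?_, ?_, ?_⟩
  · rw [hreg₃ 5 hf5 (by decide)]
    simp [h5₂]
  · simp only [List.length_append]; omega
  · have hP := hI.pair (j := j) (L := L₂ ++ L₃) (q := q) ?_ ?_ ?_
    · simpa only [circuitAct_append] using hP
    · intro e he
      rcases List.mem_append.1 he with he | he
      · exact hbel₂ e he
      · exact hbel₃ e he
    · rw [circuitAct_append, hfix₃ _ hZ₂.1 hZ₂.2.1]
      exact hZ₂
    · rw [circuitAct_append]
      rwa [circuitAct_append] at hX₃
  · rw [hreg₃ 6 hf6 (by decide), hi]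
    simp [h6₂]

/-- The program: first maps anticommuting pairs of rows to `Z_q`, `X_q` on the last qubits, then the
remaining rows to `Z_q` on the qubits before them. Without qubits it halts at once, as the loops
over the rows would exceed a running time of `O(nr² + 1)`. -/
def mainCmd : Cmd :=
  .branch (.reg 0)
    (.seq (.assign 5 (.reg 0)) (.seq (.forLoop 6 1 pairCmd)
      (.seq (.assign 3 (.sub (.reg 0) (.reg 5)))
        (.seq (.forLoop 6 1 (.seq (.assign 7 (.reg 6)) elimCmd))
          (.assign 4 (.sub (.sub (.reg 0) (.reg 3)) (.reg 5)))))))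
    .skip

/-- A bound for the number of steps of `mainCmd` on at least one qubit. -/
def mainTime (n r : ℕ) : ℕ := r * (pairTime n r + 8) + r * (elimTime n r + 10) + 26

lemma spec_mainCmd (hn : n ≠ 0) (hM : Fitting M n r) (hB : 3 * (r * (6 * n + 7)) + 3 < M)
    (H : Run g [] m) : Spec M mainCmd m (mainTime n r) fun m' =>
      ∃ L h₁ h, Run g L m' ∧ m'.reg 3 = n - h₁ ∧ m'.reg 4 = h₁ - h ∧
        ZInv h₁ r h fun l => circuitAct L (g l) := by
  have hqM := hM.qubits
  have hrM := hM.rows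
  have h0 : m.reg 0 = n := H.reg_zero
  have hf3 : IsFree 3 := by unfold IsFree; decide
  have hf6 : IsFree 6 := by unfold IsFree; decide
  refine Spec.branch (mainTime n r - 2) (by simp only [Expr.cost, mainTime]; omega)
    (by simp only [Expr.Fits]; omega) (fun _ => ?_) fun hz => absurd (h0.symm.trans hz) hn
  refine Spec.seq 2 (r * (pairTime n r + 8) + r * (elimTime n r + 10) + 22)
    (by unfold mainTime; omega)
    (Spec.assign (v := n) (by simp only [Expr.Fits]; omega) (by simp only [Expr.eval, h0])
      le_rfl ?_)
  have hstep : ∀ k, k < r → k * (4 * n + 5) + (4 * n + 5) ≤ r * (4 * n + 5) := by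
    intro k hk
    rw [← Nat.succ_mul]
    exact Nat.mul_le_mul_right _ hk
  have hstep' : ∀ k, k < r → k * (2 * n + 2) + (2 * n + 2) ≤ r * (2 * n + 2) := by
    intro k hk
    rw [← Nat.succ_mul]
    exact Nat.mul_le_mul_right _ hk
  have hsum : r * (6 * n + 7) = r * (4 * n + 5) + r * (2 * n + 2) := by ring
  refine Spec.seq (r * (pairTime n r + 8) + 6) (r * (elimTime n r + 10) + 16) (by omega)
    (Spec.forLoop (fun k m' => ∃ L h, Run g L m' ∧ m'.reg 5 = h ∧ L.length ≤ k * (4 * n + 5) ∧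
      PairInv k h fun l => circuitAct L (g l)) (by decide) (by simpa using H.reg_one) (by omega)
      ?_ ?_ ?_)
  · refine ⟨[], n, (H.setReg (by decide)).setReg (by decide), by simp, by simp, ?_⟩
    exact pairInv_init _
  · rintro k m₁ hk h6 h1 ⟨L, h, H₁, h5, hlen, hI⟩
    have := hstep k hk
    refine (spec_pairCmd hM (i := ⟨k, hk⟩) (by omega) H₁ h6 h5 hI).mono le_rfl ?_
    rintro m₂ ⟨L₂, h₂, H₂, h5₂, hlen₂, hI₂, h6₂⟩
    exact ⟨by rw [h6₂, h6], H₂.reg_one, L₂, h₂, H₂.setReg (by decide), by simp [h5₂],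
      by rw [add_mul, one_mul]; omega, hI₂⟩
  rintro m₁ - h1 ⟨L₁, h₁, H₁, h5₁, hlen₁, hI₁⟩
  have hle₁ := hI₁.le
  have h0₁ : m₁.reg 0 = n := H₁.reg_zero
  refine Spec.seq 4 (r * (elimTime n r + 10) + 12) (by omega) (Spec.assign (v := n - h₁)
    (by simp only [Expr.Fits]; omega) (by simp only [Expr.eval, h0₁, h5₁]) le_rfl ?_)
  refine Spec.seq (r * (elimTime n r + 2 + 8) + 6) 6 (by rw [add_assoc (elimTime n r)])
    (Spec.forLoop (fun k m' => ∃ L h, Run g L m' ∧ m'.reg 5 = h ∧ m'.reg 3 = n - h₁ ∧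
      L.length ≤ r * (4 * n + 5) + k * (2 * n + 2) ∧ ZInv h₁ k h fun l => circuitAct L (g l))
      (by decide) (by simpa using H₁.reg_one) (by omega) ?_ ?_ ?_)
  · exact ⟨L₁, h₁, (H₁.setReg (by decide)).setReg (by decide), by simp [h5₁], by simp,
      by omega, hI₁.zInv⟩
  · rintro k m₂ hk h6 h1 ⟨L, h, H₂, h5, h3, hlen, hI⟩
    have := hstep' k hk
    have hle := hI.le
    refine Spec.seq 2 (elimTime n r) (by omega) (Spec.assign (v := k)
      (by simp only [Expr.Fits]; omega) (by simp only [Expr.eval, h6]) le_rfl ?_)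
    refine (spec_elimCmd hM (l := ⟨k, hk⟩) (h := h) (by omega) (by omega) (H₂.setReg (by decide))
      (by simp) (by simp [h5])).mono le_rfl ?_
    rintro m₃ ⟨hor, hreg⟩
    have h6₃ : m₃.reg 6 = k := by
      rw [hreg 6 hf6 (by decide) (by decide) (by decide)]
      simp [h6]
    have h3₃ : m₃.reg 3 = n - h₁ := by
      rw [hreg 3 hf3 (by decide) (by decide) (by decide)]
      simp [h3]
    rcases hor with ⟨H₃, h5₃, hz⟩ | ⟨q, L₃, rfl, H₃, h5₃, hlen₃, hbel₃, hZ₃⟩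
    · exact ⟨h6₃, H₃.reg_one, L, h, H₃.setReg (by decide), by simp [h5₃], by simp [h3₃],
        by rw [add_mul, one_mul]; omega, hI.skip (i := ⟨k, hk⟩) hz⟩
    · refine ⟨h6₃, H₃.reg_one, L ++ L₃, q, H₃.setReg (by decide), by simp [h5₃], by simp [h3₃],
        ?_, ?_⟩
      · rw [add_mul, one_mul, List.length_append]
        have := q.2
        omega
      · have := hI.eliminate (i := ⟨k, hk⟩) hbel₃ hZ₃
        simpa only [circuitAct_append] using this
  rintro m₂ - - ⟨L, h, H₂, h5, h3, -, hI⟩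
  have h0₂ : m₂.reg 0 = n := H₂.reg_zero
  have hle := hI.le
  refine Spec.assign (v := h₁ - h) (by simp only [Expr.Fits]; omega)
    (by simp only [Expr.eval, h0₂, h3, h5]; omega) le_rfl
    ⟨L, h₁, h, H₂.setReg (by decide), by simp [h3], by simp, hI⟩

end

section

/-! ### The algorithm -/

variable {n r : ℕ}

lemma inputMem_arr_zero (g : Fin r → PauliVec n) (l : Fin r) {j : ℕ} (hj : j < n + n) :
    (inputMem g).arr 0 (l * (n + n) + j) = pauliBit (g l) j := by
  have hdiv : ((l : ℕ) * (n + n) + j) / (2 * n) = l := by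
    rw [← two_mul] at hj ⊢
    rw [mul_comm (l : ℕ), Nat.mul_add_div (by omega), Nat.div_eq_of_lt hj, add_zero]
  have hmod : ((l : ℕ) * (n + n) + j) % (2 * n) = j := by
    rw [← two_mul] at hj ⊢
    rw [mul_comm (l : ℕ), Nat.mul_add_mod, Nat.mod_eq_of_lt hj]
  simp [inputMem, hdiv, hmod]

lemma run_inputMem (g : Fin r → PauliVec n) : Run g [] (inputMem g) where
  reg_zero := by simp [inputMem]
  reg_one := by simp [inputMem]
  reg_two := by simp [inputMem]
  xbit l p := by
    rw [inputMem_arr_zero g l (by omega), pauliBit, dif_pos p.2, circuitAct_nil]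
  zbit l p := by
    rw [inputMem_arr_zero g l (by omega), pauliBit, dif_neg (by omega), dif_pos (by omega),
      circuitAct_nil]
    simp
  code i hi := absurd hi (by simp)

/-- The exponent of the word bound and the constant of the running time; it is at least the sum of
the coefficients of the polynomial `mainTime`. -/
def algConst : ℕ := 2000

lemma mainTime_le (hn : n ≠ 0) (r : ℕ) : mainTime n r ≤ algConst * (n * r ^ 2 + 1) := by
  have h2 : n * r ≤ n * r ^ 2 := Nat.mul_le_mul_left _ (Nat.le_self_pow (by norm_num) r)
  have h3 : r ^ 2 ≤ n * r ^ 2 := Nat.le_mul_of_pos_left _ (Nat.pos_of_ne_zero hn)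
  have h1 : r ≤ r ^ 2 := Nat.le_self_pow (by norm_num) r
  have : mainTime n r = 462 * (n * r ^ 2) + 391 * (n * r) + 634 * r ^ 2 + 481 * r + 26 := by
    simp only [mainTime, pairTime, elimTime, sweepTime, gateTime]
    ring
  unfold algConst
  omega

lemma pow_algConst_bounds (n r : ℕ) :
    Fitting ((n + r + 2) ^ algConst) n r ∧
      3 * (r * (6 * n + 7)) + 3 < (n + r + 2) ^ algConst := by
  have h : 2 ^ 8 * (n + r + 2) ^ 2 ≤ (n + r + 2) ^ algConst :=
    calc 2 ^ 8 * (n + r + 2) ^ 2 ≤ (n + r + 2) ^ 8 * (n + r + 2) ^ 2 :=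
          Nat.mul_le_mul_right _ (Nat.pow_le_pow_left (by omega) 8)
      _ = (n + r + 2) ^ 10 := (pow_add _ 8 2).symm
      _ ≤ (n + r + 2) ^ algConst := Nat.pow_le_pow_right (by omega) (by unfold algConst; omega)
  have hsq : (n + r + 2) ^ 2 = n ^ 2 + r ^ 2 + 2 * (n * r) + 4 * n + 4 * r + 4 := by ring
  have h1 : r * (n + n) = 2 * (n * r) := by ring
  have h2 : r * (6 * n + 7) = 6 * (n * r) + 7 * r := by ring
  generalize (n + r + 2) ^ algConst = M at h
  refine ⟨⟨?_, ?_, ?_, ?_⟩, ?_⟩ <;> omega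

/-- The program outputs a circuit that standardizes the span of the input vectors. -/
lemma exists_exec_mainCmd (g : Fin r → PauliVec n) :
    ∃ (L : List (Gate n)) (a b t : ℕ) (m : Mem),
      Exec ((n + r + 2) ^ algConst) mainCmd (inputMem g) t m ∧ IsOutput m L a b ∧
      t ≤ algConst * (n * r ^ 2 + 1) ∧ a + b ≤ n ∧
      (Submodule.span (ZMod 2) (Set.range g)).map (circuitAct L) = blockLabels n a b := by
  have H := run_inputMem g
  obtain ⟨hM, hB⟩ := pow_algConst_bounds n r
  rcases eq_or_ne n 0 with rfl | hn
  · refine ⟨[], 0, 0, _, _, Exec.branch_false _ _ _ _ _ _ ?_ ?_ (.skip _), ?_, ?_, le_rfl,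
      Subsingleton.elim _ _⟩
    · have := hM.two
      have := H.reg_zero
      simp only [Expr.Fits]
      omega
    · simp only [Expr.eval, H.reg_zero]
    · exact ⟨H.reg_two, by simp [inputMem], by simp [inputMem], H.code⟩
    · simp [Expr.cost, algConst]
  · obtain ⟨t, m, hE, ht, L, h₁, h, hR, h3, h4, hZ⟩ := spec_mainCmd hn hM hB H
    have hle := hZ.le
    have hle' := hZ.le'
    refine ⟨L, n - h₁, h₁ - h, t, m, hE, ⟨hR.reg_two, h3, h4, hR.code⟩, ?_, by omega, ?_⟩
    · exact ht.trans (mainTime_le hn r)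
    · rw [Submodule.map_span, ← Set.range_comp]
      exact hZ.span_eq

/-- Every subspace of `𝔽₂²ⁿ` is standardized by some Clifford circuit. -/
lemma exists_map_eq_blockLabels (S : Submodule (ZMod 2) (PauliVec n)) :
    ∃ (L : List (Gate n)) (a b : ℕ), a + b ≤ n ∧ S.map (circuitAct L) = blockLabels n a b := by
  obtain ⟨r, g, hg⟩ := Submodule.fg_iff_exists_fin_generating_family.1 (IsNoetherian.noetherian S)
  obtain ⟨L, a, b, -, -, -, -, -, hab, h⟩ := exists_exec_mainCmd g
  exact ⟨L, a, b, hab, hg ▸ h⟩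

end

end PauliBD


theorem mainTheorem11 :
    ∃ (prog : PauliBD.Cmd) (c : ℕ),
      ∀ (n k r : ℕ) (g : Fin r → PauliBD.PauliVec n), r ≤ k →
        ∃ (circ : List (PauliBD.Gate n)) (a' b' t : ℕ) (m : PauliBD.Mem),
          PauliBD.Exec ((n + r + 2) ^ c) prog (PauliBD.inputMem g) t m ∧
          PauliBD.IsOutput m circ a' b' ∧
          t ≤ c * (n * k ^ 2 + 1) ∧
          ∀ (U : PauliBD.QMat n) (a b : ℕ) (S T : Submodule (ZMod 2) (PauliBD.PauliVec n)) (ε : ℝ),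
            U ∈ Matrix.unitaryGroup (PauliBD.Bits n) ℂ →
            PauliBD.IsPauliDimensional k U →
            S = PauliBD.supportSpan U →
            PauliBD.HasDecomposition a b S →
            T = Submodule.span (ZMod 2) (Set.range g) →
            T ≤ S →
            0 ≤ ε →
            PauliBD.pauliWeight U T ≥ 1 - ε ^ 2 / 2 ^ (a + b + 1) →
            a' + b' ≤ a + b ∧
            PauliBD.IsApproxBlockDiagonal a' b' ε
              (PauliBD.circuitMatrix circ * U * (PauliBD.circuitMatrix circ)ᴴ) := by
  refine ⟨PauliBD.mainCmd, PauliBD.algConst, fun n k r g hrk => ?_⟩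
  obtain ⟨L, a', b', t, m, hE, hout, ht, hab, hL⟩ := PauliBD.exists_exec_mainCmd g
  refine ⟨L, a', b', t, m, hE, hout, ht.trans (by gcongr), ?_⟩
  rintro U a b S T ε hU - hSU hS rfl hTS hε hw
  obtain ⟨L', a'', b'', hab', hL'⟩ := PauliBD.exists_map_eq_blockLabels S
  exact ⟨PauliBD.add_le_of_map_eq_blockLabels hab hS hTS hL,
    PauliBD.isApproxBlockDiagonal_of_weight hab hL hab' hL'
      (PauliBD.add_le_of_map_eq_blockLabels hab' hS le_rfl hL') hU hSU hTS hε hw⟩
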